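/- **Setting.** Let $n,p\ge 0$ be integers and let $M$ be a closed (compact, without boundary, not necessarily connected) smooth manifold of dimension $n$. Let $x:M\to\mathbb R^{n+p}$ be a smooth immersion, write $w^\perp$ for the projection of $w\in\mathbb R^{n+p}$ onto the normal space of the immersion at the point considered, and let $\mathbf H$ be the mean curvature vector, that is, the trace with respect to the induced metric of the second fundamental form. Suppose that $x$ is a self-shrinker, i.e. $\mathbf H=-x^\perp$ on $M$. **Proposition.** Suppose that at least one of the following conditions holds: 1. $n\ge 2$, $\mathbf H\neq 0$ everywhere on $M$, and the principal normal $\nu=\mathbf H/|\mathbf H|$ is parallel in the normal bundle ($\nabla^\perp\nu=0$); 2. $|\mathbf H|^2$ is constant on $M$, or $|\mathbf H|^2\le n$ on $M$, or $|\mathbf H|^2\ge n$ on $M$; 3. $|x|^2$ is constant on $M$, or $|x|^2\le n$ on $M$, or $|x|^2\ge n$ on $M$. Then $x$ is a minimal immersion of $M$ into the sphere $\mathbb S^{n+p-1}(\sqrt n)=\{y\in\mathbb R^{n+p}: |y|^2=n\}$: $x(M)$ lies in this sphere, and the mean curvature vector of $x$, as an immersion into the sphere, vanishes. -/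

import Mathlib

open scoped Manifold ContDiff

/-! A vector space carries its one-chart manifold structure; this line makes instance search find
it directly, not wrapped as a topological space from category theory. -/

attribute [local instance 2000] chartedSpaceSelf

noncomputable section

namespace SelfShrinker

/-!
Geometry of a smooth map `x : M → ℝᵐ`, where `M` is an `n`-dimensional manifold without boundary.
As everywhere in Mathlib, the tangent space `T_q M` is the model space `ℝⁿ`, identified with it
through the preferred chart at `q`.
-/

variable (n : ℕ) {m : ℕ} {M : Type*} [TopologicalSpace M]
  [ChartedSpace (EuclideanSpace ℝ (Fin n)) M]

/-- The differential `dx_q : T_q M → ℝᵐ`. -/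
def differential (x : M → EuclideanSpace ℝ (Fin m)) (q : M) :
    EuclideanSpace ℝ (Fin n) →L[ℝ] EuclideanSpace ℝ (Fin m) :=
  mfderiv (𝓡 n) (𝓡 m) x q

/-- `x` is a smooth immersion: it is `C^∞` and all its differentials are injective. -/
structure IsSmoothImmersion (x : M → EuclideanSpace ℝ (Fin m)) : Prop where
  contMDiff : ContMDiff (𝓡 n) (𝓡 m) ∞ x
  injective_differential : ∀ q : M, Function.Injective (differential n x q)

/-- The tangent space `dx_q (T_q M)` of the immersed manifold, as a subspace of `ℝᵐ`. -/
def tangentPlane (x : M → EuclideanSpace ℝ (Fin m)) (q : M) :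
    Submodule ℝ (EuclideanSpace ℝ (Fin m)) :=
  LinearMap.range (differential n x q).toLinearMap

/-- The normal space of the immersed manifold at `q`. -/
def normalPlane (x : M → EuclideanSpace ℝ (Fin m)) (q : M) :
    Submodule ℝ (EuclideanSpace ℝ (Fin m)) :=
  (tangentPlane n x q)ᗮ

/-- The projection `w ↦ w^⊥` of `ℝᵐ` onto the normal space at `q`. -/
def normalPart (x : M → EuclideanSpace ℝ (Fin m)) (q : M) (w : EuclideanSpace ℝ (Fin m)) :
    EuclideanSpace ℝ (Fin m) :=
  (normalPlane n x q).starProjection w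

/-- The second derivative at `q` of `x` read in the preferred chart at `q`; with coordinates
`u₁, …, uₙ` it sends `(∂ᵢ, ∂ⱼ)` to `∂²x / ∂uᵢ∂uⱼ`, the flat derivative of the vector field `dx ∂ⱼ`
in the direction `∂ᵢ`. A change of the chart alters it by a tangential vector only. -/
def secondDerivative (x : M → EuclideanSpace ℝ (Fin m)) (q : M) :
    EuclideanSpace ℝ (Fin n) →L[ℝ] EuclideanSpace ℝ (Fin n) →L[ℝ] EuclideanSpace ℝ (Fin m) :=
  fderiv ℝ (fderiv ℝ (x ∘ (extChartAt (𝓡 n) q).symm)) (extChartAt (𝓡 n) q q)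

/-- The second fundamental form of `x` in `ℝᵐ`: the normal part of the flat derivative. -/
def secondFundamentalForm (x : M → EuclideanSpace ℝ (Fin m)) (q : M)
    (u v : EuclideanSpace ℝ (Fin n)) : EuclideanSpace ℝ (Fin m) :=
  normalPart n x q (secondDerivative n x q u v)

/-- The induced metric `gᵢⱼ = ⟪dx ∂ᵢ, dx ∂ⱼ⟫` in the coordinates of the preferred chart at `q`. -/
def inducedMetric (x : M → EuclideanSpace ℝ (Fin m)) (q : M) : Matrix (Fin n) (Fin n) ℝ :=
  Matrix.of fun i j => inner ℝ (differential n x q (EuclideanSpace.single i 1))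
    (differential n x q (EuclideanSpace.single j 1))

/-- The trace `∑ gⁱʲ B(∂ᵢ, ∂ⱼ)` of a bilinear form `B` on `T_q M` with respect to the induced
metric, i.e. `∑ B(eᵢ, eᵢ)` for a basis `e₁, …, eₙ` of `T_q M` orthonormal in that metric. -/
def metricTrace (x : M → EuclideanSpace ℝ (Fin m)) (q : M)
    (B : EuclideanSpace ℝ (Fin n) → EuclideanSpace ℝ (Fin n) → EuclideanSpace ℝ (Fin m)) :
    EuclideanSpace ℝ (Fin m) :=
  ∑ i, ∑ j, (inducedMetric n x q)⁻¹ i j • B (EuclideanSpace.single i 1) (EuclideanSpace.single j 1)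

/-- The mean curvature vector `𝐇` (the trace, not the average) of `x` in `ℝᵐ`. -/
def meanCurvature (x : M → EuclideanSpace ℝ (Fin m)) (q : M) : EuclideanSpace ℝ (Fin m) :=
  metricTrace n x q (secondFundamentalForm n x q)

/-- A self-shrinker: a smooth immersion with `𝐇 = -x^⊥`. -/
structure IsSelfShrinker (x : M → EuclideanSpace ℝ (Fin m)) : Prop extends
    IsSmoothImmersion n x where
  meanCurvature_eq : ∀ q : M, meanCurvature n x q = -normalPart n x q (x q)

/-- The principal normal `ν = 𝐇 / |𝐇|`. -/
def principalNormal (x : M → EuclideanSpace ℝ (Fin m)) (q : M) : EuclideanSpace ℝ (Fin m) :=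
  ‖meanCurvature n x q‖⁻¹ • meanCurvature n x q

/-- The normal covariant derivative `∇^⊥_u ξ = (D_u ξ)^⊥` of a normal field `ξ` along `x`. -/
def normalDerivative (x ξ : M → EuclideanSpace ℝ (Fin m)) (q : M)
    (u : EuclideanSpace ℝ (Fin n)) : EuclideanSpace ℝ (Fin m) :=
  normalPart n x q (differential n ξ q u)

/-- `𝐇` vanishes nowhere and the principal normal is parallel in the normal bundle. -/
def HasParallelPrincipalNormal (x : M → EuclideanSpace ℝ (Fin m)) : Prop :=
  (∀ q : M, meanCurvature n x q ≠ 0) ∧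
    ∀ (q : M) (u : EuclideanSpace ℝ (Fin n)), normalDerivative n x (principalNormal n x) q u = 0

/-- The normal space at `q` of an immersion into a sphere centred at the origin, taken inside the
tangent space `{w | ⟪x q, w⟫ = 0}` of that sphere. -/
def sphereNormalPlane (x : M → EuclideanSpace ℝ (Fin m)) (q : M) :
    Submodule ℝ (EuclideanSpace ℝ (Fin m)) :=
  (Submodule.span ℝ {x q})ᗮ ⊓ normalPlane n x q

/-- The second fundamental form of an immersion into a sphere centred at the origin. The
Levi-Civita derivative of the sphere is the projection of the flat derivative onto the tangent
space of the sphere, so its part normal to `M` is the projection of the flat derivative onto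
the normal space of `M` in the sphere. -/
def sphereSecondFundamentalForm (x : M → EuclideanSpace ℝ (Fin m)) (q : M)
    (u v : EuclideanSpace ℝ (Fin n)) : EuclideanSpace ℝ (Fin m) :=
  (sphereNormalPlane n x q).starProjection (secondDerivative n x q u v)

/-- `x` is a minimal immersion into the sphere of radius `r` about the origin: a smooth
immersion with values in that sphere whose mean curvature vector in the sphere vanishes. -/
structure IsMinimalInSphere (x : M → EuclideanSpace ℝ (Fin m)) (r : ℝ) : Prop extends
    IsSmoothImmersion n x where
  mem_sphere : ∀ q : M, x q ∈ Metric.sphere (0 : EuclideanSpace ℝ (Fin m)) r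
  trace_eq_zero : ∀ q : M, metricTrace n x q (sphereSecondFundamentalForm n x q) = 0

end SelfShrinker

end

/-! Near a point q, parametrize M by orthogonal projection of x to the affine tangent plane at q
(`IsGraphParam`). The induced metric is Euclidean to first order at the origin, so the Laplacian at
q is the sum of the pure second partial derivatives. Write x^T for the tangential part of x. A
self-shrinker satisfies Δ|x|² = 2(n - |H|²) and Δ|x|² - ⟨x^T, ∇|x|²⟩ = 2(n - |x|²). By the second
formula, if |x|² is locally constant, its value is n. When |x|² = n everywhere, x is normal, so H =
-x is radial and the mean curvature in the sphere vanishes (`IsSelfShrinker.isMinimalInSphere`).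

It remains to make |x|² constant on each component. The strong maximum principle
(`eqOn_of_subsolution`, globalized in `eq_on_connectedComponent`) does this once |x|² or -|x|² is a
subsolution. The two formulas give that when |H|² ≤ n, |H|² ≥ n or |x|² ≥ n. If |x|² ≤ n, then |H|²
≤ n because |H| = |x^⊥|. If |H|² is constant, the second derivative test at a minimum of |x|² shows
|H|² ≤ n.

Suppose now that ν is parallel, with shape operator A. The components of the second fundamental form
orthogonal to ν are orthogonal to A (`IsShrinkerGerm.sum_A_mul_inner_eq_zero`), so Simons' identity
closes up as in codimension one: A and |H| both solve Δu - ⟨x^T, ∇u⟩ = (1 - |A|²)u. Hence τ = A/|H|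
solves a drift equation without zeroth-order term, and |τ|² is a subsolution with bounded drift, so
constant on components, so ∇τ = 0. The Codazzi equation and tr τ = 1 then leave two possibilities at
each point: ∇|H| = 0, or τ has rank one and |τ|² = 1. At a maximum of |x|² the Hessian test gives
|H|A ≥ Id, which for n ≥ 2 forces |τ|² < 1 there, hence on the whole component. So |H| is constant
on the component. The same maximum gives |H|² ≥ n, which is a case already treated. -/

namespace SelfShrinker

open Filter Topology

/-! ### Hopf's strong maximum principle in Euclidean space. -/

section MaximumPrinciple

variable {E : Type*} [NormedAddCommGroup E] [InnerProductSpace ℝ E]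

theorem hasDerivAt_fderiv_line {g : E → ℝ} {u : E} (hg : ContDiffAt ℝ 2 g u) (v : E) :
    (∀ᶠ s in 𝓝 (0 : ℝ), HasDerivAt (fun s => g (u + s • v)) (fderiv ℝ g (u + s • v) v) s) ∧
      HasDerivAt (fun s : ℝ => fderiv ℝ g (u + s • v) v) (fderiv ℝ (fderiv ℝ g) u v v) 0 := by
  have hline : ∀ s : ℝ, HasDerivAt (fun s : ℝ => u + s • v) v s := fun s => by
    simpa using ((hasDerivAt_id s).smul_const v).const_add u
  have htend : Tendsto (fun s : ℝ => u + s • v) (𝓝 0) (𝓝 u) := by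
    have := (hline 0).continuousAt.tendsto
    simpa using this
  constructor
  · have h1 : ∀ᶠ y in 𝓝 u, DifferentiableAt ℝ g y := by
      filter_upwards [hg.eventually (by simp)] with y hy
      exact hy.differentiableAt (by simp)
    filter_upwards [htend.eventually h1] with s hs
    exact hs.hasFDerivAt.comp_hasDerivAt s (hline s)
  · have h2 : DifferentiableAt ℝ (fderiv ℝ g) (u + (0 : ℝ) • v) := by
      simpa using (hg.fderiv_right (m := 1) (by norm_num)).differentiableAt (by simp)
    have h3 := h2.hasFDerivAt.comp_hasDerivAt 0 (hline 0)
    have h4 := h3.clm_apply (hasDerivAt_const (0 : ℝ) v)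
    simpa using h4

theorem fderiv_fderiv_nonpos_of_isLocalMax {g : E → ℝ} {u : E} (hg : ContDiffAt ℝ 2 g u)
    (hmax : IsLocalMax g u) (v : E) : fderiv ℝ (fderiv ℝ g) u v v ≤ 0 := by
  by_contra! hpos
  obtain ⟨h1, h2⟩ := hasDerivAt_fderiv_line hg v
  set γ : ℝ → ℝ := fun s => g (u + s • v) with hγ
  have hd : deriv γ =ᶠ[𝓝 0] fun s => fderiv ℝ g (u + s • v) v := by
    filter_upwards [h1] with s hs using hs.deriv
  have hdd : deriv (deriv γ) 0 = fderiv ℝ (fderiv ℝ g) u v v := by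
    rw [hd.deriv_eq, h2.deriv]
  have hc : ContinuousAt (fun s : ℝ => u + s • v) 0 := by fun_prop
  have hmaxγ : IsLocalMax γ 0 := by
    have h0 : Tendsto (fun s : ℝ => u + s • v) (𝓝 0) (𝓝 u) := by simpa using hc.tendsto
    have := h0.eventually hmax
    simpa [IsLocalMax, IsMaxFilter, hγ] using this
  -- A positive second derivative at the critical point would make it a local minimum as well as a
  -- maximum, so `γ` would be constant near 0 and its second derivative zero.
  have hminγ : IsLocalMin γ 0 :=
    isLocalMin_of_deriv_deriv_pos (hdd ▸ hpos) hmaxγ.deriv_eq_zero h1.self_of_nhds.continuousAt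
  have hconst : γ =ᶠ[𝓝 0] fun _ => γ 0 := by
    filter_upwards [hmaxγ, hminγ] with s hs hs' using le_antisymm hs hs'
  have : deriv (deriv γ) 0 = 0 := by
    rw [hconst.deriv.deriv_eq]; simp
  linarith

theorem fderiv_gaussian (α : ℝ) (y u : E) :
    HasFDerivAt (fun u => Real.exp (-α * ‖u - y‖ ^ 2))
      (Real.exp (-α * ‖u - y‖ ^ 2) • ((-2 * α) • innerSL ℝ (u - y))) u := by
  have h1 : HasFDerivAt (fun u : E => ‖u - y‖ ^ 2) (2 • innerSL ℝ (u - y)) u := by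
    simpa using ((hasFDerivAt_id u).sub_const y).norm_sq
  convert (h1.const_mul (-α)).exp using 2
  ext v; simp; ring

theorem fderiv_fderiv_gaussian (α : ℝ) (y u v : E) :
    fderiv ℝ (fderiv ℝ (fun u => Real.exp (-α * ‖u - y‖ ^ 2))) u v v =
      Real.exp (-α * ‖u - y‖ ^ 2) * (4 * α ^ 2 * (inner ℝ (u - y) v) ^ 2 - 2 * α * ‖v‖ ^ 2) := by
  have h1 : fderiv ℝ (fun u => Real.exp (-α * ‖u - y‖ ^ 2)) =
      fun u => Real.exp (-α * ‖u - y‖ ^ 2) • ((-2 * α) • innerSL ℝ (u - y)) := by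
    ext1 u; exact (fderiv_gaussian α y u).fderiv
  have h2 : HasFDerivAt (fun u : E => (-2 * α) • innerSL ℝ (u - y)) ((-2 * α) • innerSL ℝ) u :=
    (((innerSL ℝ).hasFDerivAt).comp u ((hasFDerivAt_id u).sub_const y)).const_smul (-2 * α)
  have h3 := ((fderiv_gaussian α y u).smul h2).fderiv
  rw [h1]
  erw [h3]
  have h4 : innerSL ℝ v v = ‖v‖ ^ 2 := real_inner_self_eq_norm_sq v
  simp [h4, inner_sub_left]
  ring

/-- Hopf's strong maximum principle. The second-order operator is given at every point by a frame
`e` and a drift `b`, which need only be bounded and uniformly elliptic. -/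
theorem eqOn_of_subsolution {ι : Type*} [Fintype ι] [FiniteDimensional ℝ E]
    {f : E → ℝ} {u₀ : E} {R lam Lam : ℝ}
    (hR : 0 < R) (hlam : 0 < lam) (hf : ∀ u ∈ Metric.ball u₀ R, ContDiffAt ℝ 2 f u)
    (hsub : ∀ u ∈ Metric.ball u₀ R, ∃ (e : ι → E) (b : E),
      (∀ v, lam * ‖v‖ ^ 2 ≤ ∑ k, (inner ℝ v (e k)) ^ 2) ∧ ∑ k, ‖e k‖ ^ 2 ≤ Lam ∧ ‖b‖ ≤ Lam ∧
      0 ≤ ∑ k, fderiv ℝ (fderiv ℝ f) u (e k) (e k) + fderiv ℝ f u b)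
    (hmax : ∀ u ∈ Metric.ball u₀ R, f u ≤ f u₀) :
    ∀ u ∈ Metric.ball u₀ (R / 3), f u = f u₀ := by
  intro u₁ hu₁
  by_contra hne
  have hu₀ : u₀ ∈ Metric.ball u₀ R := Metric.mem_ball_self hR
  have hcont : ContinuousOn f (Metric.ball u₀ R) := fun u hu =>
    (hf u hu).continuousAt.continuousWithinAt
  have hsubset : Metric.closedBall u₀ (2 * R / 3) ⊆ Metric.ball u₀ R :=
    Metric.closedBall_subset_ball (by linarith)
  have hd₁ : dist u₁ u₀ < R / 3 := hu₁
  have hu₁R : u₁ ∈ Metric.ball u₀ R := by rw [Metric.mem_ball]; linarith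
  -- The maximum set, cut off to be compact. As `u₁` is within `R / 3` of `u₀`, every point closer
  -- to `u₁` than the nearest point `z` of `Z` still lies in the ball of radius `2 * R / 3`, so the
  -- cut-off loses nothing.
  set Z := Metric.closedBall u₀ (2 * R / 3) ∩ f ⁻¹' {f u₀} with hZ
  have hZc : IsCompact Z := by
    refine (isCompact_closedBall u₀ (2 * R / 3)).of_isClosed_subset ?_ Set.inter_subset_left
    exact (hcont.mono hsubset).preimage_isClosed_of_isClosed Metric.isClosed_closedBall
      isClosed_singleton
  have hu₀Z : u₀ ∈ Z := ⟨Metric.mem_closedBall_self (by linarith), rfl⟩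
  obtain ⟨z, hzZ, hzmin⟩ := hZc.exists_isMinOn ⟨u₀, hu₀Z⟩
    (continuous_const.dist continuous_id : Continuous fun z => dist u₁ z).continuousOn
  have hzmin' : ∀ w ∈ Z, dist u₁ z ≤ dist u₁ w := fun w hw => hzmin hw
  have hfz : f z = f u₀ := hzZ.2
  set d := dist u₁ z with hd
  have hdpos : 0 < d := by
    rw [hd, dist_pos]; rintro rfl; exact hne hfz
  have hdR : d < R / 3 := (hzmin' u₀ hu₀Z).trans_lt hd₁
  have hfar : ∀ w ∈ Metric.ball u₀ R, dist u₁ w < d → f w < f u₀ := by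
    intro w hw hwd
    refine lt_of_le_of_ne (hmax w hw) fun hw' => ?_
    have hwR : dist w u₀ ≤ 2 * R / 3 := by
      linarith [dist_triangle w u₁ u₀, dist_comm u₁ w]
    exact absurd (hzmin' w ⟨hwR, hw'⟩) (not_le.2 hwd)
  have hzu₀ : dist z u₀ < 2 * R / 3 := by
    linarith [dist_triangle z u₁ u₀, dist_comm u₁ z]
  -- a ball touching the maximum set at `z` only
  set y : E := (2⁻¹ : ℝ) • (u₁ + z) with hy
  -- With `y` the midpoint of `u₁` and `z`, this shows that the closed ball of radius `d / 2` about
  -- `y` lies in the open ball of radius `d` about `u₁`, except for the point `z`.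
  have hpar : ∀ u : E, ‖u - u₁‖ ^ 2 + ‖u - z‖ ^ 2 = 2 * ‖u - y‖ ^ 2 + d ^ 2 / 2 := by
    intro u
    have h1 : u - u₁ = (u - y) - (2⁻¹ : ℝ) • (u₁ - z) := by rw [hy]; module
    have h2 : u - z = (u - y) + (2⁻¹ : ℝ) • (u₁ - z) := by rw [hy]; module
    rw [h1, h2, @norm_sub_sq_real, @norm_add_sq_real, hd, dist_eq_norm, norm_smul]
    norm_num
    ring
  have hzy : ‖z - y‖ = d / 2 := by
    have h1 : z - y = (2⁻¹ : ℝ) • (z - u₁) := by rw [hy]; module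
    rw [h1, norm_smul, hd, dist_eq_norm, norm_sub_rev u₁ z]; norm_num; ring
  set δ := min (R / 3) (d / 4) with hδ
  have hδpos : 0 < δ := lt_min (by linarith) (by linarith)
  have hδR : δ ≤ R / 3 := min_le_left _ _
  have hδd : δ ≤ d / 4 := min_le_right _ _
  have hball : Metric.closedBall z δ ⊆ Metric.ball u₀ R := fun u hu => by
    rw [Metric.mem_closedBall] at hu
    rw [Metric.mem_ball]
    linarith [dist_triangle u z u₀]
  have hlow : ∀ u ∈ Metric.closedBall z δ, d / 4 ≤ ‖u - y‖ := fun u hu => by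
    rw [Metric.mem_closedBall, dist_eq_norm] at hu
    have := norm_sub_norm_le (z - y) (z - u)
    rw [show z - y - (z - u) = u - y by abel, norm_sub_rev z u] at this
    linarith
  have hupp : ∀ u ∈ Metric.closedBall z δ, ‖u - y‖ ≤ d := fun u hu => by
    rw [Metric.mem_closedBall, dist_eq_norm] at hu
    have := norm_add_le (u - z) (z - y)
    rw [show u - z + (z - y) = u - y by abel] at this
    linarith
  have hLam : 0 ≤ Lam := by
    obtain ⟨e, b, -, -, hb, -⟩ := hsub u₀ hu₀
    exact (norm_nonneg b).trans hb
  -- Near `z` one has `d / 4 ≤ ‖u - y‖ ≤ d`. This `α` makes the elliptic term of the Gaussian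
  -- barrier exceed the trace term, at most `Lam`, and the drift term, at most `d * Lam`, by at
  -- least 1.
  set α := (Lam + d * Lam + 1) / (2 * lam * (d / 4) ^ 2) with hα
  have hαpos : 0 < α := by positivity
  have hαeq : 2 * α * lam * (d / 4) ^ 2 = Lam + d * Lam + 1 := by
    rw [hα]; field_simp
  set w : E → ℝ := fun u => Real.exp (-α * ‖u - y‖ ^ 2) with hw
  have hwC : ContDiff ℝ 2 w := by
    have : ContDiff ℝ 2 fun u : E => ‖u - y‖ ^ 2 := (contDiff_id.sub contDiff_const).norm_sq ℝ
    exact (contDiff_const.mul this).exp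
  have hw1 : ∀ u, w u ≤ 1 := fun u => by
    rw [hw]; simp only [Real.exp_le_one_iff]; nlinarith [sq_nonneg ‖u - y‖]
  have hwpos : ∀ u, 0 < w u := fun u => Real.exp_pos _
  have hkey : ∀ u ∈ Metric.closedBall z δ, ∀ (e : ι → E) (b : E),
      (∀ v, lam * ‖v‖ ^ 2 ≤ ∑ k, (inner ℝ v (e k)) ^ 2) → ∑ k, ‖e k‖ ^ 2 ≤ Lam → ‖b‖ ≤ Lam →
      0 < ∑ k, fderiv ℝ (fderiv ℝ w) u (e k) (e k) + fderiv ℝ w u b := by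
    intro u hu e b he1 he2 hb
    have hsum : ∑ k, fderiv ℝ (fderiv ℝ w) u (e k) (e k) + fderiv ℝ w u b =
        w u * (2 * α) * (2 * α * ∑ k, (inner ℝ (u - y) (e k)) ^ 2 - ∑ k, ‖e k‖ ^ 2
          - inner ℝ (u - y) b) := by
      rw [hw, (fderiv_gaussian α y u).fderiv]
      simp only [fderiv_fderiv_gaussian, ← Finset.mul_sum, Finset.sum_sub_distrib]
      simp [inner_sub_left]
      ring
    rw [hsum]
    have h1 := he1 (u - y)
    have h2 : inner ℝ (u - y) b ≤ d * Lam :=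
      (real_inner_le_norm _ _).trans (mul_le_mul (hupp u hu) hb (norm_nonneg _) hdpos.le)
    have h3 : (d / 4) ^ 2 ≤ ‖u - y‖ ^ 2 := pow_le_pow_left₀ (by positivity) (hlow u hu) 2
    have h4 : Lam + d * Lam + 1 ≤ 2 * α * ∑ k, (inner ℝ (u - y) (e k)) ^ 2 := by
      rw [← hαeq, mul_assoc]
      refine mul_le_mul_of_nonneg_left (le_trans ?_ h1) (by positivity)
      exact mul_le_mul_of_nonneg_left h3 hlam.le
    have := hwpos u
    apply mul_pos (by positivity)
    linarith
  -- on the small sphere `f + ε w` is smaller than at the centre `z`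
  have hS : IsCompact (Metric.sphere z δ ∩ {u | ‖u - y‖ ≤ d / 2}) :=
    (isCompact_sphere z δ).inter_right (isClosed_le (by fun_prop) continuous_const)
  have hSlt : ∀ u ∈ Metric.sphere z δ ∩ {u | ‖u - y‖ ≤ d / 2}, f u < f u₀ := by
    rintro u ⟨hu1, hu2⟩
    refine hfar u (hball (Metric.sphere_subset_closedBall hu1)) ?_
    rw [dist_comm, dist_eq_norm]
    have h1 := hpar u
    have h2 : ‖u - z‖ = δ := by rw [← dist_eq_norm]; exact hu1
    replace hu2 : ‖u - y‖ ≤ d / 2 := hu2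
    have h3 : ‖u - y‖ ^ 2 ≤ (d / 2) ^ 2 := pow_le_pow_left₀ (norm_nonneg _) hu2 2
    have h4 : ‖u - u₁‖ ^ 2 < d ^ 2 := by rw [h2] at h1; nlinarith [pow_pos hδpos 2]
    exact lt_of_pow_lt_pow_left₀ 2 hdpos.le h4
  obtain ⟨η, hη, hSη⟩ : ∃ η > 0, ∀ u ∈ Metric.sphere z δ ∩ {u | ‖u - y‖ ≤ d / 2},
      f u < f u₀ - η := by
    rcases (Metric.sphere z δ ∩ {u | ‖u - y‖ ≤ d / 2}).eq_empty_or_nonempty with h | h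
    · exact ⟨1, one_pos, by simp [h]⟩
    · obtain ⟨a, ha, ha'⟩ := hS.exists_isMaxOn h (hcont.mono fun u hu =>
        hball (Metric.sphere_subset_closedBall hu.1))
      refine ⟨(f u₀ - f a) / 2, by linarith [hSlt a ha], fun u hu => ?_⟩
      have : f u ≤ f a := ha' hu
      linarith [hSlt a ha]
  -- On the part of the sphere inside the touching ball, `f` drops by `η` while `w ≤ 1`. On the part
  -- outside, `f` is at most its maximum and `w` is smaller than at `z`. So the perturbed function
  -- has an interior maximum, where its operator is both nonpositive and positive.
  have hsphere : ∀ u ∈ Metric.sphere z δ, f u + η * w u < f z + η * w z := by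
    intro u hu
    by_cases h : ‖u - y‖ ≤ d / 2
    · have h1 := hSη u ⟨hu, h⟩
      rw [hfz]
      nlinarith [hw1 u, hwpos z]
    · have h1 := hmax u (hball (Metric.sphere_subset_closedBall hu))
      have h2 : w u < w z := by
        rw [hw]
        simp only [Real.exp_lt_exp, hzy]
        have : (d / 2) ^ 2 < ‖u - y‖ ^ 2 :=
          pow_lt_pow_left₀ (not_le.1 h) (by positivity) two_ne_zero
        nlinarith
      rw [hfz]
      nlinarith
  obtain ⟨a, ha, hamax⟩ := (isCompact_closedBall z δ).exists_isMaxOn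
    ⟨z, Metric.mem_closedBall_self hδpos.le⟩
    ((hcont.mono hball).add (hwC.continuous.const_mul η |>.continuousOn) :
      ContinuousOn (fun u => f u + η * w u) _)
  have haball : a ∈ Metric.ball z δ := by
    rcases (Metric.mem_closedBall.1 ha).lt_or_eq with h | h
    · exact h
    · have h1 : f z + η * w z ≤ f a + η * w a := hamax (Metric.mem_closedBall_self hδpos.le)
      exact absurd (hsphere a h) (not_lt.2 h1)
  have hloc : IsLocalMax (fun u => f u + η * w u) a := by
    filter_upwards [Metric.isOpen_ball.mem_nhds haball] with u hu
    exact hamax (Metric.ball_subset_closedBall hu)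
  have hfa := hf a (hball ha)
  have hwa : ContDiffAt ℝ 2 w a := hwC.contDiffAt
  have hgC : ContDiffAt ℝ 2 (fun u => f u + η * w u) a := hfa.add (contDiffAt_const.mul hwa)
  have hderiv : ∀ᶠ u in 𝓝 a, fderiv ℝ (fun u => f u + η * w u) u =
      fderiv ℝ f u + η • fderiv ℝ w u := by
    filter_upwards [hfa.eventually (by simp)] with u hu
    exact ((hu.differentiableAt (by simp)).hasFDerivAt.add
      ((hwC.differentiable (by simp) u).hasFDerivAt.const_mul η)).fderiv
  have hdderiv : fderiv ℝ (fderiv ℝ fun u => f u + η * w u) a =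
      fderiv ℝ (fderiv ℝ f) a + η • fderiv ℝ (fderiv ℝ w) a := by
    rw [Filter.EventuallyEq.fderiv_eq hderiv]
    exact (((hfa.fderiv_right (m := 1) (by norm_num)).differentiableAt (by simp)).hasFDerivAt.add
      (((hwa.fderiv_right (m := 1) (by norm_num)).differentiableAt (by simp)).hasFDerivAt.const_smul
        η)).fderiv
  have h0 : fderiv ℝ f a + η • fderiv ℝ w a = 0 := by
    rw [← hderiv.self_of_nhds]; exact hloc.fderiv_eq_zero
  obtain ⟨e, b, he1, he2, hb, hge⟩ := hsub a (hball ha)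
  have hk := hkey a ha e b he1 he2 hb
  have h1 : ∑ k, (fderiv ℝ (fderiv ℝ f) a (e k) (e k) +
      η * fderiv ℝ (fderiv ℝ w) a (e k) (e k)) ≤ 0 := by
    refine Finset.sum_nonpos fun k _ => ?_
    have := fderiv_fderiv_nonpos_of_isLocalMax hgC hloc (e k)
    rw [hdderiv] at this
    simpa using this
  have h2 : fderiv ℝ f a b + η * fderiv ℝ w a b = 0 := by
    simpa using congrArg (fun L => L b) h0
  rw [Finset.sum_add_distrib, ← Finset.mul_sum] at h1
  nlinarith

end MaximumPrinciple

/-! ### Partial derivatives of germs: rules that hold on a neighbourhood, so that they can be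
differentiated again. -/

section PartialDerivatives

theorem two_le_infty : (2 : WithTop ℕ∞) ≤ ∞ :=
  WithTop.coe_le_coe.2 (le_top : (2 : ℕ∞) ≤ ⊤)

variable {n : ℕ} {V : Type*} [NormedAddCommGroup V]

/-- The partial derivative in the `i`-th coordinate direction. -/
noncomputable def pd [NormedSpace ℝ V] (i : Fin n) (f : EuclideanSpace ℝ (Fin n) → V) :
    EuclideanSpace ℝ (Fin n) → V :=
  fun w => fderiv ℝ f w (EuclideanSpace.single i 1)

section Normed

variable [NormedSpace ℝ V] {f g : EuclideanSpace ℝ (Fin n) → V} {w : EuclideanSpace ℝ (Fin n)}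

theorem contDiffAt_pd (i : Fin n) (hf : ContDiffAt ℝ ∞ f w) : ContDiffAt ℝ ∞ (pd i f) w :=
  (hf.fderiv_right (m := ∞) (by simp)).clm_apply contDiffAt_const

theorem eventually_differentiableAt (hf : ContDiffAt ℝ ∞ f w) :
    ∀ᶠ y in 𝓝 w, DifferentiableAt ℝ f y := by
  have h1 : ContDiffAt ℝ 1 f w := hf.of_le (by simp)
  filter_upwards [h1.eventually (by simp)] with y hy
  exact hy.differentiableAt (by simp)

theorem pd_congr (i : Fin n) (h : f =ᶠ[𝓝 w] g) : pd i f =ᶠ[𝓝 w] pd i g := by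
  filter_upwards [h.fderiv (𝕜 := ℝ)] with y hy
  simp [pd, hy]

theorem pd_const (i : Fin n) (c : V) :
    pd i (fun _ : EuclideanSpace ℝ (Fin n) => c) = fun _ => 0 := by
  ext1 w; simp [pd]

theorem pd_coord (i k : Fin n) :
    pd i (fun w : EuclideanSpace ℝ (Fin n) => w k) = fun _ => if k = i then 1 else 0 := by
  ext1 w
  have : HasFDerivAt (fun w : EuclideanSpace ℝ (Fin n) => w k)
      (EuclideanSpace.proj k : EuclideanSpace ℝ (Fin n) →L[ℝ] ℝ) w :=
    (EuclideanSpace.proj k : EuclideanSpace ℝ (Fin n) →L[ℝ] ℝ).hasFDerivAt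
  simp [pd, this.fderiv, eq_comm]

theorem pd_add (i : Fin n) (hf : ContDiffAt ℝ ∞ f w) (hg : ContDiffAt ℝ ∞ g w) :
    pd i (fun y => f y + g y) =ᶠ[𝓝 w] fun y => pd i f y + pd i g y := by
  filter_upwards [eventually_differentiableAt hf, eventually_differentiableAt hg] with y h1 h2
  simp [pd, fderiv_fun_add h1 h2]

theorem pd_neg (i : Fin n) : pd i (fun y => -f y) = fun y => -pd i f y := by
  ext1 y; simp [pd, fderiv_fun_neg]

theorem pd_sum {ι : Type*} (s : Finset ι) {F : ι → EuclideanSpace ℝ (Fin n) → V} (i : Fin n)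
    (hF : ∀ k ∈ s, ContDiffAt ℝ ∞ (F k) w) :
    pd i (fun y => ∑ k ∈ s, F k y) =ᶠ[𝓝 w] fun y => ∑ k ∈ s, pd i (F k) y := by
  have : ∀ᶠ y in 𝓝 w, ∀ k ∈ s, DifferentiableAt ℝ (F k) y :=
    (Filter.eventually_all_finset s).2 fun k hk => eventually_differentiableAt (hF k hk)
  filter_upwards [this] with y hy
  simp [pd, fderiv_fun_sum hy]

theorem pd_smul {a : EuclideanSpace ℝ (Fin n) → ℝ} (i : Fin n) (ha : ContDiffAt ℝ ∞ a w)
    (hf : ContDiffAt ℝ ∞ f w) :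
    pd i (fun y => a y • f y) =ᶠ[𝓝 w] fun y => pd i a y • f y + a y • pd i f y := by
  filter_upwards [eventually_differentiableAt ha, eventually_differentiableAt hf] with y h1 h2
  simp [pd, fderiv_fun_smul h1 h2, add_comm]

theorem pd_mul {a b : EuclideanSpace ℝ (Fin n) → ℝ} (i : Fin n) (ha : ContDiffAt ℝ ∞ a w)
    (hb : ContDiffAt ℝ ∞ b w) :
    pd i (fun y => a y * b y) =ᶠ[𝓝 w] fun y => pd i a y * b y + a y * pd i b y :=
  pd_smul i ha hb

theorem pd_pd_eq (hf : ContDiffAt ℝ 2 f w) (i j : Fin n) :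
    pd i (pd j f) w =
      fderiv ℝ (fderiv ℝ f) w (EuclideanSpace.single i 1) (EuclideanSpace.single j 1) := by
  have h1 : DifferentiableAt ℝ (fderiv ℝ f) w :=
    (hf.fderiv_right (m := 1) (by norm_num)).differentiableAt (by simp)
  have h2 := h1.hasFDerivAt.clm_apply
    (hasFDerivAt_const (EuclideanSpace.single j (1 : ℝ) : EuclideanSpace ℝ (Fin n)) w)
  change fderiv ℝ (fun y => fderiv ℝ f y (EuclideanSpace.single j 1)) w _ = _
  rw [h2.fderiv]
  simp

theorem pd_comm (hf : ContDiffAt ℝ ∞ f w) (i j : Fin n) :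
    pd i (pd j f) =ᶠ[𝓝 w] pd j (pd i f) := by
  have h2 : ContDiffAt ℝ 2 f w := hf.of_le two_le_infty
  filter_upwards [h2.eventually (by simp)] with y hy
  rw [pd_pd_eq hy, pd_pd_eq hy]
  exact hy.isSymmSndFDerivAt (by simp) _ _

theorem pd_pd_mul {a b : EuclideanSpace ℝ (Fin n) → ℝ} (i j : Fin n) (ha : ContDiffAt ℝ ∞ a w)
    (hb : ContDiffAt ℝ ∞ b w) :
    pd j (pd i (fun y => a y * b y)) =ᶠ[𝓝 w] fun y =>
      pd j (pd i a) y * b y + pd i a y * pd j b y +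
        (pd j a y * pd i b y + a y * pd j (pd i b) y) := by
  refine (pd_congr j (pd_mul i ha hb)).trans ?_
  have h1 := contDiffAt_pd i ha
  have h2 := contDiffAt_pd i hb
  refine (pd_add j (h1.mul hb) (ha.mul h2)).trans ?_
  filter_upwards [pd_mul j h1 hb, pd_mul j ha h2] with y e1 e2
  rw [e1, e2]

theorem pd_pd_add {f g : EuclideanSpace ℝ (Fin n) → V} (i j : Fin n) (hf : ContDiffAt ℝ ∞ f w)
    (hg : ContDiffAt ℝ ∞ g w) :
    pd j (pd i (fun y => f y + g y)) =ᶠ[𝓝 w] fun y => pd j (pd i f) y + pd j (pd i g) y :=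
  (pd_congr j (pd_add i hf hg)).trans (pd_add j (contDiffAt_pd i hf) (contDiffAt_pd i hg))

theorem pd_pd_sum {ι : Type*} (s : Finset ι) {F : ι → EuclideanSpace ℝ (Fin n) → V} (i j : Fin n)
    (hF : ∀ k ∈ s, ContDiffAt ℝ ∞ (F k) w) :
    pd j (pd i (fun y => ∑ k ∈ s, F k y)) =ᶠ[𝓝 w] fun y => ∑ k ∈ s, pd j (pd i (F k)) y :=
  (pd_congr j (pd_sum s i hF)).trans (pd_sum s j fun k hk => contDiffAt_pd i (hF k hk))

end Normed

section Inner

variable [InnerProductSpace ℝ V] {f g : EuclideanSpace ℝ (Fin n) → V}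
  {w : EuclideanSpace ℝ (Fin n)}

theorem pd_inner (i : Fin n) (hf : ContDiffAt ℝ ∞ f w) (hg : ContDiffAt ℝ ∞ g w) :
    pd i (fun y => inner ℝ (f y) (g y)) =ᶠ[𝓝 w]
      fun y => inner ℝ (pd i f y) (g y) + inner ℝ (f y) (pd i g y) := by
  filter_upwards [eventually_differentiableAt hf, eventually_differentiableAt hg] with y h1 h2
  simp only [pd]
  rw [fderiv_inner_apply ℝ h1 h2, add_comm]

theorem pd_inner_const (i : Fin n) (hf : ContDiffAt ℝ ∞ f w) (c : V) :
    pd i (fun y => inner ℝ (f y) c) =ᶠ[𝓝 w] fun y => inner ℝ (pd i f y) c := by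
  refine (pd_inner i hf contDiffAt_const).trans ?_
  simp [pd_const]

theorem pd_pd_inner (i j : Fin n) (hf : ContDiffAt ℝ ∞ f w) (hg : ContDiffAt ℝ ∞ g w) :
    pd j (pd i (fun y => inner ℝ (f y) (g y))) =ᶠ[𝓝 w] fun y =>
      inner ℝ (pd j (pd i f) y) (g y) + inner ℝ (pd i f y) (pd j g y) +
        (inner ℝ (pd j f y) (pd i g y) + inner ℝ (f y) (pd j (pd i g) y)) := by
  refine (pd_congr j (pd_inner i hf hg)).trans ?_
  have h1 := contDiffAt_pd i hf
  have h2 := contDiffAt_pd i hg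
  refine (pd_add j (h1.inner ℝ hg) (hf.inner ℝ h2)).trans ?_
  filter_upwards [pd_inner j h1 hg, pd_inner j hf h2] with y e1 e2
  rw [e1, e2]

theorem pd_pd_inner_const (i j : Fin n) (hf : ContDiffAt ℝ ∞ f w) (c : V) :
    pd j (pd i (fun y => inner ℝ (f y) c)) =ᶠ[𝓝 w] fun y => inner ℝ (pd j (pd i f) y) c :=
  (pd_congr j (pd_inner_const i hf c)).trans (pd_inner_const j (contDiffAt_pd i hf) c)

end Inner

end PartialDerivatives

/-- A self-shrinker with parallel principal normal near a point, written in coordinates in which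
the tangential part of the position vector `Y`, along the isometry `ι` onto the tangent plane at
the origin, is the coordinate vector. Here `ν` is the principal normal, `H` its length, `A` the
shape operator of `ν`, `t` the tangential part of `Y`, and `G` the inverse metric. -/
structure IsShrinkerGerm {n : ℕ} {V : Type*} [NormedAddCommGroup V] [InnerProductSpace ℝ V]
    (Y ν : EuclideanSpace ℝ (Fin n) → V) (H : EuclideanSpace ℝ (Fin n) → ℝ)
    (A : Fin n → Fin n → EuclideanSpace ℝ (Fin n) → ℝ)
    (t : Fin n → EuclideanSpace ℝ (Fin n) → ℝ)
    (G : Fin n → Fin n → EuclideanSpace ℝ (Fin n) → ℝ)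
    (ι : EuclideanSpace ℝ (Fin n) →ₗᵢ[ℝ] V) : Prop where
  smooth_Y : ContDiffAt ℝ ∞ Y 0
  smooth_ν : ContDiffAt ℝ ∞ ν 0
  smooth_H : ContDiffAt ℝ ∞ H 0
  smooth_A : ∀ k i, ContDiffAt ℝ ∞ (A k i) 0
  smooth_t : ∀ k, ContDiffAt ℝ ∞ (t k) 0
  smooth_G : ∀ i j, ContDiffAt ℝ ∞ (G i j) 0
  graph : ∃ c : Fin n → ℝ, ∀ᶠ w in 𝓝 (0 : EuclideanSpace ℝ (Fin n)), ∀ k,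
    inner ℝ (Y w) (ι (EuclideanSpace.single k 1)) = w k + c k
  tangent : ∀ k, pd k Y 0 = ι (EuclideanSpace.single k 1)
  unit : ∀ᶠ w in 𝓝 0, inner ℝ (ν w) (ν w) = 1
  perp : ∀ᶠ w in 𝓝 0, ∀ k, inner ℝ (pd k Y w) (ν w) = 0
  weingarten : ∀ᶠ w in 𝓝 0, ∀ i, pd i ν w = -∑ k, A k i w • pd k Y w
  shrinker : ∀ᶠ w in 𝓝 0, Y w + H w • ν w = ∑ k, t k w • pd k Y w
  inverse : ∀ᶠ w in 𝓝 0, ∀ i k,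
    ∑ j, G i j w * inner ℝ (pd j Y w) (pd k Y w) = if i = k then 1 else 0
  mean : ∀ᶠ w in 𝓝 0, ∑ i, ∑ j, G i j w • pd i (pd j Y) w =
    H w • ν w + ∑ k, (H w * -inner ℝ (ν w) (ι (EuclideanSpace.single k 1))) • pd k Y w
  trace : ∀ᶠ w in 𝓝 0, H w = ∑ k, A k k w
  pos : 0 < H 0

/-! ### Gauss, Codazzi and Ricci equations in graph coordinates. -/

namespace IsShrinkerGerm

variable {n : ℕ} {V : Type*} [NormedAddCommGroup V] [InnerProductSpace ℝ V]
  {Y ν : EuclideanSpace ℝ (Fin n) → V} {H : EuclideanSpace ℝ (Fin n) → ℝ}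
  {A : Fin n → Fin n → EuclideanSpace ℝ (Fin n) → ℝ}
  {t : Fin n → EuclideanSpace ℝ (Fin n) → ℝ}
  {G : Fin n → Fin n → EuclideanSpace ℝ (Fin n) → ℝ}
  {ι : EuclideanSpace ℝ (Fin n) →ₗᵢ[ℝ] V}

theorem inner_map_single (ι : EuclideanSpace ℝ (Fin n) →ₗᵢ[ℝ] V) (i j : Fin n) :
    inner ℝ (ι (EuclideanSpace.single i 1)) (ι (EuclideanSpace.single j 1)) =
      if i = j then (1 : ℝ) else 0 := by
  rw [ι.inner_map_map]
  simp [EuclideanSpace.inner_single_left]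

variable (S : IsShrinkerGerm Y ν H A t G ι)
include S

theorem inner_pd (i l : Fin n) :
    (fun w => inner ℝ (pd i Y w) (ι (EuclideanSpace.single l 1))) =ᶠ[𝓝 0]
      fun _ => if l = i then (1 : ℝ) else 0 := by
  obtain ⟨c, hc⟩ := S.graph
  have h1 : (fun w => inner ℝ (Y w) (ι (EuclideanSpace.single l 1))) =ᶠ[𝓝 0]
      fun w => w l + c l := hc.mono fun w hw => hw l
  have h2 := pd_congr i h1
  have h3 : ContDiffAt ℝ ∞ (fun w : EuclideanSpace ℝ (Fin n) => w l) 0 := by fun_prop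
  refine (pd_inner_const i S.smooth_Y _).symm.trans (h2.trans ?_)
  refine (pd_add i h3 contDiffAt_const).trans ?_
  simp [pd_coord, pd_const]

/-- The component of `Y` along the fixed tangent plane is affine in the coordinates. So all higher
derivatives of `Y` are orthogonal to that plane on a neighbourhood; in particular the Christoffel
symbols vanish at the origin. -/
theorem inner_pd_pd (i j l : Fin n) :
    (fun w => inner ℝ (pd j (pd i Y) w) (ι (EuclideanSpace.single l 1))) =ᶠ[𝓝 0]
      fun _ => (0 : ℝ) := by
  refine (pd_inner_const j (contDiffAt_pd i S.smooth_Y) _).symm.trans ?_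
  refine (pd_congr j (S.inner_pd i l)).trans ?_
  rw [pd_const]

theorem inner_pd_pd_zero (i j l : Fin n) :
    inner ℝ (pd j (pd i Y) 0) (ι (EuclideanSpace.single l 1)) = (0 : ℝ) :=
  (S.inner_pd_pd i j l).self_of_nhds

theorem inner_pd_pd_pd (i j k l : Fin n) :
    (fun w => inner ℝ (pd k (pd j (pd i Y)) w) (ι (EuclideanSpace.single l 1))) =ᶠ[𝓝 0]
      fun _ => (0 : ℝ) := by
  refine (pd_inner_const k (contDiffAt_pd j (contDiffAt_pd i S.smooth_Y)) _).symm.trans ?_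
  refine (pd_congr k (S.inner_pd_pd i j l)).trans ?_
  rw [pd_const]

theorem inner_pd_pd_pd_zero (i j k l : Fin n) :
    inner ℝ (pd k (pd j (pd i Y)) 0) (ι (EuclideanSpace.single l 1)) = (0 : ℝ) :=
  (S.inner_pd_pd_pd i j k l).self_of_nhds

theorem smooth_metric (i j : Fin n) :
    ContDiffAt ℝ ∞ (fun w => inner ℝ (pd i Y w) (pd j Y w)) 0 :=
  (contDiffAt_pd i S.smooth_Y).inner ℝ (contDiffAt_pd j S.smooth_Y)

theorem metric_zero (i j : Fin n) :
    inner ℝ (pd i Y 0) (pd j Y 0) = if i = j then (1 : ℝ) else 0 := by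
  rw [S.tangent, S.tangent, inner_map_single]

theorem pd_metric (i j l : Fin n) :
    pd l (fun w => inner ℝ (pd i Y w) (pd j Y w)) 0 = 0 := by
  rw [(pd_inner l (contDiffAt_pd i S.smooth_Y) (contDiffAt_pd j S.smooth_Y)).self_of_nhds]
  beta_reduce
  rw [S.tangent, S.tangent, S.inner_pd_pd_zero, real_inner_comm, S.inner_pd_pd_zero, add_zero]

theorem pd_pd_metric (i j l m : Fin n) :
    pd m (pd l (fun w => inner ℝ (pd i Y w) (pd j Y w))) 0 =
      inner ℝ (pd l (pd i Y) 0) (pd m (pd j Y) 0) +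
        inner ℝ (pd m (pd i Y) 0) (pd l (pd j Y) 0) := by
  rw [(pd_pd_inner l m (contDiffAt_pd i S.smooth_Y) (contDiffAt_pd j S.smooth_Y)).self_of_nhds]
  beta_reduce
  rw [S.tangent, S.tangent, S.inner_pd_pd_pd_zero, real_inner_comm _ (ι _),
    S.inner_pd_pd_pd_zero, add_zero, zero_add]

theorem inner_pd_pd_normal (i l : Fin n) :
    (fun w => inner ℝ (pd i (pd l Y) w) (ν w)) =ᶠ[𝓝 0]
      fun w => ∑ k, A k i w * inner ℝ (pd l Y w) (pd k Y w) := by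
  have h1 : (fun w => inner ℝ (pd l Y w) (ν w)) =ᶠ[𝓝 0] fun _ => (0 : ℝ) :=
    S.perp.mono fun w hw => hw l
  have h2 := (pd_inner i (contDiffAt_pd l S.smooth_Y) S.smooth_ν).symm.trans (pd_congr i h1)
  filter_upwards [h2, S.weingarten] with w h3 h4
  rw [pd_const, h4 i, inner_neg_right, inner_sum] at h3
  simp only [real_inner_smul_right] at h3
  linarith

/-- Only the form with its index lowered by the metric is symmetric away from the origin. The mixed
matrix `A` is symmetric at the origin, and the failure of its symmetry at second order carries the
curvature. -/
theorem second_fundamental_form_symm (i l : Fin n) :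
    (fun w => ∑ k, A k i w * inner ℝ (pd l Y w) (pd k Y w)) =ᶠ[𝓝 0]
      fun w => ∑ k, A k l w * inner ℝ (pd i Y w) (pd k Y w) := by
  refine (S.inner_pd_pd_normal i l).symm.trans (EventuallyEq.trans ?_ (S.inner_pd_pd_normal l i))
  filter_upwards [pd_comm S.smooth_Y i l] with w hw
  rw [hw]

theorem inner_pd_pd_normal_zero (i l : Fin n) : inner ℝ (pd i (pd l Y) 0) (ν 0) = A l i 0 := by
  refine (S.inner_pd_pd_normal i l).self_of_nhds.trans ?_
  simp [S.metric_zero]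

theorem A_symm (i l : Fin n) : A l i 0 = A i l 0 := by
  have := (S.second_fundamental_form_symm i l).self_of_nhds
  simpa [S.metric_zero] using this

theorem pd_second_fundamental_form (i l j : Fin n) :
    pd j (fun w => ∑ k, A k i w * inner ℝ (pd l Y w) (pd k Y w)) 0 = pd j (A l i) 0 := by
  rw [(pd_sum Finset.univ j fun k _ => (S.smooth_A k i).mul (S.smooth_metric l k)).self_of_nhds]
  simp only [(pd_mul j (S.smooth_A _ i) (S.smooth_metric l _)).self_of_nhds, S.pd_metric,
    S.metric_zero]
  simp

theorem pd_pd_second_fundamental_form (i l j m : Fin n) :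
    pd m (pd j (fun w => ∑ k, A k i w * inner ℝ (pd l Y w) (pd k Y w))) 0 =
      pd m (pd j (A l i)) 0 + ∑ k, A k i 0 * (inner ℝ (pd j (pd l Y) 0) (pd m (pd k Y) 0) +
        inner ℝ (pd m (pd l Y) 0) (pd j (pd k Y) 0)) := by
  rw [(pd_pd_sum Finset.univ j m fun k _ =>
    (S.smooth_A k i).mul (S.smooth_metric l k)).self_of_nhds]
  simp only [(pd_pd_mul j m (S.smooth_A _ i) (S.smooth_metric l _)).self_of_nhds, S.pd_metric,
    S.metric_zero, S.pd_pd_metric]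
  simp [Finset.sum_add_distrib]

theorem pd_A_symm (i l j : Fin n) : pd j (A l i) 0 = pd j (A i l) 0 := by
  rw [← S.pd_second_fundamental_form i l j, ← S.pd_second_fundamental_form l i j]
  exact (pd_congr j (S.second_fundamental_form_symm i l)).self_of_nhds

/-- Differentiating the symmetry of the lowered form twice brings in the second derivatives of the
metric, which are products of second derivatives of `Y`. These products are the Gauss curvature
terms of Simons' identity. -/
theorem pd_pd_A_symm (i l j m : Fin n) :
    pd m (pd j (A l i)) 0 + ∑ k, A k i 0 * (inner ℝ (pd j (pd l Y) 0) (pd m (pd k Y) 0) +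
        inner ℝ (pd m (pd l Y) 0) (pd j (pd k Y) 0)) =
    pd m (pd j (A i l)) 0 + ∑ k, A k l 0 * (inner ℝ (pd j (pd i Y) 0) (pd m (pd k Y) 0) +
        inner ℝ (pd m (pd i Y) 0) (pd j (pd k Y) 0)) := by
  rw [← S.pd_pd_second_fundamental_form i l j m, ← S.pd_pd_second_fundamental_form l i j m]
  exact (pd_congr m (pd_congr j (S.second_fundamental_form_symm i l))).self_of_nhds

theorem A_eq (l i : Fin n) :
    A l i =ᶠ[𝓝 0] fun w => -inner ℝ (pd i ν w) (ι (EuclideanSpace.single l 1)) := by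
  have h : ∀ᶠ w in 𝓝 0, ∀ k, inner ℝ (pd k Y w) (ι (EuclideanSpace.single l 1)) =
      if l = k then (1 : ℝ) else 0 := Filter.eventually_all.2 fun k => S.inner_pd k l
  filter_upwards [S.weingarten, h] with w h1 h2
  rw [h1 i, inner_neg_left, sum_inner]
  simp [real_inner_smul_left, h2]

theorem t_eq (l : Fin n) :
    t l =ᶠ[𝓝 0] fun w => inner ℝ (Y w + H w • ν w) (ι (EuclideanSpace.single l 1)) := by
  have h : ∀ᶠ w in 𝓝 0, ∀ k, inner ℝ (pd k Y w) (ι (EuclideanSpace.single l 1)) =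
      if l = k then (1 : ℝ) else 0 := Filter.eventually_all.2 fun k => S.inner_pd k l
  filter_upwards [S.shrinker, h] with w h1 h2
  rw [h1, sum_inner]
  simp [real_inner_smul_left, h2]

/-- The Codazzi equation. Paired with a fixed vector, `-pd i ν` gives `A l i`, so this is the
commutation of second derivatives of `ν`. It holds near the origin, not only at it. -/
theorem pd_A_comm (l i j : Fin n) : pd j (A l i) =ᶠ[𝓝 0] pd i (A l j) := by
  have key : ∀ i j, pd j (A l i) =ᶠ[𝓝 0]
      fun w => -inner ℝ (pd j (pd i ν) w) (ι (EuclideanSpace.single l 1)) := by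
    intro i j
    refine (pd_congr j (S.A_eq l i)).trans ?_
    rw [pd_neg]
    exact (pd_inner_const j (contDiffAt_pd i S.smooth_ν) _).neg
  refine (key i j).trans (EventuallyEq.trans ?_ (key j i).symm)
  filter_upwards [pd_comm S.smooth_ν j i] with w hw
  rw [hw]

theorem pd_pd_ν (i j : Fin n) :
    pd j (pd i ν) 0 = -∑ k, (pd j (A k i) 0 • pd k Y 0 + A k i 0 • pd j (pd k Y) 0) := by
  have h1 : pd i ν =ᶠ[𝓝 0] fun w => -∑ k, A k i w • pd k Y w := S.weingarten.mono fun w hw => hw i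
  rw [(pd_congr j h1).self_of_nhds, pd_neg]
  beta_reduce
  have h2 : ∀ k, ContDiffAt ℝ ∞ (fun w => A k i w • pd k Y w) 0 := fun k =>
    (S.smooth_A k i).smul (contDiffAt_pd k S.smooth_Y)
  rw [(pd_sum Finset.univ j fun k _ => h2 k).self_of_nhds]
  simp only [(pd_smul j (S.smooth_A _ i) (contDiffAt_pd _ S.smooth_Y)).self_of_nhds]

/-- The Ricci equation for the parallel field `ν`: the second derivatives of `ν` commute, and by
Codazzi their parts along the `pd k Y` already agree. -/
theorem sum_A_smul_comm (i j : Fin n) :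
    ∑ k, A k i 0 • pd j (pd k Y) 0 = ∑ k, A k j 0 • pd i (pd k Y) 0 := by
  have h1 := (pd_comm S.smooth_ν j i).self_of_nhds
  rw [S.pd_pd_ν i j, S.pd_pd_ν j i, neg_inj, Finset.sum_add_distrib, Finset.sum_add_distrib] at h1
  simp only [(S.pd_A_comm _ i j).self_of_nhds] at h1
  exact add_left_cancel h1

theorem G_zero (i j : Fin n) : G i j 0 = if i = j then 1 else 0 := by
  have := S.inverse.self_of_nhds i j
  simpa [S.metric_zero] using this

theorem pd_G (i j l : Fin n) : pd l (G i j) 0 = 0 := by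
  have h1 : (fun w => ∑ k, G i k w * inner ℝ (pd k Y w) (pd j Y w)) =ᶠ[𝓝 0]
      fun _ => if i = j then (1 : ℝ) else 0 := S.inverse.mono fun w hw => hw i j
  have h2 := (pd_congr l h1).self_of_nhds
  rw [(pd_sum Finset.univ l fun k _ => (S.smooth_G i k).mul (S.smooth_metric k j)).self_of_nhds,
    pd_const] at h2
  simp only [(pd_mul l (S.smooth_G i _) (S.smooth_metric _ j)).self_of_nhds, S.pd_metric,
    S.metric_zero] at h2
  simpa using h2

theorem inner_ν_tangent (k : Fin n) : inner ℝ (ν 0) (ι (EuclideanSpace.single k 1)) = 0 := by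
  rw [← S.tangent, real_inner_comm]
  exact S.perp.self_of_nhds k

theorem sum_pd_pd : ∑ i, pd i (pd i Y) 0 = H 0 • ν 0 := by
  have := S.mean.self_of_nhds
  simpa [S.G_zero, S.inner_ν_tangent] using this

omit S in
theorem inner_pd_zero_of_perp (S : IsShrinkerGerm Y ν H A t G ι) {ξ : V}
    (hξ : ∀ k, inner ℝ (ι (EuclideanSpace.single k 1)) ξ = 0) (k : Fin n) :
    pd k (fun w => inner ℝ (Y w) ξ) 0 = 0 := by
  rw [(pd_inner_const k S.smooth_Y ξ).self_of_nhds]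
  beta_reduce
  rw [S.tangent, hξ]

end IsShrinkerGerm

/-! ### Simons' identity and the drift equations for the shape operator and for |H|. -/

namespace IsShrinkerGerm

variable {n : ℕ} {V : Type*} [NormedAddCommGroup V] [InnerProductSpace ℝ V]
  {Y ν : EuclideanSpace ℝ (Fin n) → V} {H : EuclideanSpace ℝ (Fin n) → ℝ}
  {A : Fin n → Fin n → EuclideanSpace ℝ (Fin n) → ℝ}
  {t : Fin n → EuclideanSpace ℝ (Fin n) → ℝ}
  {G : Fin n → Fin n → EuclideanSpace ℝ (Fin n) → ℝ}
  {ι : EuclideanSpace ℝ (Fin n) →ₗᵢ[ℝ] V}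
  (S : IsShrinkerGerm Y ν H A t G ι)
include S

theorem pd_t (k i : Fin n) : pd i (t k) 0 = (if k = i then 1 else 0) - H 0 * A k i 0 := by
  have h1 : ContDiffAt ℝ ∞ (fun w => H w • ν w) 0 := S.smooth_H.smul S.smooth_ν
  have h2 : ContDiffAt ℝ ∞ (fun w => Y w + H w • ν w) 0 := S.smooth_Y.add h1
  rw [(pd_congr i (S.t_eq k)).self_of_nhds, (pd_inner_const i h2 _).self_of_nhds]
  beta_reduce
  rw [(pd_add i S.smooth_Y h1).self_of_nhds]
  beta_reduce
  rw [(pd_smul i S.smooth_H S.smooth_ν).self_of_nhds, (S.A_eq k i).self_of_nhds]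
  beta_reduce
  have h3 : inner ℝ (pd i Y 0) (ι (EuclideanSpace.single k 1)) = if k = i then (1 : ℝ) else 0 :=
    (S.inner_pd i k).self_of_nhds
  rw [inner_add_left, inner_add_left, h3, real_inner_smul_left, real_inner_smul_left,
    S.inner_ν_tangent]
  ring

/-- The second fundamental form in a normal direction orthogonal to `ν` is orthogonal to `A`. -/
theorem sum_A_mul_inner_eq_zero {ξ : V}
    (hξ : ∀ k, inner ℝ (ι (EuclideanSpace.single k 1)) ξ = 0) (hν : inner ℝ (ν 0) ξ = 0) :
    ∑ i, ∑ k, A k i 0 * inner ℝ (pd i (pd k Y) 0) ξ = 0 := by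
  -- Pairing with the constant vector `ξ` turns the structure equations into scalar ones for the
  -- heights `y` of `Y` and `q` of `ν`. At the origin `q` and all first derivatives of `y` and `q`
  -- vanish, which kills most product-rule terms.
  set y : EuclideanSpace ℝ (Fin n) → ℝ := fun w => inner ℝ (Y w) ξ with hy
  set q : EuclideanSpace ℝ (Fin n) → ℝ := fun w => inner ℝ (ν w) ξ with hq
  have sy : ContDiffAt ℝ ∞ y 0 := S.smooth_Y.inner ℝ contDiffAt_const
  have sq : ContDiffAt ℝ ∞ q 0 := S.smooth_ν.inner ℝ contDiffAt_const
  have y1 : ∀ k, pd k y 0 = 0 := S.inner_pd_zero_of_perp hξ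
  have yk : ∀ k, pd k y =ᶠ[𝓝 0] fun w => inner ℝ (pd k Y w) ξ := fun k =>
    pd_inner_const k S.smooth_Y ξ
  have ykl : ∀ k l, pd l (pd k y) =ᶠ[𝓝 0] fun w => inner ℝ (pd l (pd k Y) w) ξ := fun k l =>
    pd_pd_inner_const k l S.smooth_Y ξ
  have q0 : q 0 = 0 := hν
  have qi : ∀ i, pd i q =ᶠ[𝓝 0] fun w => -∑ k, A k i w * pd k y w := by
    intro i
    filter_upwards [pd_inner_const i S.smooth_ν ξ, S.weingarten,
      Filter.eventually_all.2 yk] with w h1 h2 h3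
    rw [h1, h2, inner_neg_left, sum_inner]
    simp [real_inner_smul_left, h3]
  have sAy : ∀ k i j, ContDiffAt ℝ ∞ (fun w => A k i w * pd j y w) 0 := fun k i j =>
    (S.smooth_A k i).mul (contDiffAt_pd j sy)
  have q1 : ∀ i, pd i q 0 = 0 := fun i => by
    rw [(qi i).self_of_nhds]; simp [y1]
  have q2 : ∀ i, pd i (pd i q) 0 = -∑ k, A k i 0 * pd i (pd k y) 0 := fun i => by
    rw [(pd_congr i (qi i)).self_of_nhds, pd_neg]
    beta_reduce
    rw [(pd_sum Finset.univ i fun k _ => sAy k i k).self_of_nhds]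
    simp only [(pd_mul i (S.smooth_A _ i) (contDiffAt_pd _ sy)).self_of_nhds, y1]
    simp
  have hshr : (fun w => y w + H w * q w) =ᶠ[𝓝 0] fun w => ∑ k, t k w * pd k y w := by
    filter_upwards [S.shrinker, Filter.eventually_all.2 yk] with w h1 h2
    have := congrArg (fun v => inner ℝ v ξ) h1
    simp only [inner_add_left, sum_inner, real_inner_smul_left] at this
    simp only [h2]
    exact this
  have hmean : (fun w => ∑ i, ∑ j, G i j w * pd i (pd j y) w) =ᶠ[𝓝 0] fun w =>
      H w * q w + ∑ k, (H w * -inner ℝ (ν w) (ι (EuclideanSpace.single k 1))) * pd k y w := by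
    filter_upwards [S.mean, Filter.eventually_all.2 yk, Filter.eventually_all.2 fun i =>
      Filter.eventually_all.2 fun j => ykl j i] with w h1 h2 h3
    have := congrArg (fun v => inner ℝ v ξ) h1
    simpa [inner_add_left, sum_inner, real_inner_smul_left, h2, h3, hq] using this
  have htr : ∑ i, pd i (pd i y) 0 = 0 := by
    have := hmean.self_of_nhds
    simpa [S.G_zero, q0, y1] using this
  have htr1 : ∀ l, ∑ i, pd l (pd i (pd i y)) 0 = 0 := by
    intro l
    have h1 := (pd_congr l hmean).self_of_nhds
    have sGy : ∀ i j, ContDiffAt ℝ ∞ (fun w => G i j w * pd i (pd j y) w) 0 := fun i j =>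
      (S.smooth_G i j).mul (contDiffAt_pd i (contDiffAt_pd j sy))
    have sμ : ∀ k, ContDiffAt ℝ ∞
        (fun w => H w * -inner ℝ (ν w) (ι (EuclideanSpace.single k 1))) 0 := fun k =>
      S.smooth_H.mul (S.smooth_ν.inner ℝ contDiffAt_const).neg
    have sμy : ∀ k, ContDiffAt ℝ ∞
        (fun w => (H w * -inner ℝ (ν w) (ι (EuclideanSpace.single k 1))) * pd k y w) 0 := fun k =>
      (sμ k).mul (contDiffAt_pd k sy)
    rw [(pd_add l (S.smooth_H.mul sq) (ContDiffAt.sum fun k _ => sμy k)).self_of_nhds] at h1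
    beta_reduce at h1
    rw [(pd_mul l S.smooth_H sq).self_of_nhds,
      (pd_sum Finset.univ l fun k _ => sμy k).self_of_nhds,
      (pd_sum Finset.univ l fun i _ => ContDiffAt.sum fun j _ => sGy i j).self_of_nhds] at h1
    simp only [(pd_sum Finset.univ l fun j _ => sGy _ j).self_of_nhds,
      (pd_mul l (S.smooth_G _ _) (contDiffAt_pd _ (contDiffAt_pd _ sy))).self_of_nhds,
      (pd_mul l (sμ _) (contDiffAt_pd _ sy)).self_of_nhds, S.pd_G, S.G_zero, q0, q1, y1,
      S.inner_ν_tangent] at h1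
    simpa using h1
  have hcomm : ∀ i k, pd i (pd i (pd k y)) 0 = pd k (pd i (pd i y)) 0 := fun i k =>
    ((pd_congr i (pd_comm sy i k)).trans (pd_comm (contDiffAt_pd i sy) i k)).self_of_nhds
  -- The shrinker equation differentiated twice. After summation over `i` the Laplacian of `y` and
  -- its first derivatives vanish, and the wanted sum times `H 0` is left once on the left and twice
  -- on the right, hence is zero.
  have hshr2 : ∀ i, pd i (pd i y) 0 - H 0 * ∑ k, A k i 0 * pd i (pd k y) 0 =
      2 * pd i (pd i y) 0 - 2 * H 0 * ∑ k, A k i 0 * pd i (pd k y) 0 +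
        ∑ k, t k 0 * pd k (pd i (pd i y)) 0 := by
    intro i
    have h1 := (pd_congr i (pd_congr i hshr)).self_of_nhds
    rw [(pd_pd_add i i sy (S.smooth_H.mul sq)).self_of_nhds,
      (pd_pd_sum Finset.univ i i fun k _ =>
        (S.smooth_t k).mul (contDiffAt_pd k sy)).self_of_nhds] at h1
    beta_reduce at h1
    rw [(pd_pd_mul i i S.smooth_H sq).self_of_nhds] at h1
    simp only [(pd_pd_mul i i (S.smooth_t _) (contDiffAt_pd _ sy)).self_of_nhds, q0, q1, q2, y1,
      S.pd_t] at h1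
    simp only [sub_mul, ite_mul, one_mul, zero_mul, mul_zero, add_zero, zero_add,
      Finset.sum_add_distrib, Finset.sum_sub_distrib, Finset.sum_ite_eq', Finset.mem_univ,
      if_true, mul_assoc, ← Finset.mul_sum] at h1
    have h2 : ∑ k, t k 0 * pd i (pd i (pd k y)) 0 = ∑ k, t k 0 * pd k (pd i (pd i y)) 0 :=
      Finset.sum_congr rfl fun k _ => by rw [hcomm i k]
    linarith
  have hsum := Finset.sum_congr (rfl : (Finset.univ : Finset (Fin n)) = Finset.univ)
    fun i _ => hshr2 i
  simp only [Finset.sum_add_distrib, Finset.sum_sub_distrib, ← Finset.mul_sum, htr] at hsum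
  rw [Finset.sum_comm (f := fun i k => t k 0 * pd k (pd i (pd i y)) 0)] at hsum
  simp only [← Finset.mul_sum, htr1] at hsum
  have hfin : H 0 * ∑ i, ∑ k, A k i 0 * pd i (pd k y) 0 = 0 := by
    simp only [mul_zero, Finset.sum_const_zero] at hsum
    linarith
  have h0 := (mul_eq_zero.1 hfin).resolve_left S.pos.ne'
  have e : ∀ k i, pd i (pd k y) 0 = inner ℝ (pd i (pd k Y) 0) ξ := fun k i =>
    (ykl k i).self_of_nhds
  simpa only [e] using h0

/-- Graph coordinates exclude a tangential part, pairing with `ν 0` gives |A|², and the preceding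
orthogonality removes every other normal component: the difference of the two sides is orthogonal to
itself. -/
theorem sum_A_smul_pd_pd :
    ∑ i, ∑ k, A k i 0 • pd i (pd k Y) 0 = (∑ i, ∑ k, A k i 0 ^ 2) • ν 0 := by
  set ζ := ∑ i, ∑ k, A k i 0 • pd i (pd k Y) 0 with hζ
  set N := ∑ i, ∑ k, A k i 0 ^ 2 with hN
  have hunit : inner ℝ (ν 0) (ν 0) = (1 : ℝ) := S.unit.self_of_nhds
  have h1 : inner ℝ ζ (ν 0) = N := by
    simp only [hζ, hN, sum_inner, real_inner_smul_left, S.inner_pd_pd_normal_zero, pow_two]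
  have h2 : ∀ k, inner ℝ ζ (ι (EuclideanSpace.single k 1)) = 0 := fun k => by
    simp only [hζ, sum_inner, real_inner_smul_left, S.inner_pd_pd_zero, mul_zero,
      Finset.sum_const_zero]
  have h3 : inner ℝ (ν 0) (ζ - N • ν 0) = 0 := by
    rw [inner_sub_right, real_inner_smul_right, hunit, real_inner_comm, h1]; ring
  have h4 : inner ℝ ζ (ζ - N • ν 0) = 0 := by
    have := S.sum_A_mul_inner_eq_zero (ξ := ζ - N • ν 0) (fun k => by
      rw [real_inner_comm, inner_sub_left, real_inner_smul_left, h2, S.inner_ν_tangent]; simp) h3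
    simpa only [hζ, sum_inner, real_inner_smul_left] using this
  have h5 : inner ℝ (ζ - N • ν 0) (ζ - N • ν 0) = (0 : ℝ) := by
    rw [inner_sub_left, real_inner_smul_left, h3, h4]; simp
  exact sub_eq_zero.1 (inner_self_eq_zero.1 h5)

theorem H_eq : H =ᶠ[𝓝 0] fun w => -inner ℝ (Y w) (ν w) := by
  filter_upwards [S.shrinker, S.unit, S.perp] with w h1 h2 h3
  have := congrArg (fun v => inner ℝ v (ν w)) h1
  simp only [inner_add_left, sum_inner, real_inner_smul_left, h2, h3] at this
  simp at this
  linarith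

theorem pd_H_eventually (i : Fin n) :
    pd i H =ᶠ[𝓝 0] fun w => ∑ k, A k i w * inner ℝ (Y w) (pd k Y w) := by
  refine (pd_congr i S.H_eq).trans ?_
  rw [pd_neg]
  filter_upwards [pd_inner i S.smooth_Y S.smooth_ν, S.perp, S.weingarten] with w h1 h2 h3
  rw [h1, h2, h3, inner_neg_right, inner_sum]
  simp [real_inner_smul_right]

theorem Y_zero : Y 0 = ∑ k, t k 0 • ι (EuclideanSpace.single k 1) - H 0 • ν 0 := by
  have := S.shrinker.self_of_nhds
  simp only [S.tangent] at this
  rw [← this]; abel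

theorem inner_Y_tangent (k : Fin n) : inner ℝ (Y 0) (ι (EuclideanSpace.single k 1)) = t k 0 := by
  rw [S.Y_zero, inner_sub_left, sum_inner, real_inner_smul_left, S.inner_ν_tangent]
  simp only [real_inner_smul_left, inner_map_single]
  simp

theorem inner_Y_pd_pd (i j : Fin n) : inner ℝ (Y 0) (pd i (pd j Y) 0) = -(H 0 * A j i 0) := by
  have h : ∀ k, inner ℝ (ι (EuclideanSpace.single k 1)) (pd i (pd j Y) 0) = (0 : ℝ) := fun k => by
    rw [real_inner_comm, S.inner_pd_pd_zero]
  rw [S.Y_zero, inner_sub_left, sum_inner, real_inner_smul_left,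
    real_inner_comm _ (ν 0), S.inner_pd_pd_normal_zero]
  simp [real_inner_smul_left, h]

theorem pd_H (i : Fin n) : pd i H 0 = ∑ k, A k i 0 * t k 0 := by
  refine (S.pd_H_eventually i).self_of_nhds.trans ?_
  simp only [S.tangent, S.inner_Y_tangent]

/-- Differentiate ∇H = A(x^T). The derivative of x^T contributes the identity and the second
fundamental form, and the Codazzi equation moves the derivative of `A` into the direction x^T. -/
theorem pd_pd_H (i l : Fin n) : pd l (pd i H) 0 =
    ∑ k, t k 0 * pd k (A l i) 0 + A l i 0 - H 0 * ∑ k, A k i 0 * A k l 0 := by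
  have s1 : ∀ k, ContDiffAt ℝ ∞ (fun w => inner ℝ (Y w) (pd k Y w)) 0 := fun k =>
    S.smooth_Y.inner ℝ (contDiffAt_pd k S.smooth_Y)
  rw [(pd_congr l (S.pd_H_eventually i)).self_of_nhds,
    (pd_sum Finset.univ l fun k _ => (S.smooth_A k i).mul (s1 k)).self_of_nhds]
  simp only [(pd_mul l (S.smooth_A _ i) (s1 _)).self_of_nhds,
    (pd_inner l S.smooth_Y (contDiffAt_pd _ S.smooth_Y)).self_of_nhds, S.tangent,
    S.inner_Y_tangent, S.inner_Y_pd_pd, inner_map_single]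
  have h : ∀ k, pd l (A k i) 0 = pd k (A l i) 0 := fun k => by
    rw [S.pd_A_symm i k l, (S.pd_A_comm i k l).self_of_nhds, S.pd_A_symm l i k]
  simp only [h, Finset.sum_add_distrib, mul_add, Finset.mul_sum]
  simp only [mul_ite, mul_one, mul_zero, Finset.sum_ite_eq, Finset.mem_univ, if_true, mul_neg,
    Finset.sum_neg_distrib]
  rw [add_sub_assoc, sub_eq_add_neg]
  congr 1
  · exact Finset.sum_congr rfl fun k _ => mul_comm _ _
  · congr 1
    rw [neg_inj]
    exact Finset.sum_congr rfl fun k _ => by ring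

/-- Simons' identity for the shape operator of the principal normal. -/
theorem laplacian_A (l i : Fin n) : ∑ j, pd j (pd j (A l i)) 0 =
    ∑ k, t k 0 * pd k (A l i) 0 + (1 - ∑ j, ∑ k, A k j 0 ^ 2) * A l i 0 := by
  have Ysymm : ∀ i j, pd i (pd j Y) 0 = pd j (pd i Y) 0 := fun i j =>
    (pd_comm S.smooth_Y i j).self_of_nhds
  -- Codazzi, symmetry with its curvature correction, commutation of derivatives, and Codazzi again
  -- turn the Laplacian of `A` into the Hessian of its trace plus terms quadratic in the second
  -- fundamental form.
  have h1 : ∀ j, pd j (pd j (A l i)) 0 =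
      pd i (pd l (A j j)) 0 + ∑ k, A k l 0 * (inner ℝ (pd i (pd j Y) 0) (pd j (pd k Y) 0) +
        inner ℝ (pd j (pd j Y) 0) (pd i (pd k Y) 0)) -
      ∑ k, A k j 0 * (inner ℝ (pd i (pd l Y) 0) (pd j (pd k Y) 0) +
        inner ℝ (pd j (pd l Y) 0) (pd i (pd k Y) 0)) := by
    intro j
    have e1 := (pd_congr j (S.pd_A_comm l i j)).self_of_nhds
    have e2 := S.pd_pd_A_symm j l i j
    have e3 := (pd_comm (S.smooth_A j l) j i).self_of_nhds
    have e4 := (pd_congr i (S.pd_A_comm j l j)).self_of_nhds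
    linarith
  have htrace : ∑ j, pd i (pd l (A j j)) 0 = pd i (pd l H) 0 := by
    have e : H =ᶠ[𝓝 0] fun w => ∑ k, A k k w := S.trace
    rw [(pd_congr i (pd_congr l e)).self_of_nhds,
      (pd_pd_sum Finset.univ l i fun k _ => S.smooth_A k k).self_of_nhds]
  have t1 : ∑ j, ∑ k, A k j 0 * inner ℝ (pd i (pd l Y) 0) (pd j (pd k Y) 0) =
      (∑ j, ∑ k, A k j 0 ^ 2) * A l i 0 := by
    have := congrArg (fun v => inner ℝ (pd i (pd l Y) 0) v) S.sum_A_smul_pd_pd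
    simpa only [inner_sum, real_inner_smul_right, S.inner_pd_pd_normal_zero] using this
  have t4 : ∑ j, ∑ k, A k l 0 * inner ℝ (pd j (pd j Y) 0) (pd i (pd k Y) 0) =
      H 0 * ∑ k, A k l 0 * A k i 0 := by
    rw [Finset.sum_comm]
    simp only [← Finset.mul_sum, ← sum_inner, S.sum_pd_pd, real_inner_smul_left,
      real_inner_comm _ (ν 0), S.inner_pd_pd_normal_zero]
    rw [Finset.mul_sum]
    exact Finset.sum_congr rfl fun k _ => by ring
  -- The two mixed curvature terms cancel by the Ricci equation. The term in `t4` cancels against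
  -- the A² term in the Hessian of `H`, and `t1` leaves |A|²A.
  have t23 : ∑ j, ∑ k, A k l 0 * inner ℝ (pd i (pd j Y) 0) (pd j (pd k Y) 0) =
      ∑ j, ∑ k, A k j 0 * inner ℝ (pd j (pd l Y) 0) (pd i (pd k Y) 0) := by
    have e : ∀ j, ∑ k, A k l 0 * inner ℝ (pd i (pd j Y) 0) (pd j (pd k Y) 0) =
        ∑ k, A k j 0 * inner ℝ (pd i (pd j Y) 0) (pd l (pd k Y) 0) := fun j => by
      have := congrArg (fun v => inner ℝ (pd i (pd j Y) 0) v) (S.sum_A_smul_comm l j)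
      simpa only [inner_sum, real_inner_smul_right] using this
    simp only [e]
    rw [Finset.sum_comm]
    refine Finset.sum_congr rfl fun j _ => Finset.sum_congr rfl fun k _ => ?_
    rw [S.A_symm k j, Ysymm l j, real_inner_comm]
  simp only [h1, mul_add, Finset.sum_add_distrib, Finset.sum_sub_distrib, htrace, t1, t4, t23,
    S.pd_pd_H, S.A_symm l i]
  have hd : ∀ k, pd k (A i l) 0 = pd k (A l i) 0 := fun k => S.pd_A_symm l i k
  simp only [hd]
  ring

theorem laplacian_H : ∑ j, pd j (pd j H) 0 =
    ∑ k, t k 0 * pd k H 0 + (1 - ∑ j, ∑ k, A k j 0 ^ 2) * H 0 := by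
  have e : H =ᶠ[𝓝 0] fun w => ∑ k, A k k w := S.trace
  have h1 : ∀ j, pd j H 0 = ∑ l, pd j (A l l) 0 := fun j => by
    rw [(pd_congr j e).self_of_nhds, (pd_sum Finset.univ j fun k _ => S.smooth_A k k).self_of_nhds]
  have h2 : ∀ j, pd j (pd j H) 0 = ∑ l, pd j (pd j (A l l)) 0 := fun j => by
    rw [(pd_congr j (pd_congr j e)).self_of_nhds,
      (pd_pd_sum Finset.univ j j fun k _ => S.smooth_A k k).self_of_nhds]
  simp only [h1, h2]
  rw [Finset.sum_comm]
  simp only [S.laplacian_A, Finset.sum_add_distrib, ← Finset.mul_sum]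
  rw [S.trace.self_of_nhds, Finset.sum_comm]
  simp only [Finset.mul_sum]

end IsShrinkerGerm

/-! ### The normalized shape operator τ = A / |H| and its squared norm. -/

namespace IsShrinkerGerm

variable {n : ℕ} {V : Type*} [NormedAddCommGroup V] [InnerProductSpace ℝ V]
  {Y ν : EuclideanSpace ℝ (Fin n) → V} {H : EuclideanSpace ℝ (Fin n) → ℝ}
  {A : Fin n → Fin n → EuclideanSpace ℝ (Fin n) → ℝ}
  {t : Fin n → EuclideanSpace ℝ (Fin n) → ℝ}
  {G : Fin n → Fin n → EuclideanSpace ℝ (Fin n) → ℝ}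
  {ι : EuclideanSpace ℝ (Fin n) →ₗᵢ[ℝ] V}
  (S : IsShrinkerGerm Y ν H A t G ι)
include S

theorem H_ne_zero : ∀ᶠ w in 𝓝 0, H w ≠ 0 :=
  S.smooth_H.continuousAt.eventually_ne S.pos.ne'

theorem smooth_ratio (l i : Fin n) : ContDiffAt ℝ ∞ (fun w => A l i w / H w) 0 :=
  (S.smooth_A l i).div S.smooth_H S.pos.ne'

theorem A_eq_ratio_mul (l i : Fin n) : A l i =ᶠ[𝓝 0] fun w => A l i w / H w * H w := by
  filter_upwards [S.H_ne_zero] with w hw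
  field_simp

theorem pd_A_eq (l i j : Fin n) : pd j (A l i) 0 =
    pd j (fun w => A l i w / H w) 0 * H 0 + A l i 0 / H 0 * pd j H 0 := by
  rw [(pd_congr j (S.A_eq_ratio_mul l i)).self_of_nhds,
    (pd_mul j (S.smooth_ratio l i) S.smooth_H).self_of_nhds]

theorem pd_ratio_symm (l i j : Fin n) :
    pd j (fun w => A l i w / H w) 0 = pd j (fun w => A i l w / H w) 0 := by
  have h1 := S.pd_A_eq l i j
  have h2 := S.pd_A_eq i l j
  rw [S.pd_A_symm i l j, S.A_symm i l, h2] at h1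
  exact (mul_right_cancel₀ S.pos.ne' (add_right_cancel h1)).symm

/-- Numerator and denominator solve the same linear equation, so the zeroth-order terms cancel in
the quotient. The price is the extra drift 2∇H/H. -/
theorem laplacian_ratio (l i : Fin n) :
    ∑ j, (pd j (pd j fun w => A l i w / H w) 0 +
      (-t j 0 + 2 * pd j H 0 / H 0) * pd j (fun w => A l i w / H w) 0) = 0 := by
  set τ : EuclideanSpace ℝ (Fin n) → ℝ := fun w => A l i w / H w with hτ
  have hH := S.pos.ne'
  have h1 : ∀ j, pd j (pd j (A l i)) 0 = pd j (pd j τ) 0 * H 0 + pd j τ 0 * pd j H 0 +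
      (pd j τ 0 * pd j H 0 + τ 0 * pd j (pd j H) 0) := fun j => by
    rw [(pd_congr j (pd_congr j (S.A_eq_ratio_mul l i))).self_of_nhds]
    exact (pd_pd_mul j j (S.smooth_ratio l i) S.smooth_H).self_of_nhds
  have h2 := S.laplacian_A l i
  have h3 := S.laplacian_H
  have h4 : A l i 0 = τ 0 * H 0 := (S.A_eq_ratio_mul l i).self_of_nhds
  simp only [h1, S.pd_A_eq l i, Finset.sum_add_distrib, ← Finset.mul_sum, mul_add,
    ← Finset.sum_mul] at h2
  rw [h3, h4] at h2
  have h5 : H 0 * ∑ j, (pd j (pd j τ) 0 + (-t j 0 + 2 * pd j H 0 / H 0) * pd j τ 0) =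
      (∑ j, pd j (pd j τ) 0) * H 0 + ∑ j, pd j τ 0 * pd j H 0 + ∑ j, pd j τ 0 * pd j H 0
        - ∑ j, t j 0 * (pd j τ 0 * H 0) := by
    rw [Finset.mul_sum, Finset.sum_mul, ← Finset.sum_add_distrib, ← Finset.sum_add_distrib,
      ← Finset.sum_sub_distrib]
    refine Finset.sum_congr rfl fun j _ => ?_
    field_simp
    ring
  have h6 : ∑ j, t j 0 * (τ 0 * H 0 / H 0 * pd j H 0) = τ 0 * ∑ j, t j 0 * pd j H 0 := by
    rw [Finset.mul_sum]
    refine Finset.sum_congr rfl fun j _ => ?_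
    field_simp
  have h7 : H 0 * ∑ j, (pd j (pd j τ) 0 + (-t j 0 + 2 * pd j H 0 / H 0) * pd j τ 0) = 0 := by
    rw [h5]
    rw [h6] at h2
    linear_combination h2
  exact (mul_eq_zero.1 h7).resolve_left hH

variable {F : EuclideanSpace ℝ (Fin n) → ℝ}
  (hF : F =ᶠ[𝓝 0] fun w => ∑ l, ∑ i, A l i w / H w * (A i l w / H w))
include hF

omit hF in
theorem smooth_ratio_mul (l i : Fin n) :
    ContDiffAt ℝ ∞ (fun w => A l i w / H w * (A i l w / H w)) 0 :=
  (S.smooth_ratio l i).mul (S.smooth_ratio i l)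

theorem pd_trace_sq (j : Fin n) : pd j F 0 =
    ∑ l, ∑ i, 2 * (A l i 0 / H 0 * pd j (fun w => A l i w / H w) 0) := by
  rw [(pd_congr j hF).self_of_nhds, (pd_sum Finset.univ j fun l _ => ContDiffAt.sum fun i _ =>
    S.smooth_ratio_mul l i).self_of_nhds]
  refine Finset.sum_congr rfl fun l _ => ?_
  rw [(pd_sum Finset.univ j fun i _ => S.smooth_ratio_mul l i).self_of_nhds]
  refine Finset.sum_congr rfl fun i _ => ?_
  rw [(pd_mul j (S.smooth_ratio l i) (S.smooth_ratio i l)).self_of_nhds]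
  beta_reduce
  rw [S.pd_ratio_symm i l j, S.A_symm l i]
  ring

theorem pd_pd_trace_sq (j : Fin n) : pd j (pd j F) 0 =
    ∑ l, ∑ i, (A l i 0 / H 0 * pd j (pd j fun w => A i l w / H w) 0 +
      A i l 0 / H 0 * pd j (pd j fun w => A l i w / H w) 0 +
      2 * pd j (fun w => A l i w / H w) 0 ^ 2) := by
  rw [(pd_congr j (pd_congr j hF)).self_of_nhds,
    (pd_pd_sum Finset.univ j j fun l _ => ContDiffAt.sum fun i _ =>
    S.smooth_ratio_mul l i).self_of_nhds]
  refine Finset.sum_congr rfl fun l _ => ?_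
  rw [(pd_pd_sum Finset.univ j j fun i _ => S.smooth_ratio_mul l i).self_of_nhds]
  refine Finset.sum_congr rfl fun i _ => ?_
  rw [(pd_pd_mul j j (S.smooth_ratio l i) (S.smooth_ratio i l)).self_of_nhds]
  beta_reduce
  rw [S.pd_ratio_symm i l j]
  ring

/-- By the product rule and the drift equation for τ only the gradient terms survive. The function
is tr(τ²), not the sum of the squared entries, because the trace does not depend on coordinates
while the matrix of τ is known to be symmetric only at the origin. -/
theorem drift_laplacian_trace_sq :
    ∑ j, (pd j (pd j F) 0 + (-t j 0 + 2 * pd j H 0 / H 0) * pd j F 0) =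
      2 * ∑ j, ∑ l, ∑ i, pd j (fun w => A l i w / H w) 0 ^ 2 := by
  have h1 : ∀ j, pd j (pd j F) 0 + (-t j 0 + 2 * pd j H 0 / H 0) * pd j F 0 =
      ∑ l, ∑ i, (2 * (A l i 0 / H 0 * (pd j (pd j fun w => A i l w / H w) 0 +
      (-t j 0 + 2 * pd j H 0 / H 0) * pd j (fun w => A i l w / H w) 0)) +
      2 * pd j (fun w => A l i w / H w) 0 ^ 2) := by
    intro j
    have e : ∑ l, ∑ i, A i l 0 / H 0 * pd j (pd j fun w => A l i w / H w) 0 =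
        ∑ l, ∑ i, A l i 0 / H 0 * pd j (pd j fun w => A i l w / H w) 0 := Finset.sum_comm
    rw [S.pd_pd_trace_sq hF, S.pd_trace_sq hF]
    simp only [Finset.sum_add_distrib]
    rw [e, ← two_mul, add_right_comm, Finset.mul_sum, Finset.mul_sum, ← Finset.sum_add_distrib]
    congr 1
    refine Finset.sum_congr rfl fun l _ => ?_
    rw [Finset.mul_sum, Finset.mul_sum, ← Finset.sum_add_distrib]
    refine Finset.sum_congr rfl fun i _ => ?_
    rw [S.pd_ratio_symm l i j]
    ring
  simp only [h1]
  rw [Finset.mul_sum, ← sub_eq_zero, ← Finset.sum_sub_distrib]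
  simp only [Finset.sum_add_distrib, Finset.mul_sum, add_sub_cancel_right]
  rw [Finset.sum_comm]
  refine Finset.sum_eq_zero fun l _ => ?_
  rw [Finset.sum_comm]
  refine Finset.sum_eq_zero fun i _ => ?_
  have := S.laplacian_ratio i l
  rw [← Finset.mul_sum, ← Finset.mul_sum]
  simp [this]

theorem drift_laplacian_trace_sq_nonneg :
    0 ≤ ∑ j, (pd j (pd j F) 0 + (-t j 0 + 2 * pd j H 0 / H 0) * pd j F 0) := by
  rw [S.drift_laplacian_trace_sq hF]
  positivity

theorem trace_sq_zero : F 0 = ∑ l, ∑ i, (A l i 0 / H 0) ^ 2 := by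
  refine hF.self_of_nhds.trans (Finset.sum_congr rfl fun l _ => Finset.sum_congr rfl fun i _ => ?_)
  rw [S.A_symm l i, pow_two]

/-- Constancy forces ∇τ = 0, so the derivative of A is τ ⊗ ∇H. The Codazzi symmetry of this tensor
leaves only ∇H = 0 or τ = ∇H ⊗ ∇H / |∇H|², which has norm one. -/
theorem pd_H_eq_zero_or_trace_sq_eq_one {c : ℝ} (hc : ∀ᶠ w in 𝓝 0, F w = c) :
    (∀ j, pd j H 0 = 0) ∨ F 0 = 1 := by
  have hc' : F =ᶠ[𝓝 0] fun _ => c := hc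
  have h0 : ∀ j, pd j F =ᶠ[𝓝 0] fun _ => 0 := fun j =>
    (pd_congr j hc').trans (by rw [pd_const])
  have h1 := S.drift_laplacian_trace_sq hF
  have h2 : ∀ j, pd j (pd j F) 0 = 0 := fun j => by
    rw [(pd_congr j (h0 j)).self_of_nhds, pd_const]
  have h3 : ∀ j, pd j F 0 = 0 := fun j => (h0 j).self_of_nhds
  simp only [h2, h3, mul_zero, add_zero, Finset.sum_const_zero] at h1
  have h4 : ∑ j, ∑ l, ∑ i, pd j (fun w => A l i w / H w) 0 ^ 2 = 0 := by linarith
  have h5 : ∀ j l i, pd j (fun w => A l i w / H w) 0 = 0 := by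
    intro j l i
    have e1 := (Finset.sum_eq_zero_iff_of_nonneg fun j _ => by positivity).1 h4 j
      (Finset.mem_univ _)
    have e2 := (Finset.sum_eq_zero_iff_of_nonneg fun j _ => by positivity).1 e1 l
      (Finset.mem_univ _)
    have e3 := (Finset.sum_eq_zero_iff_of_nonneg fun j _ => by positivity).1 e2 i
      (Finset.mem_univ _)
    exact pow_eq_zero_iff two_ne_zero |>.1 e3
  have hA : ∀ j l i, pd j (A l i) 0 = A l i 0 / H 0 * pd j H 0 := fun j l i => by
    rw [S.pd_A_eq, h5]; ring
  -- the Codazzi equation for `τ = A / H`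
  have cod : ∀ j l i, A l i 0 / H 0 * pd j H 0 = A l j 0 / H 0 * pd i H 0 := fun j l i => by
    rw [← hA, ← hA]; exact (S.pd_A_comm l i j).self_of_nhds
  have htr : ∑ l, A l l 0 / H 0 = 1 := by
    rw [← Finset.sum_div, ← S.trace.self_of_nhds, div_self S.pos.ne']
  by_cases hz : ∀ j, pd j H 0 = 0
  · exact Or.inl hz
  refine Or.inr ?_
  set Q := ∑ j, pd j H 0 ^ 2 with hQ
  have hQpos : Q ≠ 0 := by
    intro hQ0
    refine hz fun j => ?_
    have := (Finset.sum_eq_zero_iff_of_nonneg fun j _ => by positivity).1 hQ0 j (Finset.mem_univ _)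
    exact pow_eq_zero_iff two_ne_zero |>.1 this
  -- Contracting the Codazzi relation and using tr τ = 1 shows that ∇H is fixed by τ; contracting
  -- with ∇H instead gives the rank-one formula.
  have hfix : ∀ j, pd j H 0 = ∑ l, A l j 0 / H 0 * pd l H 0 := fun j => by
    have : ∑ l, A l l 0 / H 0 * pd j H 0 = ∑ l, A l j 0 / H 0 * pd l H 0 :=
      Finset.sum_congr rfl fun l _ => cod j l l
    rw [← this, ← Finset.sum_mul, htr, one_mul]
  have hrank : ∀ l i, A l i 0 / H 0 * Q = pd l H 0 * pd i H 0 := fun l i => by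
    have e : ∀ j, A l i 0 / H 0 * pd j H 0 ^ 2 = A j l 0 / H 0 * pd j H 0 * pd i H 0 := fun j => by
      rw [pow_two, ← mul_assoc, cod j l i, S.A_symm j l]; ring
    rw [hQ, Finset.mul_sum, hfix l, Finset.sum_mul]
    exact Finset.sum_congr rfl fun j _ => e j
  have hfin : F 0 * Q ^ 2 = Q ^ 2 := by
    rw [S.trace_sq_zero hF, Finset.sum_mul]
    simp only [Finset.sum_mul, ← mul_pow, hrank]
    simp only [mul_pow, ← Finset.mul_sum, ← Finset.sum_mul]
    rw [← hQ]; ring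
  exact mul_right_cancel₀ (pow_ne_zero 2 hQpos) (by rw [hfin, one_mul])

theorem abs_A_le (l i : Fin n) : |A l i 0| ≤ H 0 * √(F 0) := by
  have h1 : (A l i 0 / H 0) ^ 2 ≤ F 0 := by
    rw [S.trace_sq_zero hF]
    refine le_trans ?_ (Finset.single_le_sum (f := fun l => ∑ i, (A l i 0 / H 0) ^ 2)
      (fun l _ => Finset.sum_nonneg fun i _ => sq_nonneg _) (Finset.mem_univ l))
    exact Finset.single_le_sum (f := fun i => (A l i 0 / H 0) ^ 2) (fun i _ => sq_nonneg _)
      (Finset.mem_univ i)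
  have h2 := Real.abs_le_sqrt h1
  rw [abs_div, abs_of_pos S.pos, div_le_iff₀ S.pos] at h2
  linarith

/-- The strong maximum principle needs a bounded drift. Since ∇H = A(x^T) and the entries of A are
at most H√F, the quotient ∇H/H is controlled by |x| and F alone. -/
theorem abs_drift_le (j : Fin n) :
    |-t j 0 + 2 * pd j H 0 / H 0| ≤ ‖Y 0‖ + 2 * (n * (√(F 0) * ‖Y 0‖)) := by
  have ht : ∀ k, |t k 0| ≤ ‖Y 0‖ := fun k => by
    rw [← S.inner_Y_tangent]
    refine (abs_real_inner_le_norm _ _).trans ?_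
    simp
  have hH := S.pos
  have h1 : |pd j H 0 / H 0| ≤ n * (√(F 0) * ‖Y 0‖) := by
    rw [abs_div, abs_of_pos hH, div_le_iff₀ hH, S.pd_H]
    refine (Finset.abs_sum_le_sum_abs _ _).trans ?_
    refine (Finset.sum_le_card_nsmul _ _ (H 0 * √(F 0) * ‖Y 0‖) fun k _ => ?_).trans ?_
    · rw [abs_mul]
      exact mul_le_mul (S.abs_A_le hF k j) (ht k) (abs_nonneg _) (by positivity)
    · simp; exact le_of_eq (by ring)
  have h2 : |2 * pd j H 0 / H 0| = 2 * |pd j H 0 / H 0| := by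
    rw [mul_div_assoc, abs_mul, abs_two]
  refine (abs_add_le _ _).trans ?_
  rw [abs_neg, h2]
  linarith [ht j]

end IsShrinkerGerm

/-! ### The Hessian of |x|² at a maximum. -/

namespace IsShrinkerGerm

variable {n : ℕ} {V : Type*} [NormedAddCommGroup V] [InnerProductSpace ℝ V]
  {Y ν : EuclideanSpace ℝ (Fin n) → V} {H : EuclideanSpace ℝ (Fin n) → ℝ}
  {A : Fin n → Fin n → EuclideanSpace ℝ (Fin n) → ℝ}
  {t : Fin n → EuclideanSpace ℝ (Fin n) → ℝ}
  {G : Fin n → Fin n → EuclideanSpace ℝ (Fin n) → ℝ}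
  {ι : EuclideanSpace ℝ (Fin n) →ₗᵢ[ℝ] V}
  (S : IsShrinkerGerm Y ν H A t G ι)
include S

theorem pd_pd_norm_sq (i j : Fin n) : pd i (pd j fun w => inner ℝ (Y w) (Y w)) 0 =
    2 * ((if i = j then 1 else 0) - H 0 * A j i 0) := by
  rw [(pd_pd_inner j i S.smooth_Y S.smooth_Y).self_of_nhds]
  beta_reduce
  rw [real_inner_comm (Y 0), S.inner_Y_pd_pd, S.metric_zero, S.metric_zero]
  simp only [eq_comm (a := i) (b := j)]
  ring

/-- At a maximum of |x|² the Hessian 2(δ - HA) is nonpositive, so m = HA is at least the identity.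
All its 2 × 2 principal minors are positive, and summing mᵢⱼ² ≤ mᵢᵢmⱼⱼ, strict off the diagonal,
gives |m|² < (tr m)² = H⁴. An off-diagonal pair exists because `2 ≤ n`. -/
theorem trace_sq_lt_one_of_isLocalMax (hn : 2 ≤ n)
    (hmax : IsLocalMax (fun w => inner ℝ (Y w) (Y w)) 0) :
    ∑ l, ∑ i, (A l i 0 / H 0) ^ 2 < 1 := by
  have hC : ContDiffAt ℝ 2 (fun w => inner ℝ (Y w) (Y w)) 0 :=
    (S.smooth_Y.inner ℝ S.smooth_Y).of_le two_le_infty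
  have hH := S.pos
  set m : Fin n → Fin n → ℝ := fun i j => H 0 * A i j 0 with hm
  have hquad : ∀ i j (a b : ℝ), i ≠ j →
      a ^ 2 + b ^ 2 ≤ a ^ 2 * m i i + 2 * (a * b) * m i j + b ^ 2 * m j j := by
    intro i j a b hij
    have h1 := fderiv_fderiv_nonpos_of_isLocalMax hC hmax
      (a • EuclideanSpace.single i 1 + b • EuclideanSpace.single j 1)
    simp only [map_add, map_smul, add_apply, smul_apply, ← pd_pd_eq hC, S.pd_pd_norm_sq,
      if_neg hij, if_neg hij.symm, if_true, smul_eq_mul] at h1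
    have h2 := S.A_symm i j
    simp only [hm]
    rw [h2] at h1
    rw [← h2] at h1 ⊢
    nlinarith
  have hne : ∀ i : Fin n, ∃ j, i ≠ j := fun i => by
    have : Nontrivial (Fin n) := Fin.nontrivial_iff_two_le.2 hn
    obtain ⟨j, hj⟩ := exists_ne i
    exact ⟨j, hj.symm⟩
  have hdiag : ∀ i, 1 ≤ m i i := fun i => by
    obtain ⟨j, hj⟩ := hne i
    have := hquad i j 1 0 hj
    linarith
  have hoff : ∀ i j, i ≠ j → m i j ^ 2 < m i i * m j j := by
    intro i j hij
    -- For this vector the quadratic form equals `m j j` times the minor.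
    have h1 := hquad i j (m j j) (-m i j) hij
    have h2 := hdiag j
    have h3 : 0 < m j j * (m i i * m j j - m i j ^ 2) := by nlinarith [sq_nonneg (m i j)]
    have h4 := (pos_iff_pos_of_mul_pos h3).1 (by linarith)
    linarith
  have htr : ∑ i, m i i = H 0 ^ 2 := by
    rw [← Finset.mul_sum, ← S.trace.self_of_nhds, pow_two]
  have hle : ∀ i j, m i j ^ 2 ≤ m i i * m j j := fun i j => by
    rcases eq_or_ne i j with rfl | h
    · exact le_of_eq (pow_two _)
    · exact (hoff i j h).le
  have hlt : ∑ i, ∑ j, m i j ^ 2 < ∑ i, ∑ j, m i i * m j j := by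
    have i₀ : Fin n := ⟨0, by omega⟩
    obtain ⟨j₀, hj₀⟩ := hne i₀
    refine Finset.sum_lt_sum (fun i _ => Finset.sum_le_sum fun j _ => hle i j)
      ⟨i₀, Finset.mem_univ _, Finset.sum_lt_sum (fun j _ => hle i₀ j)
        ⟨j₀, Finset.mem_univ _, hoff i₀ j₀ hj₀⟩⟩
  rw [← Finset.sum_mul_sum, htr] at hlt
  have e : ∑ i, ∑ j, m i j ^ 2 = H 0 ^ 4 * ∑ l, ∑ i, (A l i 0 / H 0) ^ 2 := by
    simp only [Finset.mul_sum, hm]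
    refine Finset.sum_congr rfl fun i _ => Finset.sum_congr rfl fun j _ => ?_
    field_simp
  rw [e] at hlt
  have h4 : 0 < H 0 ^ 4 := by positivity
  nlinarith

end IsShrinkerGerm

/-! ### Gram matrices: basis independence of the trace, the normal projection, smoothness of the
inverse. -/

section Gram

variable {n : ℕ} {V : Type*} [NormedAddCommGroup V] [InnerProductSpace ℝ V]

/-- The Gram matrix of the images of the standard basis vectors. -/
noncomputable def gram (T : EuclideanSpace ℝ (Fin n) →L[ℝ] V) : Matrix (Fin n) (Fin n) ℝ :=
  Matrix.of fun i j => inner ℝ (T (EuclideanSpace.single i 1)) (T (EuclideanSpace.single j 1))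

theorem sum_smul_single (v : EuclideanSpace ℝ (Fin n)) :
    v = ∑ k, v k • EuclideanSpace.single k (1 : ℝ) := by
  ext i
  simp [Finset.sum_apply, Pi.single_apply]

theorem isUnit_det_gram {T : EuclideanSpace ℝ (Fin n) →L[ℝ] V} (hT : Function.Injective T) :
    IsUnit (gram T).det := by
  rw [isUnit_iff_ne_zero]
  intro h0
  obtain ⟨v, hv, hv0⟩ := Matrix.exists_mulVec_eq_zero_iff.2 h0
  have h1 : inner ℝ (T (WithLp.toLp 2 v)) (T (WithLp.toLp 2 v)) = (0 : ℝ) := by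
    rw [sum_smul_single (WithLp.toLp 2 v)]
    simp only [map_sum, map_smul, sum_inner, real_inner_smul_left, inner_sum,
      real_inner_smul_right]
    refine Finset.sum_eq_zero fun i _ => ?_
    have := congrFun hv0 i
    simp only [Matrix.mulVec, dotProduct, gram, Matrix.of_apply, Pi.zero_apply] at this
    rw [← Finset.mul_sum]
    refine mul_eq_zero_of_right _ ((Finset.sum_congr rfl fun j _ => ?_).trans this)
    rw [real_inner_comm, mul_comm]
  have h2 := hT ((inner_self_eq_zero.1 h1).trans (map_zero T).symm)
  exact hv ((WithLp.toLp_eq_zero 2).1 h2)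

theorem sum_gram_inv_mul {T : EuclideanSpace ℝ (Fin n) →L[ℝ] V} (hT : Function.Injective T)
    (i k : Fin n) :
    ∑ j, (gram T)⁻¹ i j *
      inner ℝ (T (EuclideanSpace.single j 1)) (T (EuclideanSpace.single k 1)) =
      if i = k then 1 else 0 := by
  have := congrFun (congrFun (Matrix.nonsing_inv_mul _ (isUnit_det_gram hT)) i) k
  simpa [Matrix.mul_apply, gram, Matrix.one_apply] using this

/-- The metric trace of a bilinear form does not depend on the basis. -/
theorem sum_gram_inv_comp {W : Type*} [AddCommGroup W] [Module ℝ W]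
    {T : EuclideanSpace ℝ (Fin n) →L[ℝ] V}
    {J : EuclideanSpace ℝ (Fin n) →L[ℝ] EuclideanSpace ℝ (Fin n)} (hT : Function.Injective T)
    (hJ : Function.Injective J)
    (B : EuclideanSpace ℝ (Fin n) →ₗ[ℝ] EuclideanSpace ℝ (Fin n) →ₗ[ℝ] W) :
    ∑ i, ∑ j, (gram (T.comp J))⁻¹ i j •
        B (J (EuclideanSpace.single i 1)) (J (EuclideanSpace.single j 1)) =
      ∑ i, ∑ j, (gram T)⁻¹ i j • B (EuclideanSpace.single i 1) (EuclideanSpace.single j 1) := by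
  set K : Matrix (Fin n) (Fin n) ℝ := Matrix.of fun k i => J (EuclideanSpace.single i 1) k with hK
  have hJe : ∀ i, J (EuclideanSpace.single i 1) = ∑ k, K k i • EuclideanSpace.single k (1 : ℝ) :=
    fun i => sum_smul_single _
  have hgram : gram (T.comp J) = K.transpose * gram T * K := by
    ext i j
    simp only [gram, Matrix.of_apply, ContinuousLinearMap.comp_apply, hJe, map_sum, map_smul,
      sum_inner, inner_sum, real_inner_smul_left, real_inner_smul_right, Matrix.mul_apply,
      Matrix.transpose_apply, Finset.sum_mul]
    exact Finset.sum_congr rfl fun k _ => Finset.sum_congr rfl fun l _ => by ring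
  have hTJ : Function.Injective (T.comp J) := hT.comp hJ
  have hdetK : IsUnit K.det := by
    have := isUnit_det_gram hTJ
    rw [hgram, Matrix.det_mul] at this
    exact isUnit_of_mul_isUnit_right this
  have hinv : K * (gram (T.comp J))⁻¹ * K.transpose = (gram T)⁻¹ := by
    have hKt : IsUnit K.transpose.det := by rwa [Matrix.det_transpose]
    rw [hgram, Matrix.mul_inv_rev, Matrix.mul_inv_rev, ← Matrix.mul_assoc, ← Matrix.mul_assoc,
      Matrix.mul_nonsing_inv _ hdetK, Matrix.one_mul, Matrix.mul_assoc,
      Matrix.nonsing_inv_mul _ hKt, Matrix.mul_one]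
  simp only [hJe, map_sum, map_smul, LinearMap.sum_apply, LinearMap.smul_apply, Finset.smul_sum,
    smul_smul]
  simp only [← hinv, Matrix.mul_apply, Matrix.transpose_apply, Finset.sum_smul, Finset.sum_mul]
  calc _ = ∑ i, ∑ j, ∑ k, ∑ l, ((gram (T.comp J))⁻¹ i j * K k i * K l j) •
        B (EuclideanSpace.single k 1) (EuclideanSpace.single l 1) := by
        refine Finset.sum_congr rfl fun i _ => Finset.sum_congr rfl fun j _ => ?_
        rw [Finset.sum_comm]
        refine Finset.sum_congr rfl fun k _ => Finset.sum_congr rfl fun l _ => ?_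
        congr 1; ring
    _ = ∑ k, ∑ l, ∑ i, ∑ j, ((gram (T.comp J))⁻¹ i j * K k i * K l j) •
        B (EuclideanSpace.single k 1) (EuclideanSpace.single l 1) := by
        rw [Finset.sum_congr rfl fun i _ => Finset.sum_comm, Finset.sum_comm]
        refine Finset.sum_congr rfl fun k _ => ?_
        rw [Finset.sum_congr rfl fun i _ => Finset.sum_comm, Finset.sum_comm]
    _ = _ := by
        refine Finset.sum_congr rfl fun k _ => Finset.sum_congr rfl fun l _ => ?_
        rw [Finset.sum_comm]
        refine Finset.sum_congr rfl fun i _ => Finset.sum_congr rfl fun j _ => ?_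
        congr 1; ring

theorem starProjection_orthogonal_range {T : EuclideanSpace ℝ (Fin n) →L[ℝ] V}
    (hT : Function.Injective T) [(LinearMap.range T.toLinearMap)ᗮ.HasOrthogonalProjection] (v : V) :
    (LinearMap.range T.toLinearMap)ᗮ.starProjection v =
      v - ∑ i, ∑ j, ((gram T)⁻¹ i j * inner ℝ v (T (EuclideanSpace.single i 1))) •
        T (EuclideanSpace.single j 1) := by
  set s := ∑ i, ∑ j, ((gram T)⁻¹ i j * inner ℝ v (T (EuclideanSpace.single i 1))) •
        T (EuclideanSpace.single j 1) with hs
  have hsT : s ∈ LinearMap.range T.toLinearMap :=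
    Submodule.sum_mem _ fun i _ => Submodule.sum_mem _ fun j _ =>
      Submodule.smul_mem _ _ ⟨EuclideanSpace.single j 1, rfl⟩
  apply Submodule.eq_starProjection_of_mem_orthogonal
  · rw [Submodule.mem_orthogonal']
    rintro _ ⟨a, rfl⟩
    have key : ∀ k, inner ℝ (v - s) (T (EuclideanSpace.single k 1)) = (0 : ℝ) := by
      intro k
      have h : ∀ i, ∑ j, (gram T)⁻¹ i j * inner ℝ v (T (EuclideanSpace.single i 1)) *
          inner ℝ (T (EuclideanSpace.single j 1)) (T (EuclideanSpace.single k 1)) =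
          inner ℝ v (T (EuclideanSpace.single i 1)) * if i = k then 1 else 0 := by
        intro i
        rw [← sum_gram_inv_mul hT i k, Finset.mul_sum]
        exact Finset.sum_congr rfl fun j _ => by ring
      simp only [hs, inner_sub_left, sum_inner, real_inner_smul_left, h]
      simp
    change inner ℝ (v - s) (T a) = 0
    rw [sum_smul_single a]
    simp [map_sum, inner_sum, real_inner_smul_right, key]
  · rw [sub_sub_cancel]
    exact Submodule.le_orthogonal_orthogonal _ hsT

/-- Cramer's rule: the determinant and the entries of the adjugate are polynomials in the entries,
and injectivity keeps the determinant away from zero. -/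
theorem contDiffAt_gram_inv {E : Type*} [NormedAddCommGroup E] [NormedSpace ℝ E]
    {T : E → EuclideanSpace ℝ (Fin n) →L[ℝ] V} {w : E}
    (hT : ContDiffAt ℝ ∞ T w) (hinj : Function.Injective (T w)) (i j : Fin n) :
    ContDiffAt ℝ ∞ (fun y => (gram (T y))⁻¹ i j) w := by
  have hentry : ∀ a b, ContDiffAt ℝ ∞ (fun y => gram (T y) a b) w := fun a b =>
    (hT.clm_apply contDiffAt_const).inner ℝ (hT.clm_apply contDiffAt_const)
  have hdet : ∀ N : E → Matrix (Fin n) (Fin n) ℝ, (∀ a b, ContDiffAt ℝ ∞ (fun y => N y a b) w) →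
      ContDiffAt ℝ ∞ (fun y => (N y).det) w := by
    intro N hN
    simp only [Matrix.det_apply']
    exact ContDiffAt.sum fun σ _ => contDiffAt_const.mul (contDiffAt_prod fun a _ => hN _ _)
  have h1 : ∀ y, (gram (T y))⁻¹ i j = ((gram (T y)).det)⁻¹ * (gram (T y)).adjugate i j := by
    intro y
    rw [Matrix.inv_def, Ring.inverse_eq_inv', Matrix.smul_apply, smul_eq_mul]
  simp only [h1, Matrix.adjugate_apply]
  refine ((hdet _ hentry).inv (isUnit_det_gram hinj).ne_zero).mul (hdet _ fun a b => ?_)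
  simp only [Matrix.updateRow_apply]
  split_ifs
  · exact contDiffAt_const
  · exact hentry a b

end Gram

/-! ### Transfer of the geometric quantities from preferred charts to one fixed parametrization. -/

theorem fderiv_fderiv_comp {E F W : Type*} [NormedAddCommGroup E] [NormedSpace ℝ E]
    [NormedAddCommGroup F] [NormedSpace ℝ F] [NormedAddCommGroup W] [NormedSpace ℝ W]
    {f : F → W} {ψ : E → F} {w : E} (hf : ContDiffAt ℝ 2 f (ψ w)) (hψ : ContDiffAt ℝ 2 ψ w)
    (a b : E) :
    fderiv ℝ (fderiv ℝ (f ∘ ψ)) w a b =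
      fderiv ℝ (fderiv ℝ f) (ψ w) (fderiv ℝ ψ w a) (fderiv ℝ ψ w b) +
        fderiv ℝ f (ψ w) (fderiv ℝ (fderiv ℝ ψ) w a b) := by
  have h1 : fderiv ℝ (f ∘ ψ) =ᶠ[𝓝 w] fun y => (fderiv ℝ f (ψ y)).comp (fderiv ℝ ψ y) := by
    filter_upwards [hψ.continuousAt.eventually (hf.eventually (by simp)),
      hψ.eventually (by simp)] with y h2 h3
    exact fderiv_comp y (h2.differentiableAt (by simp)) (h3.differentiableAt (by simp))
  have h2 : DifferentiableAt ℝ (fderiv ℝ f) (ψ w) :=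
    (hf.fderiv_right (m := 1) (by norm_num)).differentiableAt (by simp)
  have h3 : DifferentiableAt ℝ (fderiv ℝ ψ) w :=
    (hψ.fderiv_right (m := 1) (by norm_num)).differentiableAt (by simp)
  have h4 : HasFDerivAt (fun y => fderiv ℝ f (ψ y))
      ((fderiv ℝ (fderiv ℝ f) (ψ w)).comp (fderiv ℝ ψ w)) w :=
    h2.hasFDerivAt.comp w (hψ.differentiableAt (by simp)).hasFDerivAt
  rw [h1.fderiv_eq, (h4.clm_comp h3.hasFDerivAt).fderiv]
  simp [add_comm]

section Param

variable {n m : ℕ} {M : Type*} [TopologicalSpace M] [ChartedSpace (EuclideanSpace ℝ (Fin n)) M]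

theorem contDiffAt_comp_extChartAt_symm [IsManifold (𝓡 n) ∞ M]
    {f : M → EuclideanSpace ℝ (Fin m)} {r : WithTop ℕ∞} (hr : r ≤ ∞) {q : M}
    (hf : ContMDiffAt (𝓡 n) (𝓡 m) r f q) :
    ContDiffAt ℝ r (f ∘ (extChartAt (𝓡 n) q).symm) (extChartAt (𝓡 n) q q) := by
  have : IsManifold (𝓡 n) r M := IsManifold.of_le hr
  have h1 : ContMDiffAt (𝓡 n) (𝓡 n) r (extChartAt (𝓡 n) q).symm (extChartAt (𝓡 n) q q) :=
    (contMDiffOn_extChartAt_symm q).contMDiffAt (extChartAt_target_mem_nhds q)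
  have h2 : ContMDiffAt (𝓡 n) (𝓡 m) r f ((extChartAt (𝓡 n) q).symm (extChartAt (𝓡 n) q q)) := by
    rwa [extChartAt_to_inv]
  exact contMDiffAt_iff_contDiffAt.1 (h2.comp _ h1)

theorem differential_eq {f : M → EuclideanSpace ℝ (Fin m)} {q : M}
    (hf : MDifferentiableAt (𝓡 n) (𝓡 m) f q) : differential n f q =
      fderiv ℝ (f ∘ (extChartAt (𝓡 n) q).symm) (extChartAt (𝓡 n) q q) := by
  have h : mfderiv (𝓡 n) (𝓡 m) f q =
      fderivWithin ℝ (writtenInExtChartAt (𝓡 n) (𝓡 m) q f) (Set.range (𝓡 n))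
        (extChartAt (𝓡 n) q q) := by
    rw [mfderiv]
    exact if_pos hf
  unfold differential
  rw [h, ModelWithCorners.range_eq_univ, fderivWithin_univ]
  rfl

/-- A smooth map `P` into `M` that is a regular parametrization of the immersion `x` at `w`. -/
structure IsParamAt (x : M → EuclideanSpace ℝ (Fin m)) (P : EuclideanSpace ℝ (Fin n) → M)
    (w : EuclideanSpace ℝ (Fin n)) : Prop where
  smooth : ContMDiffAt (𝓡 n) (𝓡 n) 2 P w
  injective : Function.Injective (fderiv ℝ (x ∘ P) w)

namespace IsParamAt

variable {x : M → EuclideanSpace ℝ (Fin m)} {P : EuclideanSpace ℝ (Fin n) → M}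
  {w : EuclideanSpace ℝ (Fin n)}

theorem contDiffAt_chart [IsManifold (𝓡 n) ∞ M] (hP : IsParamAt x P w) :
    ContDiffAt ℝ 2 (extChartAt (𝓡 n) (P w) ∘ P) w := by
  have : IsManifold (𝓡 n) 2 M := IsManifold.of_le two_le_infty
  exact contMDiffAt_iff_contDiffAt.1 ((contMDiffAt_extChartAt (x := P w)).comp w hP.smooth)

theorem comp_eventuallyEq (hP : IsParamAt x P w) {W : Type*} (f : M → W) :
    f ∘ P =ᶠ[𝓝 w]
      (f ∘ (extChartAt (𝓡 n) (P w)).symm) ∘ (extChartAt (𝓡 n) (P w) ∘ P) := by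
  have h1 : ∀ᶠ y in 𝓝 w, P y ∈ (extChartAt (𝓡 n) (P w)).source :=
    hP.smooth.continuousAt.eventually (extChartAt_source_mem_nhds (P w))
  filter_upwards [h1] with y hy
  simp only [Function.comp_apply, (extChartAt (𝓡 n) (P w)).left_inv hy]

theorem fderiv_comp [IsManifold (𝓡 n) ∞ M] (hP : IsParamAt x P w)
    {k : ℕ} {f : M → EuclideanSpace ℝ (Fin k)} (hf : ContMDiffAt (𝓡 n) (𝓡 k) 1 f (P w)) :
    fderiv ℝ (f ∘ P) w =
      (differential n f (P w)).comp (fderiv ℝ (extChartAt (𝓡 n) (P w) ∘ P) w) := by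
  rw [(hP.comp_eventuallyEq f).fderiv_eq, differential_eq (hf.mdifferentiableAt (by simp))]
  have h1 : ContDiffAt ℝ 1 (f ∘ (extChartAt (𝓡 n) (P w)).symm) (extChartAt (𝓡 n) (P w) (P w)) :=
    contDiffAt_comp_extChartAt_symm (by simp) hf
  exact _root_.fderiv_comp w (h1.differentiableAt (by simp))
    (hP.contDiffAt_chart.differentiableAt (by simp))

variable [IsManifold (𝓡 n) ∞ M] (hx : IsSmoothImmersion n x) (hP : IsParamAt x P w)
include hx hP

theorem fderiv_comp_self : fderiv ℝ (x ∘ P) w =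
      (differential n x (P w)).comp (fderiv ℝ (extChartAt (𝓡 n) (P w) ∘ P) w) :=
  hP.fderiv_comp (hx.contMDiff.contMDiffAt.of_le (by simp))

theorem injective_chart : Function.Injective (fderiv ℝ (extChartAt (𝓡 n) (P w) ∘ P) w) := by
  have := hP.injective
  rw [hP.fderiv_comp_self hx, ContinuousLinearMap.coe_comp] at this
  exact this.of_comp

theorem tangentPlane_eq :
    tangentPlane n x (P w) = LinearMap.range (fderiv ℝ (x ∘ P) w).toLinearMap := by
  have hs : Function.Surjective (fderiv ℝ (extChartAt (𝓡 n) (P w) ∘ P) w) :=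
    LinearMap.injective_iff_surjective (f := (fderiv ℝ (extChartAt (𝓡 n) (P w) ∘ P) w).toLinearMap)
      |>.1 (hP.injective_chart hx)
  rw [hP.fderiv_comp_self hx]
  ext v
  constructor
  · rintro ⟨a, rfl⟩
    obtain ⟨b, rfl⟩ := hs a
    exact ⟨b, rfl⟩
  · rintro ⟨b, rfl⟩
    exact ⟨_, rfl⟩

theorem normalPart_eq (v : EuclideanSpace ℝ (Fin m)) : normalPart n x (P w) v =
    v - ∑ i, ∑ j, ((gram (fderiv ℝ (x ∘ P) w))⁻¹ i j *
      inner ℝ v (fderiv ℝ (x ∘ P) w (EuclideanSpace.single i 1))) •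
        fderiv ℝ (x ∘ P) w (EuclideanSpace.single j 1) := by
  rw [← starProjection_orthogonal_range hP.injective]
  simp only [normalPart, normalPlane, hP.tangentPlane_eq hx]

omit hP in
omit [IsManifold (𝓡 n) ∞ M] hx in
theorem normalPart_of_mem {q : M} {v : EuclideanSpace ℝ (Fin m)} (hv : v ∈ tangentPlane n x q) :
    normalPart n x q v = 0 := by
  apply (Submodule.starProjection_apply_eq_zero_iff _).2
  exact Submodule.le_orthogonal_orthogonal _ hv

omit hP in
omit [IsManifold (𝓡 n) ∞ M] hx in
theorem metricTrace_map {q : M} (L : EuclideanSpace ℝ (Fin m) →L[ℝ] EuclideanSpace ℝ (Fin m))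
    (B : EuclideanSpace ℝ (Fin n) → EuclideanSpace ℝ (Fin n) → EuclideanSpace ℝ (Fin m)) :
    metricTrace n x q (fun u v => L (B u v)) = L (metricTrace n x q B) := by
  simp [metricTrace, map_sum]

/-- The definition uses a chart that changes with the point, so it cannot be differentiated
directly. Passing to `P` changes the second derivative by a tangential vector, killed by the normal
projection; what remains is bilinear, and its metric trace does not depend on the basis. -/
theorem meanCurvature_eq : meanCurvature n x (P w) = normalPart n x (P w)
    (∑ i, ∑ j, (gram (fderiv ℝ (x ∘ P) w))⁻¹ i j • pd i (pd j (x ∘ P)) w) := by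
  set ψ := extChartAt (𝓡 n) (P w) ∘ P with hψ
  set X := x ∘ (extChartAt (𝓡 n) (P w)).symm with hX
  have hXC : ContDiffAt ℝ 2 X (ψ w) :=
    contDiffAt_comp_extChartAt_symm two_le_infty
      (hx.contMDiff.contMDiffAt.of_le two_le_infty)
  have hYC : ContDiffAt ℝ 2 (x ∘ P) w :=
    (hXC.comp w hP.contDiffAt_chart).congr_of_eventuallyEq (hP.comp_eventuallyEq x)
  have hD := differential_eq (n := n) ((hx.contMDiff.contMDiffAt (x := P w)).mdifferentiableAt
    (by simp))
  have h2 : ∀ a b, fderiv ℝ (fderiv ℝ (x ∘ P)) w a b =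
      secondDerivative n x (P w) (fderiv ℝ ψ w a) (fderiv ℝ ψ w b) +
        differential n x (P w) (fderiv ℝ (fderiv ℝ ψ) w a b) := by
    intro a b
    rw [hD, (hP.comp_eventuallyEq x).fderiv.fderiv_eq]
    exact fderiv_fderiv_comp hXC hP.contDiffAt_chart a b
  have hN : ∀ a b, normalPart n x (P w) (fderiv ℝ (fderiv ℝ (x ∘ P)) w a b) =
      normalPart n x (P w) (secondDerivative n x (P w) (fderiv ℝ ψ w a) (fderiv ℝ ψ w b)) := by
    intro a b
    have h3 : normalPart n x (P w) (differential n x (P w) (fderiv ℝ (fderiv ℝ ψ) w a b)) = 0 :=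
      normalPart_of_mem ⟨_, rfl⟩
    rw [h2]
    unfold normalPart at h3 ⊢
    rw [map_add, h3, add_zero]
  have key := sum_gram_inv_comp (T := differential n x (P w)) (J := fderiv ℝ ψ w)
    (hx.injective_differential _) (hP.injective_chart hx)
    (LinearMap.mk₂ ℝ (fun a b => normalPart n x (P w) (secondDerivative n x (P w) a b))
      (by intros; simp [normalPart]) (by intros; simp [normalPart])
      (by intros; simp [normalPart]) (by intros; simp [normalPart]))
  rw [← hP.fderiv_comp_self hx] at key
  have hmap : ∀ v, normalPart n x (P w) v = (normalPlane n x (P w)).starProjection v := fun v => rfl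
  have hR : normalPart n x (P w)
      (∑ i, ∑ j, (gram (fderiv ℝ (x ∘ P) w))⁻¹ i j • pd i (pd j (x ∘ P)) w) =
      ∑ i, ∑ j, (gram (fderiv ℝ (x ∘ P) w))⁻¹ i j • normalPart n x (P w)
        (fderiv ℝ (fderiv ℝ (x ∘ P)) w (EuclideanSpace.single i 1)
          (EuclideanSpace.single j 1)) := by
    simp only [pd_pd_eq hYC, hmap, map_sum, map_smul]
  rw [hR]
  simp only [hN]
  exact key.symm

/-- The `g`-norm squared of the differential of a map, in a parametrization. -/
theorem energy_eq {f : M → EuclideanSpace ℝ (Fin m)} (hf : ContMDiffAt (𝓡 n) (𝓡 m) 1 f (P w)) :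
    ∑ i, ∑ j, (inducedMetric n x (P w))⁻¹ i j *
      inner ℝ (differential n f (P w) (EuclideanSpace.single i 1))
        (differential n f (P w) (EuclideanSpace.single j 1)) =
    ∑ i, ∑ j, (gram (fderiv ℝ (x ∘ P) w))⁻¹ i j *
      inner ℝ (pd i (f ∘ P) w) (pd j (f ∘ P) w) := by
  have key := sum_gram_inv_comp (T := differential n x (P w))
    (J := fderiv ℝ (extChartAt (𝓡 n) (P w) ∘ P) w)
    (hx.injective_differential _) (hP.injective_chart hx)
    (LinearMap.mk₂ ℝ (fun a b => inner ℝ (differential n f (P w) a) (differential n f (P w) b))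
      (by intros; simp [inner_add_left]) (by intros; simp [real_inner_smul_left])
      (by intros; simp [inner_add_right]) (by intros; simp [real_inner_smul_right]))
  simp only [LinearMap.mk₂_apply, smul_eq_mul] at key
  rw [← hP.fderiv_comp_self hx] at key
  refine key.symm.trans ?_
  simp only [pd, hP.fderiv_comp hf, ContinuousLinearMap.comp_apply]

end IsParamAt

end Param

/-! ### Graph coordinates over the tangent plane at a point. -/

section GraphParam

variable {n m : ℕ} {M : Type*} [TopologicalSpace M] [ChartedSpace (EuclideanSpace ℝ (Fin n)) M]

/-- The coordinates of the orthogonal projection of `x` to the affine tangent plane at `q`, which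
`ι` identifies with `ℝⁿ`. -/
noncomputable def graphCoord (x : M → EuclideanSpace ℝ (Fin m))
    (ι : EuclideanSpace ℝ (Fin n) →ₗᵢ[ℝ] EuclideanSpace ℝ (Fin m)) (q : M) :
    M → EuclideanSpace ℝ (Fin n) :=
  fun q' => ContinuousLinearMap.adjoint ι.toContinuousLinearMap (x q' - x q)

/-- `P` is the local inverse of the graph coordinates at `q`. -/
structure IsGraphParam (x : M → EuclideanSpace ℝ (Fin m)) (q : M)
    (ι : EuclideanSpace ℝ (Fin n) →ₗᵢ[ℝ] EuclideanSpace ℝ (Fin m))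
    (P : EuclideanSpace ℝ (Fin n) → M) : Prop where
  map_zero : P 0 = q
  smooth : ContMDiffAt (𝓡 n) (𝓡 n) ∞ P 0
  eventually_smooth : ∀ᶠ w in 𝓝 0, ContMDiffAt (𝓡 n) (𝓡 n) 2 P w
  right_inv : ∀ᶠ w in 𝓝 0, graphCoord x ι q (P w) = w
  left_inv : ∀ᶠ q' in 𝓝 q, P (graphCoord x ι q q') = q'
  range_eq : LinearMap.range ι.toLinearMap = tangentPlane n x q

theorem adjoint_apply_self (ι : EuclideanSpace ℝ (Fin n) →ₗᵢ[ℝ] EuclideanSpace ℝ (Fin m))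
    (v : EuclideanSpace ℝ (Fin n)) :
    ContinuousLinearMap.adjoint ι.toContinuousLinearMap (ι v) = v := by
  exact congrArg (fun L => L v) ι.adjoint_comp_self

theorem adjoint_apply_coord (ι : EuclideanSpace ℝ (Fin n) →ₗᵢ[ℝ] EuclideanSpace ℝ (Fin m))
    (v : EuclideanSpace ℝ (Fin m)) (k : Fin n) :
    ContinuousLinearMap.adjoint ι.toContinuousLinearMap v k =
      inner ℝ v (ι (EuclideanSpace.single k 1)) := by
  have h : inner ℝ (ContinuousLinearMap.adjoint ι.toContinuousLinearMap v)
      (EuclideanSpace.single k (1 : ℝ)) = inner ℝ v (ι (EuclideanSpace.single k 1)) :=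
    ContinuousLinearMap.adjoint_inner_left _ _ _
  rw [← h, EuclideanSpace.inner_single_right]
  simp

theorem exists_linearIsometry_range_eq {x : M → EuclideanSpace ℝ (Fin m)}
    (hx : IsSmoothImmersion n x) (q : M) :
    ∃ ι : EuclideanSpace ℝ (Fin n) →ₗᵢ[ℝ] EuclideanSpace ℝ (Fin m),
      LinearMap.range ι.toLinearMap = tangentPlane n x q := by
  have hfin : Module.finrank ℝ (tangentPlane n x q) = n := by
    have := LinearMap.finrank_range_of_inj (f := (differential n x q).toLinearMap)
      (hx.injective_differential q)
    exact this.trans finrank_euclideanSpace_fin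
  let b := (stdOrthonormalBasis ℝ (tangentPlane n x q)).reindex (finCongr hfin)
  refine ⟨(tangentPlane n x q).subtypeₗᵢ.comp b.repr.symm.toLinearIsometry, ?_⟩
  ext v
  constructor
  · rintro ⟨a, rfl⟩
    exact (b.repr.symm a).2
  · intro hv
    exact ⟨b.repr ⟨v, hv⟩, by simp⟩

/-- The inverse function theorem, applied to the projection to the tangent plane read in a chart.
Its derivative is the adjoint of `ι` after dx, which is injective because dx takes values in the
range of `ι`. -/
theorem exists_isGraphParam [IsManifold (𝓡 n) ∞ M] {x : M → EuclideanSpace ℝ (Fin m)}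
    (hx : IsSmoothImmersion n x) (q : M) :
    ∃ (ι : EuclideanSpace ℝ (Fin n) →ₗᵢ[ℝ] EuclideanSpace ℝ (Fin m))
      (P : EuclideanSpace ℝ (Fin n) → M), IsGraphParam x q ι P := by
  obtain ⟨ι, hι⟩ := exists_linearIsometry_range_eq hx q
  set φ := extChartAt (𝓡 n) q with hφ
  set X := x ∘ φ.symm with hX
  have hXC : ContDiffAt ℝ ∞ X (φ q) := contDiffAt_comp_extChartAt_symm le_rfl
    hx.contMDiff.contMDiffAt
  have hXD : HasFDerivAt X (differential n x q) (φ q) := by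
    rw [differential_eq (hx.contMDiff.contMDiffAt.mdifferentiableAt (by simp))]
    exact (hXC.differentiableAt (by simp)).hasFDerivAt
  set θ : EuclideanSpace ℝ (Fin n) → EuclideanSpace ℝ (Fin n) := fun u =>
    ContinuousLinearMap.adjoint ι.toContinuousLinearMap (X u - x q) with hθ
  have hθC : ContDiffAt ℝ ∞ θ (φ q) :=
    (ContinuousLinearMap.adjoint ι.toContinuousLinearMap).contDiff.contDiffAt.comp _
      (hXC.sub contDiffAt_const)
  set D := (ContinuousLinearMap.adjoint ι.toContinuousLinearMap).comp (differential n x q) with hD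
  have hinj : Function.Injective D := by
    rw [injective_iff_map_eq_zero]
    intro v hv
    have h1 : differential n x q v ∈ LinearMap.range ι.toLinearMap := by
      rw [hι]; exact ⟨v, rfl⟩
    obtain ⟨a, ha⟩ := h1
    have ha' : ι a = differential n x q v := ha
    have h2 : a = 0 := by
      rw [← adjoint_apply_self ι a, ha']
      exact hv
    apply hx.injective_differential q
    rw [← ha', h2, _root_.map_zero, _root_.map_zero]
  let Deq : EuclideanSpace ℝ (Fin n) ≃L[ℝ] EuclideanSpace ℝ (Fin n) :=
    (LinearEquiv.ofInjectiveEndo D.toLinearMap hinj).toContinuousLinearEquiv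
  have hθD : HasFDerivAt θ (Deq : EuclideanSpace ℝ (Fin n) →L[ℝ] EuclideanSpace ℝ (Fin n))
      (φ q) := by
    have h1 : HasFDerivAt θ D (φ q) :=
      (ContinuousLinearMap.adjoint ι.toContinuousLinearMap).hasFDerivAt.comp _
        (hXD.sub_const (x q))
    exact h1.congr_fderiv (ContinuousLinearMap.ext fun v => rfl)
  have hθ0 : θ (φ q) = 0 := by
    simp [hθ, hX, hφ]
  have hne : (∞ : WithTop ℕ∞) ≠ 0 := by simp
  set g := hθC.localInverse hθD hne with hg
  have hgC : ContDiffAt ℝ ∞ g 0 := by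
    rw [← hθ0]; exact hθC.to_localInverse hθD hne
  have hg0 : g 0 = φ q := by
    rw [← hθ0]; exact hθC.localInverse_apply_image hθD hne
  have hstrict : HasStrictFDerivAt θ
      (Deq : EuclideanSpace ℝ (Fin n) →L[ℝ] EuclideanSpace ℝ (Fin n)) (φ q) :=
    hθC.hasStrictFDerivAt' hθD hne
  have hright : ∀ᶠ w in 𝓝 0, θ (g w) = w := by
    rw [← hθ0]; exact hstrict.eventually_right_inverse
  have hleft : ∀ᶠ u in 𝓝 (φ q), g (θ u) = u := hstrict.eventually_left_inverse
  have hsymm : ∀ r : WithTop ℕ∞, r ≤ ∞ → ∀ᶠ u in 𝓝 (φ q), ContMDiffAt (𝓡 n) (𝓡 n) r φ.symm u := by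
    intro r hr
    have : IsManifold (𝓡 n) r M := IsManifold.of_le hr
    filter_upwards [(isOpen_extChartAt_target (I := 𝓡 n) q).mem_nhds
      (mem_extChartAt_target (I := 𝓡 n) q)] with u hu
    exact (contMDiffOn_extChartAt_symm q).contMDiffAt
      ((isOpen_extChartAt_target (I := 𝓡 n) q).mem_nhds hu)
  refine ⟨ι, fun w => φ.symm (g w), ?_, ?_, ?_, ?_, ?_, hι⟩
  · simp [hg0, hφ]
  · have h1 := (hsymm ∞ le_rfl).self_of_nhds
    rw [← hg0] at h1
    exact h1.comp 0 (contMDiffAt_iff_contDiffAt.2 hgC)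
  -- Being C^∞ at a point yields a neighbourhood only for each finite order separately; order 2 is
  -- what the sequel uses.
  · have h1 := hgC.continuousAt.eventually (by rw [hg0]; exact hsymm 2 two_le_infty)
    filter_upwards [h1, (hgC.of_le two_le_infty).eventually (by simp)] with w h2 h3
    exact h2.comp w (contMDiffAt_iff_contDiffAt.2 h3)
  · exact hright
  · have h1 : ∀ᶠ q' in 𝓝 q, g (θ (φ q')) = φ q' :=
      (continuousAt_extChartAt (I := 𝓡 n) q).eventually hleft
    filter_upwards [h1, extChartAt_source_mem_nhds (I := 𝓡 n) q] with q' h2 h3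
    have h4 : graphCoord x ι q q' = θ (φ q') := by
      simp only [graphCoord, hθ, hX, Function.comp_apply]
      rw [φ.left_inv h3]
    rw [h4, h2, φ.left_inv h3]

namespace IsGraphParam

variable {x : M → EuclideanSpace ℝ (Fin m)} {q : M}
  {ι : EuclideanSpace ℝ (Fin n) →ₗᵢ[ℝ] EuclideanSpace ℝ (Fin m)}
  {P : EuclideanSpace ℝ (Fin n) → M}

theorem tendsto (hP : IsGraphParam x q ι P) : Tendsto P (𝓝 0) (𝓝 q) := by
  have := hP.smooth.continuousAt.tendsto
  rwa [hP.map_zero] at this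

theorem contDiffAt_comp (hP : IsGraphParam x q ι P) {W : Type*} [NormedAddCommGroup W]
    [NormedSpace ℝ W] {f : M → W} (hf : ContMDiffAt (𝓡 n) 𝓘(ℝ, W) ∞ f q) :
    ContDiffAt ℝ ∞ (f ∘ P) 0 := by
  rw [← hP.map_zero] at hf
  exact contMDiffAt_iff_contDiffAt.1 (hf.comp 0 hP.smooth)

theorem contMDiffAt_graphCoord (hx : IsSmoothImmersion n x) (q' : M) :
    ContMDiffAt (𝓡 n) (𝓡 n) ∞ (graphCoord x ι q) q' := by
  have h1 : ContDiffAt ℝ ∞ (fun y => ContinuousLinearMap.adjoint ι.toContinuousLinearMap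
      (y - x q)) (x q') :=
    (ContinuousLinearMap.adjoint ι.toContinuousLinearMap).contDiff.contDiffAt.comp _
      (contDiffAt_id.sub contDiffAt_const)
  exact (contMDiffAt_iff_contDiffAt.2 h1).comp q' hx.contMDiff.contMDiffAt

omit [TopologicalSpace M] [ChartedSpace (EuclideanSpace ℝ (Fin n)) M] in
theorem graphCoord_self : graphCoord x ι q q = 0 := by
  simp [graphCoord]

/-- The graph coordinates are smooth on M and `P` inverts them near q, so smoothness of a function
at q may be checked at the origin. -/
theorem contMDiffAt_of_comp (hP : IsGraphParam x q ι P) (hx : IsSmoothImmersion n x) {W : Type*}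
    [NormedAddCommGroup W] [NormedSpace ℝ W] {f : M → W} (hf : ContDiffAt ℝ ∞ (f ∘ P) 0) :
    ContMDiffAt (𝓡 n) 𝓘(ℝ, W) ∞ f q := by
  have h1 : f =ᶠ[𝓝 q] (f ∘ P) ∘ graphCoord x ι q := by
    filter_upwards [hP.left_inv] with q' h
    simp only [Function.comp_apply, h]
  refine ContMDiffAt.congr_of_eventuallyEq ?_ h1
  refine ContMDiffAt.comp (I' := 𝓡 n) q ?_ (contMDiffAt_graphCoord hx q)
  rw [graphCoord_self]
  exact contMDiffAt_iff_contDiffAt.2 hf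

theorem inner_eq (hP : IsGraphParam x q ι P) : ∀ᶠ w in 𝓝 0, ∀ k,
    inner ℝ ((x ∘ P) w) (ι (EuclideanSpace.single k 1)) =
      w k + inner ℝ (x q) (ι (EuclideanSpace.single k 1)) := by
  filter_upwards [hP.right_inv] with w hw k
  have h1 : graphCoord x ι q (P w) k = w k := by rw [hw]
  rw [graphCoord, adjoint_apply_coord, inner_sub_left] at h1
  simp only [Function.comp_apply]
  linarith

theorem eventually_smooth_self (hP : IsGraphParam x q ι P) (hx : IsSmoothImmersion n x) :
    ∀ᶠ w in 𝓝 0, ContDiffAt ℝ 2 (x ∘ P) w := by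
  filter_upwards [hP.eventually_smooth] with w hw
  exact contMDiffAt_iff_contDiffAt.1
    ((hx.contMDiff.contMDiffAt.of_le two_le_infty).comp w hw)

/-- The derivative of the identity `right_inv`. It makes `x ∘ P` regular near the origin and, the
adjoint being norm-nonincreasing, bounds its differential from below by 1. -/
theorem eventually_adjoint_fderiv (hP : IsGraphParam x q ι P) (hx : IsSmoothImmersion n x) :
    ∀ᶠ w in 𝓝 0, ∀ v, ContinuousLinearMap.adjoint ι.toContinuousLinearMap
      (fderiv ℝ (x ∘ P) w v) = v := by
  have h1 : (fun w => graphCoord x ι q (P w)) =ᶠ[𝓝 0] id := hP.right_inv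
  filter_upwards [h1.fderiv (𝕜 := ℝ), hP.eventually_smooth_self hx] with w hw hs v
  have h2 : HasFDerivAt (fun w => graphCoord x ι q (P w))
      ((ContinuousLinearMap.adjoint ι.toContinuousLinearMap).comp (fderiv ℝ (x ∘ P) w)) w :=
    (ContinuousLinearMap.adjoint ι.toContinuousLinearMap).hasFDerivAt.comp w
      ((hs.differentiableAt (by simp)).hasFDerivAt.sub_const (x q))
  rw [h2.fderiv, fderiv_id] at hw
  exact congrArg (fun L => L v) hw

theorem eventually_isParamAt (hP : IsGraphParam x q ι P) (hx : IsSmoothImmersion n x) :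
    ∀ᶠ w in 𝓝 0, IsParamAt x P w := by
  filter_upwards [hP.eventually_smooth, hP.eventually_adjoint_fderiv hx] with w h1 h2
  exact ⟨h1, fun a b hab => by rw [← h2 a, ← h2 b, hab]⟩

theorem fderiv_zero [IsManifold (𝓡 n) ∞ M] (hP : IsGraphParam x q ι P)
    (hx : IsSmoothImmersion n x) (v : EuclideanSpace ℝ (Fin n)) :
    fderiv ℝ (x ∘ P) 0 v = ι v := by
  have h1 := (hP.eventually_isParamAt hx).self_of_nhds
  have h2 : fderiv ℝ (x ∘ P) 0 v ∈ LinearMap.range ι.toLinearMap := by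
    rw [hP.range_eq, ← hP.map_zero, h1.tangentPlane_eq hx]
    exact ⟨v, rfl⟩
  obtain ⟨a, ha⟩ := h2
  have ha' : ι a = fderiv ℝ (x ∘ P) 0 v := ha
  have h3 := (hP.eventually_adjoint_fderiv hx).self_of_nhds v
  rw [← ha', adjoint_apply_self] at h3
  rw [← ha', h3]

theorem gram_zero [IsManifold (𝓡 n) ∞ M] (hP : IsGraphParam x q ι P)
    (hx : IsSmoothImmersion n x) : gram (fderiv ℝ (x ∘ P) 0) = 1 := by
  ext i j
  simp only [gram, Matrix.of_apply, hP.fderiv_zero hx, IsShrinkerGerm.inner_map_single,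
    Matrix.one_apply]

theorem inner_pd_pd_zero (hP : IsGraphParam x q ι P) (hx : IsSmoothImmersion n x)
    (i j l : Fin n) :
    inner ℝ (pd i (pd j (x ∘ P)) 0) (ι (EuclideanSpace.single l 1)) = (0 : ℝ) := by
  have hY := hP.contDiffAt_comp hx.contMDiff.contMDiffAt
  have h1 : (fun w => inner ℝ ((x ∘ P) w) (ι (EuclideanSpace.single l 1))) =ᶠ[𝓝 0]
      fun w => w l + inner ℝ (x q) (ι (EuclideanSpace.single l 1)) :=
    hP.inner_eq.mono fun w hw => hw l
  have h2 := (pd_congr i (pd_congr j h1)).self_of_nhds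
  have h3 : ContDiffAt ℝ ∞ (fun w : EuclideanSpace ℝ (Fin n) => w l) 0 := by fun_prop
  rw [(pd_pd_inner_const j i hY _).self_of_nhds,
    (pd_pd_add j i h3 contDiffAt_const).self_of_nhds] at h2
  simpa [pd_coord, pd_const] using h2

/-- The mean curvature vector is the sum of the pure second derivatives in graph coordinates. -/
theorem meanCurvature_eq [IsManifold (𝓡 n) ∞ M] (hP : IsGraphParam x q ι P)
    (hx : IsSmoothImmersion n x) : meanCurvature n x q = ∑ i, pd i (pd i (x ∘ P)) 0 := by
  have h1 := ((hP.eventually_isParamAt hx).self_of_nhds).meanCurvature_eq hx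
  rw [hP.map_zero, hP.gram_zero hx, inv_one] at h1
  simp only [Matrix.one_apply, ite_smul, one_smul, zero_smul, Finset.sum_ite_eq,
    Finset.mem_univ, if_true] at h1
  rw [h1, normalPart, Submodule.starProjection_eq_self_iff, normalPlane, ← hP.range_eq,
    Submodule.mem_orthogonal']
  rintro _ ⟨a, rfl⟩
  change inner ℝ _ (ι a) = 0
  rw [sum_smul_single a]
  simp [sum_inner, inner_sum, real_inner_smul_right, hP.inner_pd_pd_zero hx]

end IsGraphParam

end GraphParam

/-! ### The strong maximum principle on the immersed manifold. -/

section StrongMaximum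

variable {n m : ℕ} {M : Type*} [TopologicalSpace M] [ChartedSpace (EuclideanSpace ℝ (Fin n)) M]
  {x : M → EuclideanSpace ℝ (Fin m)}

theorem norm_adjoint_apply_le (ι : EuclideanSpace ℝ (Fin n) →ₗᵢ[ℝ] EuclideanSpace ℝ (Fin m))
    (v : EuclideanSpace ℝ (Fin m)) :
    ‖ContinuousLinearMap.adjoint ι.toContinuousLinearMap v‖ ≤ ‖v‖ := by
  refine (ContinuousLinearMap.le_opNorm _ _).trans ?_
  rw [LinearIsometryEquiv.norm_map]
  exact mul_le_of_le_one_left (norm_nonneg _) ι.norm_toContinuousLinearMap_le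

/-- Passing from graph coordinates `P` at a point to graph coordinates `P₀` at a nearby point. -/
theorem exists_frame [IsManifold (𝓡 n) ∞ M] (hx : IsSmoothImmersion n x) {f : M → ℝ} {q₀ : M}
    {ι₀ ι : EuclideanSpace ℝ (Fin n) →ₗᵢ[ℝ] EuclideanSpace ℝ (Fin m)}
    {P₀ P : EuclideanSpace ℝ (Fin n) → M} {u : EuclideanSpace ℝ (Fin n)} {K L : ℝ}
    (hK : 0 < K) (hL : 0 ≤ L)
    (hfu : ContDiffAt ℝ 2 (f ∘ P₀) u) (hXu : ContDiffAt ℝ 2 (x ∘ P₀) u)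
    (hadj : ∀ v, ContinuousLinearMap.adjoint ι₀.toContinuousLinearMap
      (fderiv ℝ (x ∘ P₀) u v) = v)
    (hDK : ‖fderiv ℝ (x ∘ P₀) u‖ ≤ K) (hDL : ‖fderiv ℝ (fderiv ℝ (x ∘ P₀)) u‖ ≤ L)
    (hright : graphCoord x ι₀ q₀ (P₀ u) = u)
    (hleft : ∀ᶠ q' in 𝓝 (P₀ u), P₀ (graphCoord x ι₀ q₀ q') = q')
    (hP : IsGraphParam x (P₀ u) ι P) :
    ∃ (e s : Fin n → EuclideanSpace ℝ (Fin n)), (∀ k, ‖e k‖ ≤ 1) ∧ (∀ k, ‖s k‖ ≤ L) ∧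
      (∀ v, 1 / K ^ 2 * ‖v‖ ^ 2 ≤ ∑ k, (inner ℝ v (e k)) ^ 2) ∧
      (∀ k, pd k (f ∘ P) 0 = fderiv ℝ (f ∘ P₀) u (e k)) ∧
      ∀ k, pd k (pd k (f ∘ P)) 0 =
        fderiv ℝ (fderiv ℝ (f ∘ P₀)) u (e k) (e k) + fderiv ℝ (f ∘ P₀) u (s k) := by
  set ϕ : EuclideanSpace ℝ (Fin n) → EuclideanSpace ℝ (Fin n) :=
    fun w => graphCoord x ι₀ q₀ (P w) with hϕ
  have hϕ0 : ϕ 0 = u := by simp only [hϕ, hP.map_zero, hright]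
  have hϕC : ContDiffAt ℝ 2 ϕ 0 :=
    (hP.contDiffAt_comp (IsGraphParam.contMDiffAt_graphCoord hx _)).of_le two_le_infty
  have hcomp : ∀ {W : Type} (g : M → W), g ∘ P =ᶠ[𝓝 0] (g ∘ P₀) ∘ ϕ := by
    intro W g
    filter_upwards [hP.tendsto.eventually hleft] with w hw
    simp only [Function.comp_apply, hϕ, hw]
  have hdiff := hϕC.differentiableAt (by simp)
  have hD1 : ∀ v, fderiv ℝ (x ∘ P₀) u (fderiv ℝ ϕ 0 v) = ι v := by
    intro v
    rw [← hP.fderiv_zero hx v, (hcomp x).fderiv_eq, ← hϕ0]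
    rw [fderiv_comp _ (by rw [hϕ0]; exact hXu.differentiableAt (by simp)) hdiff]
    rfl
  have hinj : Function.Injective (fderiv ℝ ϕ 0) := fun a b hab => by
    apply ι.injective
    rw [← hD1, ← hD1, hab]
  have hsurj : Function.Surjective (fderiv ℝ ϕ 0) :=
    LinearMap.injective_iff_surjective (f := (fderiv ℝ ϕ 0).toLinearMap) |>.1 hinj
  have hlow : ∀ v, ‖v‖ ≤ ‖fderiv ℝ (x ∘ P₀) u v‖ := fun v => by
    have := norm_adjoint_apply_le ι₀ (fderiv ℝ (x ∘ P₀) u v)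
    rwa [hadj] at this
  have he1 : ∀ k, ‖fderiv ℝ ϕ 0 (EuclideanSpace.single k 1)‖ ≤ 1 := fun k => by
    refine (hlow _).trans ?_
    rw [hD1, ι.norm_map]; simp
  have hYC : ContDiffAt ℝ 2 (x ∘ P) 0 :=
    (hP.contDiffAt_comp hx.contMDiff.contMDiffAt).of_le two_le_infty
  refine ⟨fun k => fderiv ℝ ϕ 0 (EuclideanSpace.single k 1), fun k =>
    fderiv ℝ (fderiv ℝ ϕ) 0 (EuclideanSpace.single k 1) (EuclideanSpace.single k 1), he1,
    fun k => ?_, fun v => ?_, fun k => ?_, fun k => ?_⟩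
  · set s := fderiv ℝ (fderiv ℝ ϕ) 0 (EuclideanSpace.single k 1) (EuclideanSpace.single k 1) with hs
    set e := fderiv ℝ ϕ 0 (EuclideanSpace.single k 1) with he
    -- Bound for the second derivative `s` of the transition map. The pure second derivative of `x ∘
    -- P` is normal, while dX(s) is tangential, where X is `x ∘ P₀`. Hence |dX(s)|² = -⟨d²X(e, e),
    -- dX(s)⟩, so |dX(s)| ≤ `L`, and |s| ≤ |dX(s)|.
    obtain ⟨a, ha⟩ := hsurj s
    have h1 : pd k (pd k (x ∘ P)) 0 =
        fderiv ℝ (fderiv ℝ (x ∘ P₀)) u e e + fderiv ℝ (x ∘ P₀) u s := by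
      rw [pd_pd_eq hYC, (hcomp x).fderiv.fderiv_eq,
        fderiv_fderiv_comp (by rw [hϕ0]; exact hXu) hϕC, hϕ0]
    have h2 : inner ℝ (pd k (pd k (x ∘ P)) 0) (ι a) = (0 : ℝ) := by
      rw [sum_smul_single a]
      simp [inner_sum, real_inner_smul_right, hP.inner_pd_pd_zero hx]
    have h3 : fderiv ℝ (x ∘ P₀) u s = ι a := by rw [← ha, hD1]
    rw [h1, ← h3, inner_add_left, real_inner_self_eq_norm_sq] at h2
    have h4 : |inner ℝ (fderiv ℝ (fderiv ℝ (x ∘ P₀)) u e e) (fderiv ℝ (x ∘ P₀) u s)| ≤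
        L * ‖fderiv ℝ (x ∘ P₀) u s‖ := by
      refine (abs_real_inner_le_norm _ _).trans ?_
      refine mul_le_mul_of_nonneg_right ?_ (norm_nonneg _)
      refine (ContinuousLinearMap.le_opNorm₂ _ _ _).trans ?_
      have := he1 k
      calc _ ≤ L * 1 * 1 := by gcongr
        _ = L := by ring
    refine (hlow s).trans ?_
    by_contra! hcon
    have h5 := (abs_le.1 h4).1
    nlinarith [norm_nonneg (fderiv ℝ (x ∘ P₀) u s)]
  · obtain ⟨a, rfl⟩ := hsurj v
    set v := fderiv ℝ ϕ 0 a with hv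
    set S := ∑ k, (inner ℝ v (fderiv ℝ ϕ 0 (EuclideanSpace.single k 1))) ^ 2 with hS
    have h1 : ‖v‖ ^ 2 = ∑ k, a k * inner ℝ v (fderiv ℝ ϕ 0 (EuclideanSpace.single k 1)) := by
      have hva : v = ∑ k, a k • fderiv ℝ ϕ 0 (EuclideanSpace.single k 1) := by
        simp only [hv, ← map_smul, ← map_sum, ← sum_smul_single]
      rw [← real_inner_self_eq_norm_sq]
      refine (congrArg (inner ℝ v) hva).trans ?_
      simp only [inner_sum, real_inner_smul_right]
    -- Ellipticity: dX maps v to `ι a`, so |a| ≤ `K` |v|. Cauchy-Schwarz applied to |v|² = ∑ aₖ⟨v,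
    -- eₖ⟩ then gives the lower bound.
    have h2 : ∑ k, a k ^ 2 ≤ K ^ 2 * ‖v‖ ^ 2 := by
      have e1 : ∑ k, a k ^ 2 = ‖a‖ ^ 2 := by
        rw [EuclideanSpace.norm_sq_eq]; simp
      rw [e1, ← ι.norm_map, ← hD1, ← mul_pow]
      refine pow_le_pow_left₀ (norm_nonneg _) ?_ 2
      exact (ContinuousLinearMap.le_opNorm _ _).trans
        (mul_le_mul_of_nonneg_right hDK (norm_nonneg _))
    have h3 : (‖v‖ ^ 2) ^ 2 ≤ (K ^ 2 * ‖v‖ ^ 2) * S := by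
      rw [h1]
      refine (Finset.sum_mul_sq_le_sq_mul_sq _ _ _).trans ?_
      rw [← h1]
      exact mul_le_mul_of_nonneg_right h2 (Finset.sum_nonneg fun _ _ => sq_nonneg _)
    have hS0 : 0 ≤ S := Finset.sum_nonneg fun _ _ => sq_nonneg _
    rw [one_div, inv_mul_le_iff₀ (by positivity)]
    rcases (sq_nonneg ‖v‖).eq_or_lt with h | h
    · rw [← h]; positivity
    · nlinarith
  · simp only [pd]
    rw [(hcomp f).fderiv_eq,
      fderiv_comp _ (by rw [hϕ0]; exact hfu.differentiableAt (by simp)) hdiff, hϕ0]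
    rfl
  · have hfP : ContDiffAt ℝ 2 (f ∘ P) 0 := by
      have h1 : ContDiffAt ℝ 2 ((f ∘ P₀) ∘ ϕ) 0 :=
        ContDiffAt.comp 0 (by rw [hϕ0]; exact hfu) hϕC
      exact h1.congr_of_eventuallyEq (hcomp f)
    rw [pd_pd_eq hfP, (hcomp f).fderiv.fderiv_eq,
      fderiv_fderiv_comp (by rw [hϕ0]; exact hfu) hϕC, hϕ0]

theorem eventually_norm_le_add_one {X W : Type*} [TopologicalSpace X] [SeminormedAddCommGroup W]
    {g : X → W} {a : X} (hg : ContinuousAt g a) : ∀ᶠ u in 𝓝 a, ‖g u‖ ≤ ‖g a‖ + 1 :=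
  hg.norm.eventually (ge_mem_nhds (lt_add_one _))

/-- The strong maximum principle at a local maximum, for the Laplacian with a bounded drift. -/
theorem eventually_eq_of_subsolution [IsManifold (𝓡 n) ∞ M] (hx : IsSmoothImmersion n x)
    {f : M → ℝ} (hf : ContMDiff (𝓡 n) 𝓘(ℝ, ℝ) ∞ f) {q₀ : M} {C : ℝ}
    (hsub : ∀ᶠ q in 𝓝 q₀, ∃ (ι : EuclideanSpace ℝ (Fin n) →ₗᵢ[ℝ] EuclideanSpace ℝ (Fin m))
      (P : EuclideanSpace ℝ (Fin n) → M) (c : Fin n → ℝ), IsGraphParam x q ι P ∧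
      (∀ k, |c k| ≤ C) ∧ 0 ≤ ∑ k, (pd k (pd k (f ∘ P)) 0 + c k * pd k (f ∘ P) 0))
    (hmax : ∀ᶠ q in 𝓝 q₀, f q ≤ f q₀) : ∀ᶠ q in 𝓝 q₀, f q = f q₀ := by
  obtain ⟨ι₀, P₀, hP₀⟩ := exists_isGraphParam hx q₀
  have hfC : ContDiffAt ℝ 2 (f ∘ P₀) 0 := (hP₀.contDiffAt_comp hf.contMDiffAt).of_le two_le_infty
  have hXC : ContDiffAt ℝ 2 (x ∘ P₀) 0 :=
    (hP₀.contDiffAt_comp hx.contMDiff.contMDiffAt).of_le two_le_infty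
  set K := ‖fderiv ℝ (x ∘ P₀) 0‖ + 1 with hK
  set L := ‖fderiv ℝ (fderiv ℝ (x ∘ P₀)) 0‖ + 1 with hL
  have hKpos : 0 < K := by positivity
  have hLpos : 0 < L := by positivity
  have hD1 : ContDiffAt ℝ 1 (fderiv ℝ (x ∘ P₀)) 0 := hXC.fderiv_right (by norm_num)
  have hD2 : ContDiffAt ℝ 0 (fderiv ℝ (fderiv ℝ (x ∘ P₀))) 0 := hD1.fderiv_right (by norm_num)
  have hDK : ∀ᶠ u in 𝓝 0, ‖fderiv ℝ (x ∘ P₀) u‖ ≤ K :=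
    eventually_norm_le_add_one hD1.continuousAt
  have hDL : ∀ᶠ u in 𝓝 0, ‖fderiv ℝ (fderiv ℝ (x ∘ P₀)) u‖ ≤ L :=
    eventually_norm_le_add_one hD2.continuousAt
  clear_value K L
  have hsum : ∀ a : Fin n → ℝ, (∀ k, a k ≤ 1 + L + |C|) → ∑ k, a k ≤ n * (1 + L + |C|) := by
    intro a ha
    have := Finset.sum_le_card_nsmul Finset.univ a _ fun k _ => ha k
    rwa [Finset.card_univ, Fintype.card_fin, nsmul_eq_mul] at this
  have hall : ∀ᶠ u in 𝓝 0, (ContDiffAt ℝ 2 (f ∘ P₀) u ∧ ∃ (e : Fin n → EuclideanSpace ℝ (Fin n))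
      (b : EuclideanSpace ℝ (Fin n)),
      (∀ v, 1 / K ^ 2 * ‖v‖ ^ 2 ≤ ∑ k, (inner ℝ v (e k)) ^ 2) ∧
      ∑ k, ‖e k‖ ^ 2 ≤ n * (1 + L + |C|) ∧ ‖b‖ ≤ n * (1 + L + |C|) ∧
      0 ≤ ∑ k, fderiv ℝ (fderiv ℝ (f ∘ P₀)) u (e k) (e k) + fderiv ℝ (f ∘ P₀) u b) ∧
      (f ∘ P₀) u ≤ (f ∘ P₀) 0 := by
    have hmax' : ∀ᶠ u in 𝓝 0, (f ∘ P₀) u ≤ (f ∘ P₀) 0 := by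
      have := hP₀.tendsto.eventually hmax
      simpa [hP₀.map_zero] using this
    filter_upwards [hfC.eventually (by simp), hXC.eventually (by simp), hDK, hDL,
      hP₀.eventually_adjoint_fderiv hx, hP₀.right_inv, hP₀.tendsto.eventually hsub,
      hP₀.tendsto.eventually (eventually_eventually_nhds.2 hP₀.left_inv), hmax']
      with u h1 h2 h3 h4 h5 h6 h7 h8 h9
    refine ⟨⟨h1, ?_⟩, h9⟩
    obtain ⟨ι, P, c, hP, hc, hge⟩ := h7
    obtain ⟨e, s, he, hs, hell, hp1, hp2⟩ :=
      exists_frame hx hKpos hLpos.le h1 h2 h5 h3 h4 h6 h8 hP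
    -- The drift in the fixed coordinates: second derivatives of the transition maps plus the
    -- transported drift.
    refine ⟨e, ∑ k, (s k + c k • e k), hell, ?_, ?_, ?_⟩
    · refine hsum _ fun k => ?_
      have := pow_le_one₀ (norm_nonneg (e k)) (he k) (n := 2)
      linarith [abs_nonneg C]
    · refine (norm_sum_le _ _).trans (hsum _ fun k => ?_)
      refine (norm_add_le _ _).trans ?_
      rw [norm_smul, Real.norm_eq_abs]
      have h10 : |c k| * ‖e k‖ ≤ |C| :=
        (mul_le_of_le_one_right (abs_nonneg _) (he k)).trans ((hc k).trans (le_abs_self C))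
      linarith [hs k]
    · refine hge.trans (le_of_eq ?_)
      rw [map_sum, ← Finset.sum_add_distrib]
      refine Finset.sum_congr rfl fun k _ => ?_
      rw [hp1, hp2, map_add, map_smul, smul_eq_mul]
      ring
  obtain ⟨R, hR, hball⟩ := Metric.eventually_nhds_iff_ball.1 hall
  have hconst := eqOn_of_subsolution hR (lam := 1 / K ^ 2) (by positivity)
    (fun u hu => (hball u hu).1.1) (fun u hu => (hball u hu).1.2) (fun u hu => (hball u hu).2)
  have hcoord : Tendsto (graphCoord x ι₀ q₀) (𝓝 q₀) (𝓝 0) := by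
    have := (IsGraphParam.contMDiffAt_graphCoord (ι := ι₀) (q := q₀) hx q₀).continuousAt.tendsto
    rwa [IsGraphParam.graphCoord_self] at this
  filter_upwards [hP₀.left_inv,
    hcoord.eventually (Metric.ball_mem_nhds 0 (by positivity : 0 < R / 3))]
    with q h1 h2
  have := hconst _ h2
  simpa [h1, hP₀.map_zero] using this

end StrongMaximum

/-! ### Connected components: open and compact, since M is locally connected and compact. -/

section ConnectedComponent

variable (n : ℕ) {M : Type*} [TopologicalSpace M] [ChartedSpace (EuclideanSpace ℝ (Fin n)) M]
include n

theorem connectedComponent_mem_nhds (p : M) {q : M} (hq : q ∈ connectedComponent p) :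
    connectedComponent p ∈ 𝓝 q := by
  have : LocallyConnectedSpace M :=
    ChartedSpace.locallyConnectedSpace (EuclideanSpace ℝ (Fin n)) M
  exact isOpen_connectedComponent.mem_nhds hq

theorem exists_isLocalMax_connectedComponent [CompactSpace M] {f : M → ℝ} (hf : Continuous f)
    (p : M) : ∃ q ∈ connectedComponent p, (∀ y ∈ connectedComponent p, f y ≤ f q) ∧
      IsLocalMax f q := by
  obtain ⟨q, hq, hmax⟩ := (isClosed_connectedComponent (x := p)).isCompact.exists_isMaxOn
    ⟨p, mem_connectedComponent⟩ hf.continuousOn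
  refine ⟨q, hq, fun y hy => hmax hy, ?_⟩
  filter_upwards [connectedComponent_mem_nhds n p hq] with y hy using hmax hy

end ConnectedComponent

section Components

variable {n m : ℕ} {M : Type*} [TopologicalSpace M] [ChartedSpace (EuclideanSpace ℝ (Fin n)) M]
  {x : M → EuclideanSpace ℝ (Fin m)}

/-- Compactness provides a maximum on the component, and by the strong maximum principle the set
where it is attained is open as well as closed. -/
theorem eq_on_connectedComponent [CompactSpace M] [IsManifold (𝓡 n) ∞ M]
    (hx : IsSmoothImmersion n x) {f : M → ℝ} (hf : ContMDiff (𝓡 n) 𝓘(ℝ, ℝ) ∞ f) (p : M) (C : ℝ)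
    (hsub : ∀ q ∈ connectedComponent p,
      ∃ (ι : EuclideanSpace ℝ (Fin n) →ₗᵢ[ℝ] EuclideanSpace ℝ (Fin m))
      (P : EuclideanSpace ℝ (Fin n) → M) (c : Fin n → ℝ), IsGraphParam x q ι P ∧
      (∀ k, |c k| ≤ C) ∧ 0 ≤ ∑ k, (pd k (pd k (f ∘ P)) 0 + c k * pd k (f ∘ P) 0)) :
    ∀ q ∈ connectedComponent p, f q = f p := by
  obtain ⟨q₁, hq₁, hmax, -⟩ := exists_isLocalMax_connectedComponent n hf.continuous p
  have hclopen : IsClopen (connectedComponent p ∩ f ⁻¹' {f q₁}) := by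
    refine ⟨isClosed_connectedComponent.inter (isClosed_singleton.preimage hf.continuous), ?_⟩
    rw [isOpen_iff_mem_nhds]
    rintro q ⟨hq, hfq⟩
    have hfq' : f q = f q₁ := hfq
    have hK := connectedComponent_mem_nhds n p hq
    have h1 := eventually_eq_of_subsolution hx hf (q₀ := q) (C := C)
      (by filter_upwards [hK] with y hy using hsub y hy)
      (by filter_upwards [hK] with y hy; rw [hfq']; exact hmax y hy)
    filter_upwards [hK, h1] with y hy hfy
    exact ⟨hy, hfy.trans hfq'⟩
  have hsubset := isPreconnected_connectedComponent.subset_isClopen hclopen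
    ⟨q₁, hq₁, hq₁, rfl⟩
  intro q hq
  exact (hsubset hq).2.trans (hsubset mem_connectedComponent).2.symm

end Components

/-! ### The function |x|² on a self-shrinker. -/

section Position

variable {n m : ℕ} {M : Type*} [TopologicalSpace M] [ChartedSpace (EuclideanSpace ℝ (Fin n)) M]
  {x : M → EuclideanSpace ℝ (Fin m)} {q : M}
  {ι : EuclideanSpace ℝ (Fin n) →ₗᵢ[ℝ] EuclideanSpace ℝ (Fin m)}
  {P : EuclideanSpace ℝ (Fin n) → M}

theorem contMDiff_normSq (hx : IsSmoothImmersion n x) :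
    ContMDiff (𝓡 n) 𝓘(ℝ, ℝ) ∞ fun q => inner ℝ (x q) (x q) := by
  intro q
  have h1 : ContDiffAt ℝ ∞ (fun y : EuclideanSpace ℝ (Fin m) => inner ℝ y y) (x q) :=
    contDiffAt_id.inner ℝ contDiffAt_id
  exact (contMDiffAt_iff_contDiffAt.2 h1).comp q hx.contMDiff.contMDiffAt

theorem contMDiff_neg {f : M → ℝ} (hf : ContMDiff (𝓡 n) 𝓘(ℝ, ℝ) ∞ f) :
    ContMDiff (𝓡 n) 𝓘(ℝ, ℝ) ∞ fun q => -f q := by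
  intro q
  have h1 : ContDiffAt ℝ ∞ (fun y : ℝ => -y) (f q) := contDiffAt_id.neg
  exact (contMDiffAt_iff_contDiffAt.2 h1).comp q hf.contMDiffAt

theorem pd_pd_nonpos_of_isLocalMax {f : M → ℝ} (hP : IsGraphParam x q ι P)
    (hf : ContMDiffAt (𝓡 n) 𝓘(ℝ, ℝ) ∞ f q) (hmax : IsLocalMax f q) (k : Fin n) :
    pd k (pd k (f ∘ P)) 0 ≤ 0 := by
  have hC : ContDiffAt ℝ 2 (f ∘ P) 0 := (hP.contDiffAt_comp hf).of_le two_le_infty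
  rw [pd_pd_eq hC]
  refine fderiv_fderiv_nonpos_of_isLocalMax hC ?_ _
  have := hP.tendsto.eventually hmax
  simpa [IsLocalMax, IsMaxFilter, hP.map_zero] using this

theorem pd_normSq (hP : IsGraphParam x q ι P) [IsManifold (𝓡 n) ∞ M] (hx : IsSmoothImmersion n x)
    (k : Fin n) : pd k ((fun q => inner ℝ (x q) (x q)) ∘ P) 0 =
      2 * inner ℝ (x q) (ι (EuclideanSpace.single k 1)) := by
  have hY := hP.contDiffAt_comp hx.contMDiff.contMDiffAt
  have h1 : pd k (x ∘ P) 0 = ι (EuclideanSpace.single k 1) := hP.fderiv_zero hx _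
  have h2 : pd k (fun w => inner ℝ ((x ∘ P) w) ((x ∘ P) w)) 0 = _ :=
    (pd_inner k hY hY).self_of_nhds
  refine h2.trans ?_
  beta_reduce
  rw [h1, real_inner_comm, Function.comp_apply, hP.map_zero]
  ring

theorem laplacian_normSq_eq (hP : IsGraphParam x q ι P) [IsManifold (𝓡 n) ∞ M]
    (hx : IsSmoothImmersion n x) :
    ∑ k, pd k (pd k ((fun q => inner ℝ (x q) (x q)) ∘ P)) 0 =
      2 * (n + inner ℝ (x q) (meanCurvature n x q)) := by
  have hY := hP.contDiffAt_comp hx.contMDiff.contMDiffAt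
  have h1 : ∀ k, pd k (x ∘ P) 0 = ι (EuclideanSpace.single k 1) := fun k => hP.fderiv_zero hx _
  have h2 : ∀ k, pd k (pd k ((fun q => inner ℝ (x q) (x q)) ∘ P)) 0 =
      2 * (1 + inner ℝ (x q) (pd k (pd k (x ∘ P)) 0)) := by
    intro k
    have h3 : pd k (pd k (fun w => inner ℝ ((x ∘ P) w) ((x ∘ P) w))) 0 = _ :=
      (pd_pd_inner k k hY hY).self_of_nhds
    refine h3.trans ?_
    beta_reduce
    rw [h1, IsShrinkerGerm.inner_map_single, if_pos rfl, real_inner_comm ((x ∘ P) 0),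
      Function.comp_apply, hP.map_zero]
    ring
  simp only [h2, ← Finset.mul_sum, Finset.sum_add_distrib, ← inner_sum, hP.meanCurvature_eq hx]
  simp

theorem normalPart_eq_sub (hP : IsGraphParam x q ι P) [IsManifold (𝓡 n) ∞ M]
    (hx : IsSmoothImmersion n x) (v : EuclideanSpace ℝ (Fin m)) :
    normalPart n x q v = v - ∑ k, inner ℝ v (ι (EuclideanSpace.single k 1)) •
      ι (EuclideanSpace.single k 1) := by
  have h1 := ((hP.eventually_isParamAt hx).self_of_nhds).normalPart_eq hx v
  rw [hP.map_zero, hP.gram_zero hx, inv_one] at h1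
  simpa [Matrix.one_apply, hP.fderiv_zero hx] using h1

variable [IsManifold (𝓡 n) ∞ M] (hx : IsSelfShrinker n x)
include hx

omit [IsManifold (𝓡 n) ∞ M] in
theorem IsSelfShrinker.inner_meanCurvature (q : M) :
    inner ℝ (x q) (meanCurvature n x q) = -‖meanCurvature n x q‖ ^ 2 := by
  rw [hx.meanCurvature_eq, norm_neg, inner_neg_right, neg_inj, normalPart,
    ← real_inner_self_eq_norm_sq]
  have h := Submodule.starProjection_inner_eq_zero (K := normalPlane n x q) (x q) _
    (Submodule.starProjection_apply_mem (normalPlane n x q) (x q))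
  rwa [inner_sub_left, sub_eq_zero] at h

theorem IsSelfShrinker.laplacian_normSq (hP : IsGraphParam x q ι P) :
    ∑ k, pd k (pd k ((fun q => inner ℝ (x q) (x q)) ∘ P)) 0 =
      2 * (n - ‖meanCurvature n x q‖ ^ 2) := by
  rw [laplacian_normSq_eq hP hx.toIsSmoothImmersion, hx.inner_meanCurvature]
  ring

/-- The Laplacian contributes 2(n - |x^⊥|²) and the drift contributes -2|x^T|². -/
theorem IsSelfShrinker.drift_laplacian_normSq (hP : IsGraphParam x q ι P) :
    ∑ k, (pd k (pd k ((fun q => inner ℝ (x q) (x q)) ∘ P)) 0 +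
      -inner ℝ (x q) (ι (EuclideanSpace.single k 1)) *
        pd k ((fun q => inner ℝ (x q) (x q)) ∘ P) 0) = 2 * (n - ‖x q‖ ^ 2) := by
  have h1 : inner ℝ (x q) (meanCurvature n x q) =
      -‖x q‖ ^ 2 + ∑ k, inner ℝ (x q) (ι (EuclideanSpace.single k 1)) ^ 2 := by
    rw [hx.meanCurvature_eq, normalPart_eq_sub hP hx.toIsSmoothImmersion]
    simp only [inner_neg_right, inner_sub_right, inner_sum, real_inner_smul_right,
      real_inner_self_eq_norm_sq, pow_two]
    ring
  rw [Finset.sum_add_distrib, laplacian_normSq_eq hP hx.toIsSmoothImmersion, h1]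
  simp only [pd_normSq hP hx.toIsSmoothImmersion, mul_add, Finset.mul_sum]
  rw [add_assoc, add_assoc, ← Finset.sum_add_distrib, Finset.sum_eq_zero fun k _ => by ring]
  ring

/-- The drift Laplacian of a constant is zero, while for |x|² it equals 2(n - |x|²). -/
theorem IsSelfShrinker.norm_sq_eq_of_eventually_const {c : ℝ}
    (hc : ∀ᶠ y in 𝓝 q, inner ℝ (x y) (x y) = c) : ‖x q‖ ^ 2 = n := by
  obtain ⟨ι, P, hP⟩ := exists_isGraphParam hx.toIsSmoothImmersion q
  have h1 : ((fun q => inner ℝ (x q) (x q)) ∘ P) =ᶠ[𝓝 0] fun _ => c := hP.tendsto.eventually hc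
  have h2 : ∀ k, pd k ((fun q => inner ℝ (x q) (x q)) ∘ P) =ᶠ[𝓝 0] fun _ => 0 := fun k =>
    (pd_congr k h1).trans (by rw [pd_const])
  have h3 := hx.drift_laplacian_normSq hP
  have h4 : ∀ k, pd k (pd k ((fun q => inner ℝ (x q) (x q)) ∘ P)) 0 = 0 := fun k => by
    rw [(pd_congr k (h2 k)).self_of_nhds, pd_const]
  have h5 : ∀ k, pd k ((fun q => inner ℝ (x q) (x q)) ∘ P) 0 = 0 := fun k => (h2 k).self_of_nhds
  simp only [h4, h5, mul_zero, add_zero, Finset.sum_const_zero] at h3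
  linarith

theorem IsSelfShrinker.le_norm_sq_meanCurvature_of_isLocalMax
    (hmax : IsLocalMax (fun q => inner ℝ (x q) (x q)) q) : (n : ℝ) ≤ ‖meanCurvature n x q‖ ^ 2 := by
  obtain ⟨ι, P, hP⟩ := exists_isGraphParam hx.toIsSmoothImmersion q
  have h1 := hx.laplacian_normSq hP
  have h2 := Finset.sum_nonpos fun k (_ : k ∈ Finset.univ) => pd_pd_nonpos_of_isLocalMax hP
    (contMDiff_normSq hx.toIsSmoothImmersion).contMDiffAt hmax k
  linarith

theorem IsSelfShrinker.norm_sq_meanCurvature_le_of_isLocalMin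
    (hmin : IsLocalMax (fun q => -inner ℝ (x q) (x q)) q) : ‖meanCurvature n x q‖ ^ 2 ≤ n := by
  obtain ⟨ι, P, hP⟩ := exists_isGraphParam hx.toIsSmoothImmersion q
  have h1 := hx.laplacian_normSq hP
  have h2 := Finset.sum_nonpos fun k (_ : k ∈ Finset.univ) => pd_pd_nonpos_of_isLocalMax hP
    (contMDiff_neg (contMDiff_normSq hx.toIsSmoothImmersion)).contMDiffAt hmin k
  have h3 : ∀ k, pd k (pd k ((fun q => -inner ℝ (x q) (x q)) ∘ P)) 0 =
      -pd k (pd k ((fun q => inner ℝ (x q) (x q)) ∘ P)) 0 := fun k => by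
    have e : ((fun q => -inner ℝ (x q) (x q)) ∘ P) =
      fun w => -((fun q => inner ℝ (x q) (x q)) ∘ P) w := rfl
    rw [e, pd_neg, pd_neg]
  simp only [h3, Finset.sum_neg_distrib] at h2
  linarith

variable [CompactSpace M] (p : M)

theorem IsSelfShrinker.norm_sq_eq_of_meanCurvature_le
    (h : ∀ q ∈ connectedComponent p, ‖meanCurvature n x q‖ ^ 2 ≤ n) : ‖x p‖ ^ 2 = n := by
  have hconst := eq_on_connectedComponent hx.toIsSmoothImmersion
    (contMDiff_normSq hx.toIsSmoothImmersion) p 0 fun q hq => by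
      obtain ⟨ι, P, hP⟩ := exists_isGraphParam hx.toIsSmoothImmersion q
      refine ⟨ι, P, fun _ => 0, hP, fun k => by simp, ?_⟩
      simp only [zero_mul, add_zero, hx.laplacian_normSq hP]
      linarith [h q hq]
  apply hx.norm_sq_eq_of_eventually_const
  filter_upwards [connectedComponent_mem_nhds n p mem_connectedComponent] with y hy
    using hconst y hy

theorem IsSelfShrinker.norm_sq_eq_of_neg_subsolution (C : ℝ)
    (h : ∀ q ∈ connectedComponent p,
      ∃ (ι : EuclideanSpace ℝ (Fin n) →ₗᵢ[ℝ] EuclideanSpace ℝ (Fin m))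
      (P : EuclideanSpace ℝ (Fin n) → M) (c : Fin n → ℝ), IsGraphParam x q ι P ∧
      (∀ k, |c k| ≤ C) ∧ ∑ k, (pd k (pd k ((fun q => inner ℝ (x q) (x q)) ∘ P)) 0 +
        c k * pd k ((fun q => inner ℝ (x q) (x q)) ∘ P) 0) ≤ 0) : ‖x p‖ ^ 2 = n := by
  have hconst := eq_on_connectedComponent hx.toIsSmoothImmersion
    (contMDiff_neg (contMDiff_normSq hx.toIsSmoothImmersion)) p C fun q hq => by
      obtain ⟨ι, P, c, hP, hc, hle⟩ := h q hq
      refine ⟨ι, P, c, hP, hc, ?_⟩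
      have e : ((fun q => -inner ℝ (x q) (x q)) ∘ P) =
        fun w => -((fun q => inner ℝ (x q) (x q)) ∘ P) w := rfl
      rw [← neg_nonneg, ← Finset.sum_neg_distrib] at hle
      refine hle.trans (le_of_eq (Finset.sum_congr rfl fun k _ => ?_))
      simp only [e, pd_neg]
      ring
  apply hx.norm_sq_eq_of_eventually_const
  filter_upwards [connectedComponent_mem_nhds n p mem_connectedComponent] with y hy
    using neg_inj.1 (hconst y hy)

theorem IsSelfShrinker.norm_sq_eq_of_le_meanCurvature
    (h : ∀ q ∈ connectedComponent p, (n : ℝ) ≤ ‖meanCurvature n x q‖ ^ 2) : ‖x p‖ ^ 2 = n := by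
  refine hx.norm_sq_eq_of_neg_subsolution p 0 fun q hq => ?_
  obtain ⟨ι, P, hP⟩ := exists_isGraphParam hx.toIsSmoothImmersion q
  refine ⟨ι, P, fun _ => 0, hP, fun k => by simp, ?_⟩
  simp only [zero_mul, add_zero, hx.laplacian_normSq hP]
  linarith [h q hq]

theorem IsSelfShrinker.norm_sq_eq_of_le (h : ∀ q, (n : ℝ) ≤ ‖x q‖ ^ 2) : ‖x p‖ ^ 2 = n := by
  obtain ⟨C, hC⟩ := isCompact_univ.exists_bound_of_continuousOn
    (hx.contMDiff.continuous.continuousOn (s := Set.univ))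
  refine hx.norm_sq_eq_of_neg_subsolution p C fun q hq => ?_
  obtain ⟨ι, P, hP⟩ := exists_isGraphParam hx.toIsSmoothImmersion q
  refine ⟨ι, P, fun k => -inner ℝ (x q) (ι (EuclideanSpace.single k 1)), hP, fun k => ?_, ?_⟩
  · rw [abs_neg]
    refine (abs_real_inner_le_norm _ _).trans ?_
    simpa using hC q (Set.mem_univ q)
  · rw [hx.drift_laplacian_normSq hP]
    linarith [h q]

omit [IsManifold (𝓡 n) ∞ M] [CompactSpace M] in
theorem IsSelfShrinker.norm_meanCurvature_le : ‖meanCurvature n x p‖ ≤ ‖x p‖ := by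
  rw [hx.meanCurvature_eq, norm_neg, normalPart]
  exact Submodule.norm_starProjection_apply_le _ _

omit [CompactSpace M] in
-- The gradient of |x|² vanishes, so x is normal and H = -x. The normal space in the sphere is
-- orthogonal to x, so the projection of H to it is zero.
theorem IsSelfShrinker.isMinimalInSphere (h : ∀ q, ‖x q‖ ^ 2 = n) :
    IsMinimalInSphere n x (√n) := by
  refine ⟨hx.toIsSmoothImmersion, fun q => ?_, fun q => ?_⟩
  · rw [mem_sphere_zero_iff_norm, ← h q, Real.sqrt_sq (norm_nonneg _)]
  · obtain ⟨ι, P, hP⟩ := exists_isGraphParam hx.toIsSmoothImmersion q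
    have hnormal : normalPart n x q (x q) = x q := by
      have h0 : (fun q => inner ℝ (x q) (x q)) ∘ P = fun _ => (n : ℝ) := by
        ext w
        simp [h]
      have h1 : ∀ k, inner ℝ (x q) (ι (EuclideanSpace.single k 1)) = (0 : ℝ) := fun k => by
        have h2 := pd_normSq hP hx.toIsSmoothImmersion k
        rw [h0, pd_const] at h2
        linarith
      rw [normalPart_eq_sub hP hx.toIsSmoothImmersion]
      simp [h1]
    have h3 : (sphereSecondFundamentalForm n x q) = fun u v =>
        (sphereNormalPlane n x q).starProjection (secondFundamentalForm n x q u v) := by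
      ext1 u
      ext1 v
      exact (congrArg (fun L => L (secondDerivative n x q u v))
        (Submodule.starProjection_comp_starProjection_of_le
          (inf_le_right : sphereNormalPlane n x q ≤ normalPlane n x q))).symm
    rw [h3, IsParamAt.metricTrace_map]
    change (sphereNormalPlane n x q).starProjection (meanCurvature n x q) = 0
    rw [hx.meanCurvature_eq, hnormal, map_neg, neg_eq_zero,
      Submodule.starProjection_apply_eq_zero_iff, Submodule.mem_orthogonal']
    intro y hy
    exact Submodule.mem_orthogonal_singleton_iff_inner_right.1 hy.1

end Position

/-! ### From a self-shrinker with parallel principal normal to its germ in graph coordinates. -/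

section NormalBundle

variable {n m : ℕ} {M : Type*} [TopologicalSpace M] [ChartedSpace (EuclideanSpace ℝ (Fin n)) M]
  {x : M → EuclideanSpace ℝ (Fin m)} {q : M}

theorem mem_tangentPlane_of_normalPart_eq_zero {v : EuclideanSpace ℝ (Fin m)}
    (hv : normalPart n x q v = 0) : v ∈ tangentPlane n x q := by
  have := (Submodule.starProjection_apply_eq_zero_iff _).1 hv
  rwa [normalPlane, Submodule.orthogonal_orthogonal] at this

theorem sub_normalPart_mem (v : EuclideanSpace ℝ (Fin m)) :
    v - normalPart n x q v ∈ tangentPlane n x q := by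
  have := Submodule.sub_starProjection_mem_orthogonal (K := normalPlane n x q) v
  rwa [normalPlane, Submodule.orthogonal_orthogonal] at this

theorem norm_smul_principalNormal (hH : meanCurvature n x q ≠ 0) :
    ‖meanCurvature n x q‖ • principalNormal n x q = meanCurvature n x q := by
  rw [principalNormal, smul_smul, mul_inv_cancel₀ (norm_ne_zero_iff.2 hH), one_smul]

theorem inner_principalNormal_self (hH : meanCurvature n x q ≠ 0) :
    inner ℝ (principalNormal n x q) (principalNormal n x q) = (1 : ℝ) := by
  rw [real_inner_self_eq_norm_sq, principalNormal, norm_smul, norm_inv, norm_norm,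
    inv_mul_cancel₀ (norm_ne_zero_iff.2 hH), one_pow]

/-- Tangential coefficients are read off by pairing with the fixed vectors `ι (EuclideanSpace.single
k 1)`, because the adjoint of `ι` inverts the differential. This yields smooth formulas for the
shape operator and for x^T without the inverse metric. -/
theorem IsGraphParam.eventually_eq_sum
    {ι : EuclideanSpace ℝ (Fin n) →ₗᵢ[ℝ] EuclideanSpace ℝ (Fin m)}
    {P : EuclideanSpace ℝ (Fin n) → M} [IsManifold (𝓡 n) ∞ M] (hP : IsGraphParam x q ι P)
    (hx : IsSmoothImmersion n x) : ∀ᶠ w in 𝓝 0, ∀ v ∈ tangentPlane n x (P w),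
      v = ∑ k, inner ℝ v (ι (EuclideanSpace.single k 1)) • pd k (x ∘ P) w := by
  filter_upwards [hP.eventually_isParamAt hx, hP.eventually_adjoint_fderiv hx] with w h1 h2 v hv
  rw [h1.tangentPlane_eq hx] at hv
  obtain ⟨a, rfl⟩ := hv
  change fderiv ℝ (x ∘ P) w a = _
  have h3 : ∀ k, inner ℝ (fderiv ℝ (x ∘ P) w a) (ι (EuclideanSpace.single k 1)) = a k := fun k => by
    rw [← adjoint_apply_coord, h2]
  change fderiv ℝ (x ∘ P) w a =
    ∑ k, (inner ℝ (fderiv ℝ (x ∘ P) w a) (ι (EuclideanSpace.single k 1)) : ℝ) • pd k (x ∘ P) w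
  simp only [h3, pd, ← map_smul, ← map_sum, ← sum_smul_single]

variable [IsManifold (𝓡 n) ∞ M] (hx : IsSelfShrinker n x)
include hx

/-- Through H = -x^⊥ the mean curvature is expressed by first derivatives and the inverse Gram
matrix in a single parametrization. -/
theorem IsSelfShrinker.contMDiff_meanCurvature :
    ContMDiff (𝓡 n) (𝓡 m) ∞ (meanCurvature n x) := by
  intro q
  obtain ⟨ι, P, hP⟩ := exists_isGraphParam hx.toIsSmoothImmersion q
  refine hP.contMDiffAt_of_comp hx.toIsSmoothImmersion ?_
  have hY := hP.contDiffAt_comp hx.contMDiff.contMDiffAt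
  have hD : ContDiffAt ℝ ∞ (fderiv ℝ (x ∘ P)) 0 := hY.fderiv_right (m := ∞) (by simp)
  have hinj := ((hP.eventually_isParamAt hx.toIsSmoothImmersion).self_of_nhds).injective
  have h1 : meanCurvature n x ∘ P =ᶠ[𝓝 0] fun w => -((x ∘ P) w -
      ∑ i, ∑ j, ((gram (fderiv ℝ (x ∘ P) w))⁻¹ i j * inner ℝ ((x ∘ P) w) (pd i (x ∘ P) w)) •
        pd j (x ∘ P) w) := by
    filter_upwards [hP.eventually_isParamAt hx.toIsSmoothImmersion] with w hw
    rw [Function.comp_apply, hx.meanCurvature_eq, hw.normalPart_eq hx.toIsSmoothImmersion]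
    rfl
  refine ContDiffAt.congr_of_eventuallyEq ?_ h1
  exact (hY.sub (ContDiffAt.sum fun i _ => ContDiffAt.sum fun j _ =>
    ((contDiffAt_gram_inv hD hinj i j).mul (hY.inner ℝ (contDiffAt_pd i hY))).smul
      (contDiffAt_pd j hY))).neg

theorem IsSelfShrinker.contMDiffAt_norm_meanCurvature (hH : meanCurvature n x q ≠ 0) :
    ContMDiffAt (𝓡 n) 𝓘(ℝ, ℝ) ∞ (fun q => ‖meanCurvature n x q‖) q :=
  (contMDiffAt_iff_contDiffAt.2 (contDiffAt_norm ℝ hH)).comp q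
    hx.contMDiff_meanCurvature.contMDiffAt

theorem IsSelfShrinker.contMDiffAt_principalNormal (hH : meanCurvature n x q ≠ 0) :
    ContMDiffAt (𝓡 n) (𝓡 m) ∞ (principalNormal n x) q := by
  have h1 : ContDiffAt ℝ ∞ (fun v : EuclideanSpace ℝ (Fin m) => ‖v‖⁻¹ • v) (meanCurvature n x q) :=
    ((contDiffAt_norm ℝ hH).inv (norm_ne_zero_iff.2 hH)).smul contDiffAt_id
  exact (contMDiffAt_iff_contDiffAt.2 h1).comp q hx.contMDiff_meanCurvature.contMDiffAt

omit [IsManifold (𝓡 n) ∞ M] in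
theorem IsSelfShrinker.principalNormal_mem : principalNormal n x q ∈ normalPlane n x q := by
  refine Submodule.smul_mem _ _ ?_
  rw [hx.meanCurvature_eq]
  exact Submodule.neg_mem _ (Submodule.starProjection_apply_mem _ _)

/-- A self-shrinker with parallel principal normal, read in graph coordinates. -/
theorem IsGraphParam.isShrinkerGerm
    {ι : EuclideanSpace ℝ (Fin n) →ₗᵢ[ℝ] EuclideanSpace ℝ (Fin m)}
    {P : EuclideanSpace ℝ (Fin n) → M} (hP : IsGraphParam x q ι P)
    (hpar : HasParallelPrincipalNormal n x) :
    IsShrinkerGerm (x ∘ P) (principalNormal n x ∘ P) ((fun q => ‖meanCurvature n x q‖) ∘ P)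
      (fun k i w => -inner ℝ (pd i (principalNormal n x ∘ P) w) (ι (EuclideanSpace.single k 1)))
      (fun k w => inner ℝ ((x ∘ P) w + ‖meanCurvature n x (P w)‖ • (principalNormal n x ∘ P) w)
        (ι (EuclideanSpace.single k 1)))
      (fun i j w => (gram (fderiv ℝ (x ∘ P) w))⁻¹ i j) ι := by
  have hI := hx.toIsSmoothImmersion
  have hY := hP.contDiffAt_comp hx.contMDiff.contMDiffAt
  have hD : ContDiffAt ℝ ∞ (fderiv ℝ (x ∘ P)) 0 := hY.fderiv_right (m := ∞) (by simp)
  have hinj := ((hP.eventually_isParamAt hI).self_of_nhds).injective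
  have hν := hP.contDiffAt_comp (hx.contMDiffAt_principalNormal (hpar.1 q))
  have hH := hP.contDiffAt_comp (hx.contMDiffAt_norm_meanCurvature (hpar.1 q))
  have hperp : ∀ᶠ w in 𝓝 0, ∀ k, inner ℝ (pd k (x ∘ P) w) ((principalNormal n x ∘ P) w) =
      (0 : ℝ) := by
    filter_upwards [hP.eventually_isParamAt hI] with w hw k
    refine (Submodule.mem_orthogonal _ _).1 (hx.principalNormal_mem (q := P w)) _ ?_
    rw [hw.tangentPlane_eq hI]
    exact ⟨_, rfl⟩
  have hwein : ∀ᶠ w in 𝓝 0, ∀ i, pd i (principalNormal n x ∘ P) w =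
      ∑ k, inner ℝ (pd i (principalNormal n x ∘ P) w) (ι (EuclideanSpace.single k 1)) •
        pd k (x ∘ P) w := by
    filter_upwards [hP.eventually_isParamAt hI, hP.eventually_eq_sum hI] with w hw hsum i
    apply hsum
    rw [pd, hw.fderiv_comp ((hx.contMDiffAt_principalNormal (hpar.1 _)).of_le (by simp))]
    exact mem_tangentPlane_of_normalPart_eq_zero (hpar.2 _ _)
  have hsecond : ∀ i j l, (fun w => inner ℝ (pd i (pd j (x ∘ P)) w)
      (ι (EuclideanSpace.single l 1))) =ᶠ[𝓝 0] fun _ => (0 : ℝ) := by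
    intro i j l
    have h1 : (fun w => inner ℝ ((x ∘ P) w) (ι (EuclideanSpace.single l 1))) =ᶠ[𝓝 0]
        fun w => w l + inner ℝ (x q) (ι (EuclideanSpace.single l 1)) :=
      hP.inner_eq.mono fun w hw => hw l
    have h3 : ContDiffAt ℝ ∞ (fun w : EuclideanSpace ℝ (Fin n) => w l) 0 := by fun_prop
    refine (pd_pd_inner_const j i hY _).symm.trans ((pd_congr i (pd_congr j h1)).trans
      ((pd_pd_add j i h3 contDiffAt_const).trans ?_))
    simp [pd_coord, pd_const]
  have hinv : ∀ᶠ w in 𝓝 0, ∀ i k, ∑ j, (gram (fderiv ℝ (x ∘ P) w))⁻¹ i j *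
      inner ℝ (pd j (x ∘ P) w) (pd k (x ∘ P) w) = if i = k then (1 : ℝ) else 0 := by
    filter_upwards [hP.eventually_isParamAt hI] with w hw i k
    exact sum_gram_inv_mul hw.injective i k
  have hmean : ∀ᶠ w in 𝓝 0, ∑ i, ∑ j, (gram (fderiv ℝ (x ∘ P) w))⁻¹ i j •
      pd i (pd j (x ∘ P)) w = ‖meanCurvature n x (P w)‖ • (principalNormal n x ∘ P) w +
        ∑ k, (‖meanCurvature n x (P w)‖ * -inner ℝ ((principalNormal n x ∘ P) w)
          (ι (EuclideanSpace.single k 1))) • pd k (x ∘ P) w := by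
    filter_upwards [hP.eventually_isParamAt hI, hP.eventually_eq_sum hI,
      eventually_all.2 fun i => eventually_all.2 fun j => eventually_all.2 (hsecond i j)]
      with w hw hsum h2
    have h3 := hsum _ (sub_normalPart_mem (∑ i, ∑ j, (gram (fderiv ℝ (x ∘ P) w))⁻¹ i j •
      pd i (pd j (x ∘ P)) w))
    rw [← hw.meanCurvature_eq hI, sub_eq_iff_eq_add'] at h3
    rw [Function.comp_apply, norm_smul_principalNormal (hpar.1 _)]
    -- The second derivatives are orthogonal to the fixed tangent plane, so the tangential
    -- coefficients of their trace come only from subtracting H.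
    refine h3.trans (congrArg _ (Finset.sum_congr rfl fun k _ => ?_))
    congr 1
    rw [← norm_smul_principalNormal (hpar.1 (P w)), inner_sub_left, real_inner_smul_left,
      norm_smul_principalNormal (hpar.1 (P w))]
    simp [sum_inner, real_inner_smul_left, h2]
  have hnormal : ∀ᶠ w in 𝓝 0, ∀ i j, inner ℝ (pd i (pd j (x ∘ P)) w)
      ((principalNormal n x ∘ P) w) = -∑ k, inner ℝ (pd i (principalNormal n x ∘ P) w)
        (ι (EuclideanSpace.single k 1)) * inner ℝ (pd j (x ∘ P) w) (pd k (x ∘ P) w) := by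
    have h1 : ∀ i j, ∀ᶠ w in 𝓝 0, inner ℝ (pd i (pd j (x ∘ P)) w)
        ((principalNormal n x ∘ P) w) + inner ℝ (pd j (x ∘ P) w)
          (pd i (principalNormal n x ∘ P) w) = (0 : ℝ) := fun i j => by
      have h2 : (fun w => inner ℝ (pd j (x ∘ P) w) ((principalNormal n x ∘ P) w)) =ᶠ[𝓝 0]
          fun _ => (0 : ℝ) := hperp.mono fun w hw => hw j
      refine (pd_inner i (contDiffAt_pd j hY) hν).symm.trans ((pd_congr i h2).trans ?_)
      rw [pd_const]
    filter_upwards [eventually_all.2 fun i => eventually_all.2 (h1 i), hwein] with w h2 h3 i j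
    rw [eq_neg_of_add_eq_zero_left (h2 i j)]
    congr 1
    refine (congrArg (inner ℝ (pd j (x ∘ P) w)) (h3 i)).trans ?_
    simp only [inner_sum, real_inner_smul_right]
  refine ⟨hY, hν, hH, fun k i => ((contDiffAt_pd i hν).inner ℝ contDiffAt_const).neg,
    fun k => (hY.add (hH.smul hν)).inner ℝ contDiffAt_const,
    fun i j => contDiffAt_gram_inv hD hinj i j, ⟨_, hP.inner_eq⟩, fun k => hP.fderiv_zero hI _,
    Eventually.of_forall fun w => inner_principalNormal_self (hpar.1 (P w)), hperp, ?_, ?_, hinv,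
    hmean, ?_, norm_pos_iff.2 (hpar.1 _)⟩
  · filter_upwards [hwein] with w hw i
    simp only [neg_smul, Finset.sum_neg_distrib, neg_neg]
    exact hw i
  · filter_upwards [hP.eventually_eq_sum hI] with w hsum
    refine hsum _ ?_
    have h1 : (‖meanCurvature n x (P w)‖ • (principalNormal n x ∘ P) w) =
      -normalPart n x (P w) (x (P w)) := by
      rw [Function.comp_apply, norm_smul_principalNormal (hpar.1 _), hx.meanCurvature_eq]
    change (x ∘ P) w + ‖meanCurvature n x (P w)‖ • (principalNormal n x ∘ P) w ∈ _
    rw [h1, ← sub_eq_add_neg]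
    exact sub_normalPart_mem _
  -- The trace of the shape operator: pair the mean curvature equation with ν, then contract the
  -- inverse metric with the metric.
  · filter_upwards [hmean, hperp, hnormal, hinv] with w h1 h2 h3 h4
    have h5 := congrArg (fun v => inner ℝ v ((principalNormal n x ∘ P) w)) h1
    simp only [sum_inner, inner_add_left, real_inner_smul_left, h2, h3, mul_zero,
      Finset.sum_const_zero, add_zero] at h5
    rw [Function.comp_apply, inner_principalNormal_self (hpar.1 (P w)), mul_one] at h5
    rw [Function.comp_apply, ← h5]
    refine Finset.sum_congr rfl fun i _ => ?_
    simp only [mul_neg, Finset.sum_neg_distrib, neg_inj, Finset.mul_sum]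
    rw [Finset.sum_comm]
    have h6 : ∀ k, ∑ j, (gram (fderiv ℝ (x ∘ P) w))⁻¹ i j *
        (inner ℝ (pd i (principalNormal n x ∘ P) w) (ι (EuclideanSpace.single k 1)) *
          inner ℝ (pd j (x ∘ P) w) (pd k (x ∘ P) w)) =
        inner ℝ (pd i (principalNormal n x ∘ P) w) (ι (EuclideanSpace.single k 1)) *
          if i = k then 1 else 0 := fun k => by
      rw [← h4 i k, Finset.mul_sum]
      exact Finset.sum_congr rfl fun j _ => by ring
    simp only [h6]
    simp

end NormalBundle

/-- By Weingarten and the symmetry of the lowered form, |∇ν|² is the trace of A². This identifies a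
function defined on all of M with its expression in every graph chart. -/
theorem IsShrinkerGerm.eventually_energy_eq {n : ℕ} {V : Type*} [NormedAddCommGroup V]
    [InnerProductSpace ℝ V]
    {Y ν : EuclideanSpace ℝ (Fin n) → V} {H : EuclideanSpace ℝ (Fin n) → ℝ}
    {A : Fin n → Fin n → EuclideanSpace ℝ (Fin n) → ℝ}
    {t : Fin n → EuclideanSpace ℝ (Fin n) → ℝ}
    {G : Fin n → Fin n → EuclideanSpace ℝ (Fin n) → ℝ}
    {ι : EuclideanSpace ℝ (Fin n) →ₗᵢ[ℝ] V} (S : IsShrinkerGerm Y ν H A t G ι) :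
    ∀ᶠ w in 𝓝 0, ∑ i, ∑ j, G i j w * inner ℝ (pd i ν w) (pd j ν w) =
      ∑ i, ∑ k, A i k w * A k i w := by
  filter_upwards [S.weingarten, S.inverse, eventually_all.2 fun j => eventually_all.2
    (S.second_fundamental_form_symm j)] with w h1 h2 h3
  have h4 : ∀ i j, inner ℝ (pd i ν w) (pd j ν w) =
      ∑ k, A k i w * ∑ l, A l k w * inner ℝ (pd j Y w) (pd l Y w) := by
    intro i j
    rw [h1 i, h1 j, inner_neg_neg, sum_inner]
    refine Finset.sum_congr rfl fun k _ => ?_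
    rw [real_inner_smul_left, inner_sum, ← h3 j k]
    simp only [real_inner_smul_right]
  refine Finset.sum_congr rfl fun i _ => ?_
  have h5 : ∀ k l, ∑ j, G i j w * (A k i w * (A l k w * inner ℝ (pd j Y w) (pd l Y w))) =
      A k i w * (A l k w * if i = l then 1 else 0) := fun k l => by
    rw [← h2 i l, Finset.mul_sum, Finset.mul_sum]
    exact Finset.sum_congr rfl fun j _ => by ring
  simp only [h4, Finset.mul_sum]
  rw [Finset.sum_comm]
  refine Finset.sum_congr rfl fun k _ => ?_
  rw [Finset.sum_comm]
  simp only [h5]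
  simp [mul_comm]

/-! ### Parallel principal normal: constancy of |τ|², then of |H|, then of |x|². -/

section ParallelPrincipalNormal

variable {n m : ℕ} {M : Type*} [TopologicalSpace M] [ChartedSpace (EuclideanSpace ℝ (Fin n)) M]
  {x : M → EuclideanSpace ℝ (Fin m)} {q : M}

variable (n) in
/-- The ratio `|∇ν|² / |𝐇|²`. If `ν` is parallel in the normal bundle, then the numerator is the
squared norm of the shape operator of `ν`. -/
noncomputable def shapeRatio (x : M → EuclideanSpace ℝ (Fin m)) (q : M) : ℝ :=
  (∑ i, ∑ j, (inducedMetric n x q)⁻¹ i j *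
    inner ℝ (differential n (principalNormal n x) q (EuclideanSpace.single i 1))
      (differential n (principalNormal n x) q (EuclideanSpace.single j 1))) /
    ‖meanCurvature n x q‖ ^ 2

variable [IsManifold (𝓡 n) ∞ M] (hx : IsSelfShrinker n x)
include hx

theorem IsGraphParam.eventually_shapeRatio_eq
    {ι : EuclideanSpace ℝ (Fin n) →ₗᵢ[ℝ] EuclideanSpace ℝ (Fin m)}
    {P : EuclideanSpace ℝ (Fin n) → M} (hP : IsGraphParam x q ι P)
    (hpar : HasParallelPrincipalNormal n x) :
    shapeRatio n x ∘ P =ᶠ[𝓝 0] fun w => ∑ l, ∑ i,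
      -inner ℝ (pd i (principalNormal n x ∘ P) w) (ι (EuclideanSpace.single l 1)) /
          ((fun q => ‖meanCurvature n x q‖) ∘ P) w *
        (-inner ℝ (pd l (principalNormal n x ∘ P) w) (ι (EuclideanSpace.single i 1)) /
          ((fun q => ‖meanCurvature n x q‖) ∘ P) w) := by
  filter_upwards [(hP.isShrinkerGerm hx hpar).eventually_energy_eq,
    hP.eventually_isParamAt hx.toIsSmoothImmersion] with w h1 h2
  rw [Function.comp_apply, shapeRatio, h2.energy_eq hx.toIsSmoothImmersion
    ((hx.contMDiffAt_principalNormal (hpar.1 _)).of_le (by simp)), h1]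
  simp only [Finset.sum_div]
  refine Finset.sum_congr rfl fun l _ => Finset.sum_congr rfl fun i _ => ?_
  rw [div_mul_div_comm, pow_two]
  rfl

theorem IsSelfShrinker.contMDiff_shapeRatio (hpar : HasParallelPrincipalNormal n x) :
    ContMDiff (𝓡 n) 𝓘(ℝ, ℝ) ∞ (shapeRatio n x) := by
  intro q
  obtain ⟨ι, P, hP⟩ := exists_isGraphParam hx.toIsSmoothImmersion q
  refine hP.contMDiffAt_of_comp hx.toIsSmoothImmersion
    (ContDiffAt.congr_of_eventuallyEq ?_ (hP.eventually_shapeRatio_eq hx hpar))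
  exact ContDiffAt.sum fun l _ => ContDiffAt.sum fun i _ =>
    (hP.isShrinkerGerm hx hpar).smooth_ratio_mul l i

variable [CompactSpace M] (p : M)

/-- Compactness bounds |x| and the ratio itself, hence the drift, uniformly over all graph charts.
-/
theorem IsSelfShrinker.shapeRatio_eq (hpar : HasParallelPrincipalNormal n x) :
    ∀ q ∈ connectedComponent p, shapeRatio n x q = shapeRatio n x p := by
  obtain ⟨R, hR⟩ := isCompact_univ.exists_bound_of_continuousOn
    (hx.contMDiff.continuous.continuousOn (s := Set.univ))
  obtain ⟨B, hB⟩ := isCompact_univ.exists_bound_of_continuousOn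
    ((hx.contMDiff_shapeRatio hpar).continuous.continuousOn (s := Set.univ))
  refine eq_on_connectedComponent hx.toIsSmoothImmersion (hx.contMDiff_shapeRatio hpar) p
    (R + 2 * (n * (√B * R))) fun q _ => ?_
  obtain ⟨ι, P, hP⟩ := exists_isGraphParam hx.toIsSmoothImmersion q
  have S := hP.isShrinkerGerm hx hpar
  have hF := hP.eventually_shapeRatio_eq hx hpar
  refine ⟨ι, P, _, hP, fun k => (S.abs_drift_le hF k).trans ?_,
    S.drift_laplacian_trace_sq_nonneg hF⟩
  have h1 : ‖(x ∘ P) 0‖ ≤ R := hR _ (Set.mem_univ _)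
  have h2 : √((shapeRatio n x ∘ P) 0) ≤ √B :=
    Real.sqrt_le_sqrt ((le_abs_self _).trans (hB _ (Set.mem_univ _)))
  gcongr

/-- The ratio is below 1 at a maximum of |x|², hence on the component, which excludes the rank-one
alternative. So the gradient of |H| vanishes at every point. -/
theorem IsSelfShrinker.norm_meanCurvature_eq (hn : 2 ≤ n) (hpar : HasParallelPrincipalNormal n x) :
    ∀ q ∈ connectedComponent p, ‖meanCurvature n x q‖ = ‖meanCurvature n x p‖ := by
  have hI := hx.toIsSmoothImmersion
  set h : M → ℝ := fun q => ‖meanCurvature n x q‖ with hh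
  have hlt : shapeRatio n x p < 1 := by
    obtain ⟨q, hq, -, hmax⟩ := exists_isLocalMax_connectedComponent n
      (contMDiff_normSq hI).continuous p
    obtain ⟨ι, P, hP⟩ := exists_isGraphParam hI q
    have S := hP.isShrinkerGerm hx hpar
    rw [← hx.shapeRatio_eq p hpar q hq]
    have h1 := S.trace_sq_zero (hP.eventually_shapeRatio_eq hx hpar)
    rw [Function.comp_apply, hP.map_zero] at h1
    rw [h1]
    refine S.trace_sq_lt_one_of_isLocalMax hn ?_
    have := hP.tendsto.eventually hmax
    simpa [IsLocalMax, IsMaxFilter, hP.map_zero] using this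
  have hfderiv : ∀ q ∈ connectedComponent p,
      ∃ (ι : EuclideanSpace ℝ (Fin n) →ₗᵢ[ℝ] EuclideanSpace ℝ (Fin m))
        (P : EuclideanSpace ℝ (Fin n) → M), IsGraphParam x q ι P ∧ fderiv ℝ (h ∘ P) 0 = 0 := by
    intro q hq
    obtain ⟨ι, P, hP⟩ := exists_isGraphParam hI q
    have S := hP.isShrinkerGerm hx hpar
    refine ⟨ι, P, hP, ?_⟩
    have hc : ∀ᶠ w in 𝓝 0, (shapeRatio n x ∘ P) w = shapeRatio n x p :=
      hP.tendsto.eventually (by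
        filter_upwards [connectedComponent_mem_nhds n p hq] with y hy
          using hx.shapeRatio_eq p hpar y hy)
    have hpd := (S.pd_H_eq_zero_or_trace_sq_eq_one (hP.eventually_shapeRatio_eq hx hpar) hc)
      |>.resolve_right
      (by rw [hc.self_of_nhds]; exact hlt.ne)
    ext v
    rw [sum_smul_single v, map_sum]
    simp only [map_smul]
    refine Finset.sum_eq_zero fun k _ => ?_
    rw [show fderiv ℝ (h ∘ P) 0 (EuclideanSpace.single k 1) = 0 from hpd k, smul_zero]
  have hsmooth : ContMDiff (𝓡 n) 𝓘(ℝ, ℝ) ∞ h := fun q =>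
    hx.contMDiffAt_norm_meanCurvature (hpar.1 q)
  refine eq_on_connectedComponent hI hsmooth p 0 fun q hq => ?_
  obtain ⟨ι, P, hP⟩ := exists_isGraphParam hI q
  refine ⟨ι, P, fun _ => 0, hP, fun k => by simp, ?_⟩
  -- The gradient is known to vanish only at the origin of each graph chart. Changing to the chart
  -- centred at `P w` makes it vanish throughout a neighbourhood in one chart, so that second
  -- derivatives vanish too.
  have hzero : ∀ᶠ w in 𝓝 0, fderiv ℝ (h ∘ P) w = 0 := by
    filter_upwards [hP.eventually_smooth,
      hP.tendsto.eventually (connectedComponent_mem_nhds n p hq)] with w h1 h2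
    obtain ⟨ι', P', hP', h3⟩ := hfderiv (P w) h2
    have h4 : h ∘ P =ᶠ[𝓝 w] (h ∘ P') ∘ (graphCoord x ι' (P w) ∘ P) := by
      filter_upwards [h1.continuousAt.eventually hP'.left_inv] with y hy
      simp only [Function.comp_apply, hy]
    have h5 : DifferentiableAt ℝ (graphCoord x ι' (P w) ∘ P) w :=
      (contMDiffAt_iff_contDiffAt.1 (((IsGraphParam.contMDiffAt_graphCoord hI (P w)).of_le
        two_le_infty).comp w h1)).differentiableAt (by simp)
    have h6 : (graphCoord x ι' (P w) ∘ P) w = 0 := IsGraphParam.graphCoord_self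
    have h7 : DifferentiableAt ℝ (h ∘ P') ((graphCoord x ι' (P w) ∘ P) w) := by
      rw [h6]
      exact (hP'.contDiffAt_comp hsmooth.contMDiffAt).differentiableAt (by simp)
    rw [h4.fderiv_eq, fderiv_comp w h7 h5, h6, h3, ContinuousLinearMap.zero_comp]
  have hpd : ∀ k, pd k (h ∘ P) =ᶠ[𝓝 0] fun _ => 0 := fun k =>
    hzero.mono fun w hw => by rw [pd, hw]; rfl
  refine le_of_eq (Finset.sum_eq_zero fun k _ => ?_).symm
  rw [(pd_congr k (hpd k)).self_of_nhds, pd_const, zero_mul, add_zero]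

/-- A maximum of |x|² has |H|² ≥ n, and constancy of |H| spreads this bound over the component. -/
theorem IsSelfShrinker.norm_sq_eq_of_hasParallelPrincipalNormal (hn : 2 ≤ n)
    (hpar : HasParallelPrincipalNormal n x) : ‖x p‖ ^ 2 = n := by
  obtain ⟨q₁, hq₁, -, hmax⟩ := exists_isLocalMax_connectedComponent n
    (contMDiff_normSq hx.toIsSmoothImmersion).continuous p
  refine hx.norm_sq_eq_of_le_meanCurvature p fun q hq => ?_
  rw [hx.norm_meanCurvature_eq p hn hpar q hq, ← hx.norm_meanCurvature_eq p hn hpar q₁ hq₁]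
  exact hx.le_norm_sq_meanCurvature_of_isLocalMax hmax

end ParallelPrincipalNormal

end SelfShrinker

theorem proposition1p8 (n p : ℕ) {M : Type*} [TopologicalSpace M] [T2Space M] [CompactSpace M]
    [ChartedSpace (EuclideanSpace ℝ (Fin n)) M] [IsManifold (𝓡 n) ∞ M]
    (x : M → EuclideanSpace ℝ (Fin (n + p))) (hx : SelfShrinker.IsSelfShrinker n x)
    (h : (2 ≤ n ∧ SelfShrinker.HasParallelPrincipalNormal n x) ∨
      ((∃ c : ℝ, ∀ q, ‖SelfShrinker.meanCurvature n x q‖ ^ 2 = c) ∨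
        (∀ q, ‖SelfShrinker.meanCurvature n x q‖ ^ 2 ≤ (n : ℝ)) ∨
        (∀ q, (n : ℝ) ≤ ‖SelfShrinker.meanCurvature n x q‖ ^ 2)) ∨
      ((∃ c : ℝ, ∀ q, ‖x q‖ ^ 2 = c) ∨
        (∀ q, ‖x q‖ ^ 2 ≤ (n : ℝ)) ∨
        (∀ q, (n : ℝ) ≤ ‖x q‖ ^ 2))) :
    SelfShrinker.IsMinimalInSphere n x (Real.sqrt n) := by
  refine hx.isMinimalInSphere fun q => ?_
  rcases h with ⟨hn, h⟩ | (⟨c, h⟩ | h | h) | (⟨c, h⟩ | h | h)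
  · exact hx.norm_sq_eq_of_hasParallelPrincipalNormal q hn h
  -- At a minimum of |x|² its Laplacian is nonnegative, so |H|² ≤ n there, and hence everywhere when
  -- |H|² is constant.
  · obtain ⟨q₁, -, -, hmin⟩ := SelfShrinker.exists_isLocalMax_connectedComponent n
      (SelfShrinker.contMDiff_neg
        (SelfShrinker.contMDiff_normSq hx.toIsSmoothImmersion)).continuous q
    refine hx.norm_sq_eq_of_meanCurvature_le q fun y _ => ?_
    rw [h y, ← h q₁]
    exact hx.norm_sq_meanCurvature_le_of_isLocalMin hmin
  · exact hx.norm_sq_eq_of_meanCurvature_le q fun y _ => h y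
  · exact hx.norm_sq_eq_of_le_meanCurvature q fun y _ => h y
  · exact hx.norm_sq_eq_of_eventually_const (c := c) (Filter.Eventually.of_forall fun y => by
      rw [real_inner_self_eq_norm_sq, h y])
  -- Here |H| = |x^⊥| ≤ |x| reduces the bound on |x|² to the one on |H|².
  · exact hx.norm_sq_eq_of_meanCurvature_le q fun y _ =>
      (pow_le_pow_left₀ (norm_nonneg _) (hx.norm_meanCurvature_le y) 2).trans (h y)
  · exact hx.norm_sq_eq_of_le q h
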